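/- Let $k$ be a commutative ring. A $k$-dga is an associative unital (not necessarily commutative, unbounded) differential graded $k$-algebra with differential of degree $-1$; weak equivalences are quasi-isomorphisms. For $n\ge 0$, an $n$-th Postnikov section of a dga $C$ is a map $C\to P_nC$ of dgas which is an isomorphism on $H_i$ for $i\le n$ and such that $H_i(P_nC)=0$ for $i>n$. Let $C$ be a non-negative $k$-dga ($C_i=0$ for $i<0$) with $P_nC\simeq C$, and let $M$ be an $H_0(C)$-bimodule (over $k$, i.e. the two actions of $k$ agree), regarded as a $C$-bimodule via $C\to H_0(C)$. Let $C\vee\Sigma^{n+2}M$ be the square-zero extension, a dga over $C$ by projection, and let $$T=\mathrm{Ho}(k\text{-}\mathcal{DGA}_{/C})(C,\ C\vee\Sigma^{n+2}M)$$ be the set of morphisms in the localization of the category of $k$-dgas over $C$ at the quasi-isomorphisms. A Postnikov $(n+1)$-extension of $C$ is a $k$-dga $X$ with $P_{n+1}X\simeq X$ and a dga map $f\colon X\to C$ inducing isomorphisms on $H_i$ for $i\le n$; a map $(X,f)\to(Y,g)$ is a quasi-isomorphism $X\to Y$ of dgas over $C$. For such $(X,f)$, $H_{n+1}(X)$ is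 an $H_0(C)$-bimodule through $H_0(f)\colon H_0(X)\cong H_0(C)$. (1) Let $\mathcal A$ be the category of triples $(X,f,\theta)$, where $(X,f)$ is a Postnikov $(n+1)$-extension of $C$ and $\theta\colon H_{n+1}(X)\to M$ is an isomorphism of $H_0(C)$-bimodules, with maps the maps of extensions compatible with the $\theta$'s. Then there is a bijection $\Phi\colon\pi_0(\mathcal A)\to T$ between the set of connected components of $\mathcal A$ and $T$. It is characterized as follows: if $q\colon C'\to C$ is a quasi-isomorphism of dgas, $a\colon C'\to C\vee\Sigma^{n+2}M$ is a map over $C$, and $X$ is the homotopy pullback of $C'\xrightarrow{a}C\vee\Sigma^{n+2}M\leftarrow C$ (the second map being the inclusion), with $f$ the composite $X\to C'\xrightarrow{q}C$ and $\theta$ the identification given by the long exact homology sequence of the homotopy pullback, then $\Phi$ sends the class of $(X,f,\theta)$ to the homotopy class $[a]\circ[q]^{-1}$. Here the homotopy pullback is the pullback of $a$ along a surjection $p\colon D\to C\vee\Sigma^{n+2}M$ in a factorization $C\xrightarrow{\simeq}D\xrightarrow{p}C\vee\Sigma^{n+2}M$ of the inclusion, and $\theta[x]$ is the $M$-component of $a(c)-p(e)$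 whenever $x\in X_{n+1}$ is a cycle whose images in $C'$ and $D$ are $dc$ and $de$. (2) Let $G$ be the group of $H_0(C)$-bimodule automorphisms of $M$, acting on $T$ through its action on $C\vee\Sigma^{n+2}M$. Let $\mathcal B$ be the category of the Postnikov $(n+1)$-extensions $(X,f)$ of $C$ for which there is some isomorphism $H_{n+1}(X)\cong M$ of $H_0(C)$-bimodules (none being chosen). Then there is a bijection $\Psi\colon\pi_0(\mathcal B)\to T/G$, and it is compatible with $\Phi$: $\Psi[(X,f)]$ is the $G$-orbit of $\Phi[(X,f,\theta)]$ for every object $(X,f,\theta)$ of $\mathcal A$. -/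

import Mathlib

open CategoryTheory

universe u

/-- A differential graded algebra over `k` (unbounded, homologically graded, associative and unital,
not necessarily commutative): a chain complex of `k`-modules with a unit and an associative, unital
`k`-bilinear product satisfying the Leibniz rule.  The product of degrees `i` and `j` may be placed
in any degree `l` that is equal to `i + j`. -/
structure DGA (k : Type u) [CommRing k] where
  cx : ChainComplex (ModuleCat.{u} k) ℤ
  one : cx.X 0
  mul : ∀ {i j l : ℤ}, i + j = l → (cx.X i →ₗ[k] cx.X j →ₗ[k] cx.X l)
  one_mul : ∀ {i : ℤ} (x : cx.X i), mul (zero_add i) one x = x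
  mul_one : ∀ {i : ℤ} (x : cx.X i), mul (add_zero i) x one = x
  mul_assoc : ∀ {i₁ i₂ i₃ i₁₂ i₂₃ i : ℤ} (h₁₂ : i₁ + i₂ = i₁₂) (h₂₃ : i₂ + i₃ = i₂₃)
    (h : i₁₂ + i₃ = i) (h' : i₁ + i₂₃ = i) (x : cx.X i₁) (y : cx.X i₂) (z : cx.X i₃),
    mul h (mul h₁₂ x y) z = mul h' x (mul h₂₃ y z)
  d_one : cx.d 0 (-1) one = 0
  leibniz : ∀ {i i' j j' l l' : ℤ} (_ : i' + 1 = i) (_ : j' + 1 = j)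
    (h : i + j = l) (h₁ : i' + j = l') (h₂ : i + j' = l') (x : cx.X i) (y : cx.X j),
    cx.d l l' (mul h x y) = mul h₁ (cx.d i i' x) y + i.negOnePow • mul h₂ x (cx.d j j' y)

namespace DGA

variable {k : Type u} [CommRing k]

/-- A morphism of dgas: a chain map that preserves the unit and the product. -/
@[ext]
structure Hom (A B : DGA k) where
  φ : A.cx ⟶ B.cx
  map_one : φ.f 0 A.one = B.one
  map_mul : ∀ {i j l : ℤ} (h : i + j = l) (x : A.cx.X i) (y : A.cx.X j),
    φ.f l (A.mul h x y) = B.mul h (φ.f i x) (φ.f j y)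

instance : Category (DGA k) where
  Hom := Hom
  id A := { φ := 𝟙 _, map_one := by simp, map_mul := by simp }
  comp f g :=
    { φ := f.φ ≫ g.φ
      map_one := by simp [f.map_one, g.map_one]
      map_mul := by simp [f.map_mul, g.map_mul] }
  id_comp f := by apply Hom.ext; simp
  comp_id f := by apply Hom.ext; simp
  assoc f g h := by apply Hom.ext; simp

@[ext]
lemma hom_ext {A B : DGA k} {f g : A ⟶ B} (h : f.φ = g.φ) : f = g := Hom.ext h

@[simp] lemma id_φ (A : DGA k) : (𝟙 A : A ⟶ A).φ = 𝟙 A.cx := rfl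

@[simp] lemma comp_φ {A B C : DGA k} (f : A ⟶ B) (g : B ⟶ C) : (f ≫ g).φ = f.φ ≫ g.φ := rfl

/-- The weak equivalences of dgas: the quasi-isomorphisms. -/
def quasiIso (k : Type u) [CommRing k] : MorphismProperty (DGA k) :=
  fun _ _ f => QuasiIso f.φ

/-- Two dgas are quasi-isomorphic if a zigzag of quasi-isomorphisms of dgas joins them. -/
def QuasiIsomorphic (A B : DGA k) : Prop :=
  Relation.EqvGen (fun X Y : DGA k => ∃ f : X ⟶ Y, quasiIso k f) A B

/-- A dga is non-negative if it vanishes in negative degrees. -/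
def NonNeg (C : DGA k) : Prop := ∀ i : ℤ, i < 0 → Subsingleton (C.cx.X i)

/-- `p : C ⟶ P` is an `n`-th Postnikov section of `C`. -/
structure IsPostnikovSection (n : ℕ) {C P : DGA k} (p : C ⟶ P) : Prop where
  subsingleton : ∀ i : ℤ, (n : ℤ) < i → Subsingleton (P.cx.homology i)
  quasiIsoAt : ∀ i : ℤ, i ≤ n → QuasiIsoAt p.φ i

/-- `P_n C ≃ C`: the dga `C` is quasi-isomorphic to its `n`-th Postnikov section. -/
def EqPostnikov (n : ℕ) (C : DGA k) : Prop :=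
  ∃ (P : DGA k) (p : C ⟶ P), IsPostnikovSection n p ∧ QuasiIsomorphic P C

/-! ### Homology classes and products on homology -/

/-- The cycles of degree `i`. -/
def Z (A : DGA k) (i : ℤ) : Submodule k (A.cx.X i) := LinearMap.ker (A.cx.d i (i - 1)).hom

/-- The homology class of a cycle. -/
noncomputable def cls (A : DGA k) (i : ℤ) : A.Z i →ₗ[k] A.cx.homology i :=
  (A.cx.liftCycles (ModuleCat.ofHom (A.Z i).subtype) (i - 1) (by simp)
    (by ext x; exact x.2) ≫ A.cx.homologyπ i).hom

lemma cls_surjective (A : DGA k) (i : ℤ) : Function.Surjective (A.cls i) := by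
  intro y
  obtain ⟨z, rfl⟩ := (ModuleCat.epi_iff_surjective (A.cx.homologyπ i)).1 inferInstance y
  have hz : A.cx.iCycles i z ∈ A.Z i := by
    have : A.cx.iCycles i ≫ A.cx.d i (i - 1) = 0 := by simp
    exact congr($this z)
  refine ⟨⟨A.cx.iCycles i z, hz⟩, ?_⟩
  · simp only [cls, ModuleCat.hom_comp, LinearMap.comp_apply]
    congr 1
    apply (ModuleCat.mono_iff_injective (A.cx.iCycles i)).1 inferInstance
    have := A.cx.liftCycles_i (ModuleCat.ofHom (A.Z i).subtype) (i - 1) (by simp)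
      (by ext x; exact x.2)
    exact congr($this (⟨A.cx.iCycles i z, hz⟩ : A.Z i))

lemma cls_eq_zero_iff (A : DGA k) (i : ℤ) (x : A.Z i) :
    A.cls i x = 0 ↔ ∃ b : A.cx.X (i + 1), A.cx.d (i + 1) i b = x := by
  have hl := A.cx.liftCycles_i (ModuleCat.ofHom (A.Z i).subtype) (i - 1) (by simp)
      (by ext x; exact x.2)
  have hinj := (ModuleCat.mono_iff_injective (A.cx.iCycles i)).1 inferInstance
  have hc := A.cx.toCycles_i (i + 1) i
  constructor
  · intro h
    have hex : (ShortComplex.mk (A.cx.toCycles (i + 1) i) (A.cx.homologyπ i) (by simp)).Exact :=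
      ShortComplex.exact_of_g_is_cokernel _ (A.cx.homologyIsCokernel (i + 1) i (by simp))
    rw [ShortComplex.moduleCat_exact_iff] at hex
    obtain ⟨b, hb⟩ := hex _ h
    refine ⟨b, ?_⟩
    have h1 := congr($hc b)
    have h2 := congr($hl x)
    simp only [ModuleCat.hom_comp, LinearMap.comp_apply] at h1 h2
    rw [← h1]
    exact (congrArg (A.cx.iCycles i) hb).trans h2
  · rintro ⟨b, hb⟩
    have : A.cx.liftCycles (ModuleCat.ofHom (A.Z i).subtype) (i - 1) (by simp)
      (by ext x; exact x.2) x = A.cx.toCycles (i + 1) i b := by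
      apply hinj
      have h1 := congr($hc b)
      have h2 := congr($hl x)
      exact h2.trans (hb.symm.trans h1.symm)
    simp only [cls, ModuleCat.hom_comp, LinearMap.comp_apply]
    erw [this]
    have h3 : A.cx.toCycles (i + 1) i ≫ A.cx.homologyπ i = 0 := by simp
    exact congr($h3 b)

lemma mul_mem_Z (A : DGA k) {i j l : ℤ} (h : i + j = l) {x : A.cx.X i} {y : A.cx.X j}
    (hx : x ∈ A.Z i) (hy : y ∈ A.Z j) : A.mul h x y ∈ A.Z l := by
  have := A.leibniz (i' := i - 1) (j' := j - 1) (l' := l - 1) (by simp) (by simp) h (by omega)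
    (by omega) x y
  have hx' : A.cx.d i (i - 1) x = 0 := hx
  have hy' : A.cx.d j (j - 1) y = 0 := hy
  change A.cx.d l (l - 1) _ = 0
  rw [this, hx', hy']
  simp

/-- The product of cycles. -/
def mulZ (A : DGA k) {i j l : ℤ} (h : i + j = l) (x : A.Z i) (y : A.Z j) : A.Z l :=
  ⟨A.mul h x y, A.mul_mem_Z h x.2 y.2⟩

lemma cls_mulZ_congr (A : DGA k) {i j l : ℤ} (h : i + j = l) {x x' : A.Z i} {y y' : A.Z j}
    (hx : A.cls i x = A.cls i x') (hy : A.cls j y = A.cls j y') :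
    A.cls l (A.mulZ h x y) = A.cls l (A.mulZ h x' y') := by
  rw [← sub_eq_zero, ← map_sub, cls_eq_zero_iff] at hx hy ⊢
  obtain ⟨a, ha⟩ := hx
  obtain ⟨b, hb⟩ := hy
  have hxx : A.cx.d i (i - 1) x' = 0 := x'.2
  have hyy : A.cx.d j (j - 1) y = 0 := y.2
  have e1 := A.leibniz (i' := i) (j' := j - 1) (l' := l) rfl (by simp)
    (show i + 1 + j = l + 1 by omega) h (by omega) a (y : A.cx.X j)
  have e2 := A.leibniz (i' := i - 1) (j' := j) (l' := l) (by simp) rfl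
    (show i + (j + 1) = l + 1 by omega) (by omega) h (x' : A.cx.X i) b
  refine ⟨A.mul (show i + 1 + j = l + 1 by omega) a (y : A.cx.X j) +
    i.negOnePow • A.mul (show i + (j + 1) = l + 1 by omega) (x' : A.cx.X i) b, ?_⟩
  rw [map_add, Units.smul_def, map_zsmul, e1, e2, ha, hb, hxx, hyy]
  simp [mulZ, ← Units.smul_def, smul_smul]

/-- The product `H_i(A) × H_j(A) → H_l(A)` (where `l = i + j`) induced by that of `A`. -/
noncomputable def hmul (A : DGA k) {i j l : ℤ} (h : i + j = l)
    (a : A.cx.homology i) (b : A.cx.homology j) : A.cx.homology l :=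
  A.cls l (A.mulZ h (A.cls_surjective i a).choose (A.cls_surjective j b).choose)

lemma hmul_cls (A : DGA k) {i j l : ℤ} (h : i + j = l) (x : A.Z i) (y : A.Z j) :
    A.hmul h (A.cls i x) (A.cls j y) = A.cls l (A.mulZ h x y) :=
  A.cls_mulZ_congr h (A.cls_surjective i _).choose_spec (A.cls_surjective j _).choose_spec

/-! ### The ring `H_0` -/

/-- The zeroth homology of a dga. -/
def H0 (A : DGA k) : Type u := A.cx.homology 0

noncomputable instance (A : DGA k) : AddCommGroup A.H0 :=
  inferInstanceAs (AddCommGroup (A.cx.homology 0))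

noncomputable instance (A : DGA k) : Module k A.H0 :=
  inferInstanceAs (Module k (A.cx.homology 0))

/-- The class in `H_0(A)` of a cycle of degree `0`. -/
noncomputable def cls0 (A : DGA k) : A.Z 0 →ₗ[k] A.H0 := A.cls 0

lemma cls0_surjective (A : DGA k) : Function.Surjective A.cls0 := A.cls_surjective 0

/-- The unit, as a cycle. -/
def oneZ (A : DGA k) : A.Z 0 := ⟨A.one, A.d_one⟩

noncomputable instance (A : DGA k) : One A.H0 := ⟨A.cls0 A.oneZ⟩

noncomputable instance (A : DGA k) : Mul A.H0 := ⟨A.hmul (add_zero 0)⟩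

lemma cls0_mul (A : DGA k) (x y : A.Z 0) :
    A.cls0 x * A.cls0 y = A.cls0 (A.mulZ (add_zero 0) x y) := A.hmul_cls _ x y

lemma cls0_one (A : DGA k) : A.cls0 A.oneZ = 1 := rfl

noncomputable instance (A : DGA k) : Ring A.H0 :=
  { (inferInstance : AddCommGroup A.H0), (inferInstance : One A.H0),
    (inferInstance : Mul A.H0) with
    one_mul := fun a => by
      obtain ⟨x, rfl⟩ := A.cls0_surjective a
      rw [← cls0_one, cls0_mul]
      congr 1
      exact Subtype.ext (A.one_mul _)
    mul_one := fun a => by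
      obtain ⟨x, rfl⟩ := A.cls0_surjective a
      rw [← cls0_one, cls0_mul]
      congr 1
      exact Subtype.ext (A.mul_one _)
    mul_assoc := fun a b c => by
      obtain ⟨x, rfl⟩ := A.cls0_surjective a
      obtain ⟨y, rfl⟩ := A.cls0_surjective b
      obtain ⟨z, rfl⟩ := A.cls0_surjective c
      simp only [cls0_mul]
      congr 1
      exact Subtype.ext (A.mul_assoc _ _ _ _ _ _ _)
    left_distrib := fun a b c => by
      obtain ⟨x, rfl⟩ := A.cls0_surjective a
      obtain ⟨y, rfl⟩ := A.cls0_surjective b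
      obtain ⟨z, rfl⟩ := A.cls0_surjective c
      simp only [← map_add, cls0_mul]
      congr 1
      exact Subtype.ext (by simp [mulZ])
    right_distrib := fun a b c => by
      obtain ⟨x, rfl⟩ := A.cls0_surjective a
      obtain ⟨y, rfl⟩ := A.cls0_surjective b
      obtain ⟨z, rfl⟩ := A.cls0_surjective c
      simp only [← map_add, cls0_mul]
      congr 1
      exact Subtype.ext (by simp [mulZ])
    zero_mul := fun a => by
      obtain ⟨x, rfl⟩ := A.cls0_surjective a
      rw [← map_zero A.cls0, cls0_mul]
      congr 1
      exact Subtype.ext (by simp [mulZ])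
    mul_zero := fun a => by
      obtain ⟨x, rfl⟩ := A.cls0_surjective a
      rw [← map_zero A.cls0, cls0_mul]
      congr 1
      exact Subtype.ext (by simp [mulZ]) }

lemma cls0_smul_mul (A : DGA k) (r : k) (a b : A.H0) : r • a * b = r • (a * b) := by
  obtain ⟨x, rfl⟩ := A.cls0_surjective a
  obtain ⟨y, rfl⟩ := A.cls0_surjective b
  rw [← map_smul, cls0_mul, cls0_mul, ← map_smul]
  congr 1
  exact Subtype.ext (by simp [mulZ])

lemma cls0_mul_smul (A : DGA k) (r : k) (a b : A.H0) : a * r • b = r • (a * b) := by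
  obtain ⟨x, rfl⟩ := A.cls0_surjective a
  obtain ⟨y, rfl⟩ := A.cls0_surjective b
  rw [← map_smul, cls0_mul, cls0_mul, ← map_smul]
  congr 1
  exact Subtype.ext (by simp [mulZ])

noncomputable instance (A : DGA k) : Algebra k A.H0 :=
  Algebra.ofModule A.cls0_smul_mul A.cls0_mul_smul

/-! ### Square-zero extensions -/

/-- The canonical map `C → H_0(C)` of a non-negative dga, in degree `i`: the class of an element
of degree `0`, and zero on the elements of any other degree. -/
noncomputable def toH0 (C : DGA k) (hC : C.NonNeg) (i : ℤ) : C.cx.X i →ₗ[k] C.H0 :=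
  if h : i = 0 then
    C.cls0.comp (LinearMap.codRestrict (C.Z 0) (C.cx.XIsoOfEq h).hom.hom fun _ =>
      @Subsingleton.elim _ (hC (0 - 1) (by norm_num)) _ _)
  else 0

lemma toH0_zero (C : DGA k) (hC : C.NonNeg) (x : C.cx.X 0) (hx : x ∈ C.Z 0) :
    C.toH0 hC 0 x = C.cls0 ⟨x, hx⟩ := by
  rw [toH0, dif_pos rfl]
  rfl

lemma mem_Z_zero (C : DGA k) (hC : C.NonNeg) (x : C.cx.X 0) : x ∈ C.Z 0 :=
  @Subsingleton.elim _ (hC (0 - 1) (by norm_num)) _ _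

lemma toH0_of_ne (C : DGA k) (hC : C.NonNeg) {i : ℤ} (h : i ≠ 0) (x : C.cx.X i) :
    C.toH0 hC i x = 0 := by
  rw [toH0, dif_neg h]
  rfl

lemma toH0_one (C : DGA k) (hC : C.NonNeg) : C.toH0 hC 0 C.one = 1 :=
  C.toH0_zero hC _ (C.mem_Z_zero hC _)

lemma toH0_mul (C : DGA k) (hC : C.NonNeg) {i j l : ℤ} (h : i + j = l)
    (x : C.cx.X i) (y : C.cx.X j) :
    C.toH0 hC l (C.mul h x y) = C.toH0 hC i x * C.toH0 hC j y := by
  by_cases hi : i = 0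
  · by_cases hj : j = 0
    · subst hi hj
      obtain rfl : l = 0 := by omega
      rw [C.toH0_zero hC _ (C.mem_Z_zero hC _), C.toH0_zero hC _ (C.mem_Z_zero hC _),
        C.toH0_zero hC _ (C.mem_Z_zero hC _), cls0_mul]
      rfl
    · rw [C.toH0_of_ne hC hj, mul_zero, C.toH0_of_ne hC (by omega)]
  · rw [C.toH0_of_ne hC hi, zero_mul]
    by_cases hl : l = 0
    · rcases lt_or_gt_of_ne hi with h' | h'
      · have := hC i h'
        rw [Subsingleton.elim x 0]
        simp
      · have := hC j (by omega)
        rw [Subsingleton.elim y 0]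
        simp
    · exact C.toH0_of_ne hC hl _

lemma toH0_d (C : DGA k) (hC : C.NonNeg) {i j : ℤ} (x : C.cx.X i) :
    C.toH0 hC j (C.cx.d i j x) = 0 := by
  by_cases hj : j = 0
  · subst hj
    by_cases hi : i = 0 + 1
    · subst hi
      rw [C.toH0_zero hC _ (C.mem_Z_zero hC _)]
      exact (C.cls_eq_zero_iff 0 _).2 ⟨x, rfl⟩
    · rw [C.cx.shape i 0 (by simpa [eq_comm] using hi)]
      simp
  · exact C.toH0_of_ne hC hj _

variable (M : Type u) [AddCommGroup M] [Module k M]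

/-- The degree `i` part of the complex `Σ^p M`, which is `M` in degree `p` and zero elsewhere,
as a submodule of `M`. -/
def susp (k : Type u) [CommRing k] (M : Type u) [AddCommGroup M] [Module k M] (p i : ℤ) :
    Submodule k M where
  carrier := {m | i ≠ p → m = 0}
  add_mem' ha hb h := by rw [ha h, hb h, add_zero]
  zero_mem' _ := rfl
  smul_mem' r _ hm h := by rw [hm h, smul_zero]

variable (C : DGA k) (hC : C.NonNeg) [Module C.H0 M] [Module C.H0ᵐᵒᵖ M]
  [SMulCommClass C.H0 C.H0ᵐᵒᵖ M] [IsScalarTower k C.H0 M] [IsScalarTower k C.H0ᵐᵒᵖ M]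

/-- The chain complex `C ⊕ Σ^p M`. -/
noncomputable def sqZeroCx (p : ℤ) : ChainComplex (ModuleCat.{u} k) ℤ where
  X i := ModuleCat.of k (C.cx.X i × susp k M p i)
  d i j := ModuleCat.ofHom
    ((LinearMap.inl k (C.cx.X j) (susp k M p j)).comp
      ((C.cx.d i j).hom.comp (LinearMap.fst k (C.cx.X i) (susp k M p i))))
  shape i j h := ModuleCat.hom_ext <| LinearMap.ext fun x =>
    Prod.ext congr($(C.cx.shape i j h) x.1) rfl
  d_comp_d' i j l _ _ := ModuleCat.hom_ext <| LinearMap.ext fun x =>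
    Prod.ext congr($(C.cx.d_comp_d i j l) x.1) rfl

variable {M} in
set_option linter.unusedSectionVars false in
lemma sqZero_mem (p : ℤ) {i j l : ℤ} (h : i + j = l) (x : C.cx.X i × susp k M p i)
    (y : C.cx.X j × susp k M p j) :
    C.toH0 hC i x.1 • (y.2 : M) + MulOpposite.op (C.toH0 hC j y.1) • (x.2 : M) ∈
      susp k M p l := by
  intro hl
  have h1 : C.toH0 hC i x.1 • (y.2 : M) = 0 := by
    by_cases hi : i = 0
    · rw [y.2.2 (by omega), smul_zero]
    · rw [C.toH0_of_ne hC hi, zero_smul]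
  have h2 : MulOpposite.op (C.toH0 hC j y.1) • (x.2 : M) = 0 := by
    by_cases hj : j = 0
    · rw [x.2.2 (by omega), smul_zero]
    · rw [C.toH0_of_ne hC hj, MulOpposite.op_zero, zero_smul]
  rw [h1, h2, add_zero]

/-- The product `(c, m) (c', m') = (c c', c m' + m c')` of `C ⊕ Σ^p M`. -/
noncomputable def sqZeroMul (p : ℤ) {i j l : ℤ} (h : i + j = l) :
    (C.cx.X i × susp k M p i) →ₗ[k] (C.cx.X j × susp k M p j) →ₗ[k]
      (C.cx.X l × susp k M p l) :=
  LinearMap.mk₂ k (fun x y => (C.mul h x.1 y.1, ⟨_, C.sqZero_mem hC p h x y⟩))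
    (fun x x' y => by
      refine Prod.ext (by simp) (Subtype.ext ?_)
      simp only [Prod.fst_add, Prod.snd_add, map_add, add_smul, Submodule.coe_add, smul_add]
      abel)
    (fun r x y => by
      refine Prod.ext (by simp) (Subtype.ext ?_)
      simp only [Prod.smul_fst, Prod.smul_snd, map_smul, Submodule.coe_smul, smul_add,
        smul_assoc]
      rw [smul_comm r (MulOpposite.op (C.toH0 hC j y.1))])
    (fun x y y' => by
      refine Prod.ext (by simp) (Subtype.ext ?_)
      simp only [Prod.fst_add, Prod.snd_add, map_add, add_smul, Submodule.coe_add, smul_add,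
        MulOpposite.op_add]
      abel)
    (fun r x y => by
      refine Prod.ext (by simp) (Subtype.ext ?_)
      simp only [Prod.smul_fst, Prod.smul_snd, map_smul, Submodule.coe_smul, smul_add,
        MulOpposite.op_smul, smul_assoc]
      rw [smul_comm r (C.toH0 hC i x.1)])

/-- The square-zero extension `C ∨ Σ^p M` of a non-negative dga `C` by the `p`-fold suspension of an
`H_0(C)`-bimodule `M`, which is a `C`-bimodule through `C → H_0(C)`. -/
noncomputable def sqZero (p : ℤ) : DGA k where
  cx := sqZeroCx M C p
  one := (C.one, 0)
  mul h := sqZeroMul M C hC p h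
  one_mul {i} x := Prod.ext (C.one_mul x.1) (Subtype.ext (by
    change C.toH0 hC 0 C.one • (x.2 : M) + MulOpposite.op (C.toH0 hC i x.1) • (0 : M) = x.2
    simp [toH0_one]))
  mul_one {i} x := Prod.ext (C.mul_one x.1) (Subtype.ext (by
    change C.toH0 hC i x.1 • (0 : M) + MulOpposite.op (C.toH0 hC 0 C.one) • (x.2 : M) = x.2
    simp [toH0_one]))
  mul_assoc {i₁ i₂ i₃ i₁₂ i₂₃ i} h₁₂ h₂₃ h h' x y z :=
    Prod.ext (C.mul_assoc h₁₂ h₂₃ h h' x.1 y.1 z.1) (Subtype.ext (by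
      change C.toH0 hC i₁₂ (C.mul h₁₂ x.1 y.1) • (z.2 : M) +
          MulOpposite.op (C.toH0 hC i₃ z.1) •
            (C.toH0 hC i₁ x.1 • (y.2 : M) + MulOpposite.op (C.toH0 hC i₂ y.1) • (x.2 : M)) =
        C.toH0 hC i₁ x.1 •
            (C.toH0 hC i₂ y.1 • (z.2 : M) + MulOpposite.op (C.toH0 hC i₃ z.1) • (y.2 : M)) +
          MulOpposite.op (C.toH0 hC i₂₃ (C.mul h₂₃ y.1 z.1)) • (x.2 : M)
      rw [toH0_mul, toH0_mul, MulOpposite.op_mul, mul_smul, mul_smul, smul_add, smul_add,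
        smul_comm (C.toH0 hC i₁ x.1) (MulOpposite.op (C.toH0 hC i₃ z.1)), add_assoc]))
  d_one := Prod.ext C.d_one rfl
  leibniz {i i' j j' l l'} hi hj h h₁ h₂ x y :=
    Prod.ext (C.leibniz hi hj h h₁ h₂ x.1 y.1) (Subtype.ext (by
      change (0 : M) = (C.toH0 hC i' (C.cx.d i i' x.1) • (y.2 : M) +
          MulOpposite.op (C.toH0 hC j y.1) • (0 : M)) +
        (((i.negOnePow • (⟨_, C.sqZero_mem hC p h₂ x (C.cx.d j j' y.1, 0)⟩ :
          susp k M p l') : susp k M p l')) : M)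
      rw [Units.smul_def, Submodule.coe_smul_of_tower]
      simp [toH0_d]))

/-- The projection `C ∨ Σ^p M ⟶ C`. -/
noncomputable def sqZeroProj (p : ℤ) : sqZero M C hC p ⟶ C where
  φ := { f := fun i => ModuleCat.ofHom (LinearMap.fst k (C.cx.X i) (susp k M p i))
         comm' := fun _ _ _ => rfl }
  map_one := rfl
  map_mul _ _ _ := rfl

/-- The inclusion `C ⟶ C ∨ Σ^p M`. -/
noncomputable def sqZeroIncl (p : ℤ) : C ⟶ sqZero M C hC p where
  φ := { f := fun i => ModuleCat.ofHom (LinearMap.inl k (C.cx.X i) (susp k M p i))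
         comm' := fun _ _ _ => rfl }
  map_one := rfl
  map_mul _ x y := Prod.ext rfl (Subtype.ext (by
    change (0 : M) = C.toH0 hC _ x • (0 : M) + MulOpposite.op (C.toH0 hC _ y) • (0 : M)
    simp))

/-- The group of automorphisms of the `H_0(C)`-bimodule `M` (over `k`). -/
def bimodAut : Subgroup (M ≃ₗ[k] M) where
  carrier := {e | (∀ (a : C.H0) (m : M), e (a • m) = a • e m) ∧
    ∀ (a : C.H0) (m : M), e (MulOpposite.op a • m) = MulOpposite.op a • e m}
  mul_mem' {e e'} he he' := ⟨fun a m => by simp [he.1, he'.1], fun a m => by simp [he.2, he'.2]⟩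
  one_mem' := ⟨fun _ _ => rfl, fun _ _ => rfl⟩
  inv_mem' {e} he := by
    refine ⟨fun a m => e.injective ?_, fun a m => e.injective ?_⟩
    · rw [he.1]
      exact (e.apply_symm_apply _).trans (congrArg _ (e.apply_symm_apply _).symm)
    · rw [he.2]
      exact (e.apply_symm_apply _).trans (congrArg _ (e.apply_symm_apply _).symm)

variable {M}

/-- The map `C ∨ Σ^p M ⟶ C ∨ Σ^p M` induced by an automorphism of `M`. -/
noncomputable def sqZeroMap (p : ℤ) (e : bimodAut M C) : sqZero M C hC p ⟶ sqZero M C hC p where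
  φ := { f := fun i => ModuleCat.ofHom
          (LinearMap.prodMap LinearMap.id
            ((e.1.toLinearMap.restrict fun m (hm : m ∈ susp k M p i) h => by
              simp [hm h] : susp k M p i →ₗ[k] susp k M p i)))
         comm' := fun i j _ => ModuleCat.hom_ext <| LinearMap.ext fun x =>
          Prod.ext rfl (Subtype.ext (map_zero e.1).symm) }
  map_one := Prod.ext rfl (Subtype.ext (map_zero e.1))
  map_mul _ x y := Prod.ext rfl (Subtype.ext (by
    change e.1 (C.toH0 hC _ x.1 • (y.2 : M) + MulOpposite.op (C.toH0 hC _ y.1) • (x.2 : M)) =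
      C.toH0 hC _ x.1 • e.1 (y.2 : M) + MulOpposite.op (C.toH0 hC _ y.1) • e.1 (x.2 : M)
    rw [map_add, e.2.1, e.2.2]))

/-! ### The homotopy category of dgas over `C` -/

/-- The quasi-isomorphisms in the category of dgas over `C`. -/
def overQuasiIso (C : DGA k) : MorphismProperty (Over C) :=
  (quasiIso k).inverseImage (Over.forget C)

/-- The homotopy category `Ho(k-DGA_{/C})`: the localization of the category of dgas over `C` at the
quasi-isomorphisms. -/
abbrev HoOver (C : DGA k) := (overQuasiIso C).Localization

/-- `C`, as a dga over itself. -/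
abbrev overSelf (C : DGA k) : Over C := Over.mk (𝟙 C)

variable (M) in
/-- `C ∨ Σ^p M`, as a dga over `C`. -/
noncomputable abbrev overSqZero (p : ℤ) : Over C := Over.mk (sqZeroProj M C hC p)

variable (M) in
/-- The set of homotopy classes `Ho(k-DGA_{/C})(C, C ∨ Σ^p M)`. -/
def HoClasses (p : ℤ) : Type (u + 1) :=
  (overQuasiIso C).Q.obj (overSelf C) ⟶ (overQuasiIso C).Q.obj (overSqZero M C hC p)

/-- The endomorphism of `C ∨ Σ^p M` over `C` induced by an automorphism of `M`. -/
noncomputable def overSqZeroMap (p : ℤ) (e : bimodAut M C) :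
    overSqZero M C hC p ⟶ overSqZero M C hC p :=
  Over.homMk (sqZeroMap C hC p e) rfl

/-- The action of the bimodule automorphisms of `M` on `Ho(k-DGA_{/C})(C, C ∨ Σ^p M)`. -/
noncomputable instance (p : ℤ) : MulAction (bimodAut M C) (HoClasses M C hC p) where
  smul e α := CategoryStruct.comp (obj := HoOver C) α
    ((overQuasiIso C).Q.map (overSqZeroMap C hC p e))
  one_smul α := by
    have h : (overQuasiIso C).Q.map (overSqZeroMap C hC p (1 : bimodAut M C)) = 𝟙 _ :=
      (overQuasiIso C).Q.map_id _
    exact (congrArg (CategoryStruct.comp (obj := HoOver C) α) h).trans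
      (Category.comp_id (obj := HoOver C) α)
  mul_smul e e' α := by
    have h : (overQuasiIso C).Q.map (overSqZeroMap C hC p (e * e')) =
        (overQuasiIso C).Q.map (overSqZeroMap C hC p e') ≫
          (overQuasiIso C).Q.map (overSqZeroMap C hC p e) :=
      (overQuasiIso C).Q.map_comp (overSqZeroMap C hC p e') (overSqZeroMap C hC p e)
    exact (congrArg (CategoryStruct.comp (obj := HoOver C) α) h).trans
      (Category.assoc (obj := HoOver C) α _ _).symm

/-- The homotopy class of `C ←q- C' -a→ C ∨ Σ^p M`, where `q` is a quasi-isomorphism and `a` is a map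
over `C`. -/
noncomputable def homotopyClass {p : ℤ} {C' : DGA k} (q : C' ⟶ C) (hq : quasiIso k q)
    (a : C' ⟶ sqZero M C hC p) (ha : a ≫ sqZeroProj M C hC p = q) : HoClasses M C hC p :=
  CategoryStruct.comp (obj := HoOver C)
    (Localization.isoOfHom (overQuasiIso C).Q (overQuasiIso C)
      (Over.homMk q : Over.mk q ⟶ overSelf C) hq).inv
    ((overQuasiIso C).Q.map (Over.homMk a ha : Over.mk q ⟶ overSqZero M C hC p))

/-! ### Postnikov extensions -/

/-- A Postnikov `(n+1)`-extension of `C`. -/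
structure PostnikovExt (C : DGA k) (n : ℕ) where
  X : DGA k
  f : X ⟶ C
  eqPostnikov : X.EqPostnikov (n + 1)
  quasiIsoAt : ∀ i : ℤ, i ≤ n → QuasiIsoAt f.φ i

/-- A map of Postnikov extensions of `C`: a quasi-isomorphism over `C`. -/
@[ext]
structure PostnikovExt.Hom {C : DGA k} {n : ℕ} (E F : PostnikovExt C n) where
  g : E.X ⟶ F.X
  quasiIso : quasiIso k g
  comm : g ≫ F.f = E.f

instance (C : DGA k) (n : ℕ) : Category (PostnikovExt C n) where
  Hom := PostnikovExt.Hom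
  id E := ⟨𝟙 _, inferInstanceAs (QuasiIso (𝟙 E.X.cx)), by simp⟩
  comp {E F G} g h := ⟨g.g ≫ h.g, by
    have := g.quasiIso
    have := h.quasiIso
    simp only [DGA.quasiIso, comp_φ] at *
    infer_instance, by simp [h.comm, g.comm]⟩
  id_comp g := by apply PostnikovExt.Hom.ext; simp
  comp_id g := by apply PostnikovExt.Hom.ext; simp
  assoc g h l := by apply PostnikovExt.Hom.ext; simp

/-- The map `H_i(A) → H_i(B)` induced by a map of dgas. -/
noncomputable def hmap {A B : DGA k} (f : A ⟶ B) (i : ℤ) :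
    A.cx.homology i →ₗ[k] B.cx.homology i :=
  (HomologicalComplex.homologyMap f.φ i).hom

/-- The map `H_0(A) → H_0(B)` induced by a map of dgas. -/
noncomputable def h0map {A B : DGA k} (f : A ⟶ B) : A.H0 → B.H0 := hmap f 0

variable (M) {C} {n : ℕ}

/-- An isomorphism of `H_0(C)`-bimodules `H_{n+1}(X) ≅ M`, for a Postnikov `(n+1)`-extension
`f : X ⟶ C`: the ring `H_0(C)` acts on `H_{n+1}(X)` through the isomorphism
`H_0(f) : H_0(X) ≅ H_0(C)`. -/
structure PostnikovExt.BimodIso (E : PostnikovExt C n) where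
  θ : E.X.cx.homology (n + 1) ≃ₗ[k] M
  map_left : ∀ (a : E.X.H0) (y : E.X.cx.homology (n + 1)),
    θ (E.X.hmul (zero_add _) a y) = h0map E.f a • θ y
  map_right : ∀ (a : E.X.H0) (y : E.X.cx.homology (n + 1)),
    θ (E.X.hmul (add_zero _) y a) = MulOpposite.op (h0map E.f a) • θ y

variable (C n)

/-- Postnikov `(n+1)`-extensions `(X, f)` of `C` with an isomorphism of `H_0(C)`-bimodules
`H_{n+1}(X) ≅ M`. -/
structure RigidExt where
  E : PostnikovExt C n
  iso : E.BimodIso M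

/-- A map of Postnikov extensions that is compatible with the isomorphisms to `M`. -/
@[ext]
structure RigidExt.Hom {M : Type u} [AddCommGroup M] [Module k M] {C : DGA k} [Module C.H0 M]
    [Module C.H0ᵐᵒᵖ M] {n : ℕ} (E F : RigidExt M C n) where
  g : E.E ⟶ F.E
  comm : ∀ y, F.iso.θ (hmap (PostnikovExt.Hom.g g) (n + 1) y) = E.iso.θ y

instance : Category (RigidExt M C n) where
  Hom := RigidExt.Hom
  id E := ⟨𝟙 _, fun y => by
    have : hmap (𝟙 E.E.X) (n + 1) = LinearMap.id := by
      simp [hmap]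
    exact congr(E.iso.θ ($this y))⟩
  comp {E F G} g h := ⟨g.g ≫ h.g, fun y => by
    have : hmap (g.g.g ≫ h.g.g) (n + 1) =
        (hmap h.g.g (n + 1)).comp (hmap g.g.g (n + 1)) := by
      simp [hmap, HomologicalComplex.homologyMap_comp]
    rw [← g.comm, ← h.comm]
    exact congr(G.iso.θ ($this y))⟩
  id_comp g := by apply RigidExt.Hom.ext; simp
  comp_id g := by apply RigidExt.Hom.ext; simp
  assoc g h l := by apply RigidExt.Hom.ext; simp

/-- The category of the Postnikov `(n+1)`-extensions `X` of `C` such that `H_{n+1}(X) ≅ M` as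
`H_0(C)`-bimodules (no isomorphism being chosen). -/
abbrev UnrigidExt :=
  ObjectProperty.FullSubcategory fun E : PostnikovExt C n => Nonempty (E.BimodIso M)

variable {M C n} in
/-- Forget the isomorphism `H_{n+1}(X) ≅ M`. -/
def RigidExt.forget (E : RigidExt M C n) : UnrigidExt M C n := ⟨E.E, ⟨E.iso⟩⟩

variable {M C n} in
/-- The extension `X` (with its identification `θ : H_{n+1}(X) ≅ M`) is the homotopy pullback of
`C' -a→ C ∨ Σ^{n+2} M ←- C`, where `q : C' ⟶ C` is a quasi-isomorphism and `a` is a map over `C`.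
The homotopy pullback is formed by a factorization of the inclusion of `C` into a quasi-isomorphism
`j : C ⟶ D` followed by a surjection `p : D ⟶ C ∨ Σ^{n+2} M`; then `X` is the pullback of `a` and
`p`, its map to `C` is the projection to `C'` followed by `q`, and `θ` is given by the connecting
map of the long exact homology sequence of the pullback square: if `x` is a cycle of degree `n + 1`
of `X` whose images in `C'` and `D` are `d c` and `d e`, then `θ [x] = a c - p e` in `M`. -/
def IsHomotopyFiber (E : RigidExt M C n) {C' : DGA k} (q : C' ⟶ C)
    (a : C' ⟶ sqZero M C hC (n + 2)) : Prop :=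
  ∃ (D : DGA k) (j : C ⟶ D) (p : D ⟶ sqZero M C hC (n + 2))
    (u : E.E.X ⟶ C') (v : E.E.X ⟶ D),
    quasiIso k j ∧ j ≫ p = sqZeroIncl M C hC (n + 2) ∧
    (∀ i, Function.Surjective (p.φ.f i)) ∧
    IsPullback u v a p ∧ u ≫ q = E.E.f ∧
    ∀ (x : E.E.X.Z (n + 1)) (c : C'.cx.X (n + 2)) (e : D.cx.X (n + 2)),
      C'.cx.d (n + 2) (n + 1) c = u.φ.f (n + 1) x →
      D.cx.d (n + 2) (n + 1) e = v.φ.f (n + 1) x →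
      E.iso.θ (E.E.X.cls (n + 1) x) =
        (Prod.snd (α := C.cx.X (n + 2)) (β := susp k M (n + 2) (n + 2))
          (a.φ.f (n + 2) c - p.φ.f (n + 2) e) : M)

end DGA

namespace DGA

variable {k : Type u} [CommRing k]

/-! ### Elementwise homology -/

/-! A map from `C` to `C ∨ Σ^{n+2} M` in the homotopy category is a derivation with values in
`Σ^{n+2} M` on some dga `Y` quasi-isomorphic to `C`. Twisting the differential of `Y ⊕ Σ^{n+1} M` by
this derivation gives its homotopy fiber, which is a Postnikov extension (`Span.ext`). Conversely,
adjoining cells that kill `H_{n+1}(X)` and everything above turns an extension `X` into a dga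
equivalent to `C`, and `θ`, read on the new cells, is a derivation (`RigidExt.span`). Both
constructions are explicit, and no model structure is needed.

The homotopy category. If `Z ⟶ C` is surjective, the morphisms from `C` to `Z` in the localization
are the components of the category of spans `C ← C' → Z` (`SpanClass.toHo_bijective`). Spans pull
back along trivial fibrations; path objects over `C` extend this invariance to quasi-isomorphisms,
so span classes form a functor on the localization, and a Yoneda argument at the identity span
compares it with the functor represented by `C`.

The two constructions. The dga `kill` consists of pairs `(x + σ y, c)` with `dσ = 1`, where `y` is
truncated so that only homology in degrees above `n` dies. It is equivalent to `C`
(`killProj_quasiIso`), and the classifying derivation sends `(x + σ y, c)` of degree `n + 2` to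
`θ[y]`. Starting from an extension, one returns to its component through its connective cover
(`spanToExt_extToSpan`). The other composite and the description of `Φ` on homotopy pullbacks both
follow from `RigidExt.span_toHo`: for a homotopy pullback of `a` and `p`, the derivation of `X` is
the difference of one induced by `a` and one induced by `p`. The latter factors through a dga
equivalent to `C`, with a section on which it vanishes, so subtracting it does not change the
homotopy class (`toHo_subHom`).

The second bijection. Changing `θ` by an automorphism of `M` acts on `T` by composition
(`rigidEquiv_twist`), and any two choices of `θ` differ by an automorphism. Forgetting `θ` therefore
amounts to passing to orbits. -/

lemma d_d (A : DGA k) (i j l : ℤ) (x : A.cx.X i) : A.cx.d j l (A.cx.d i j x) = 0 :=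
  congr($(A.cx.d_comp_d i j l) x)

lemma d_of_ne (A : DGA k) {i j : ℤ} (h : j + 1 ≠ i) (x : A.cx.X i) : A.cx.d i j x = 0 :=
  congr($(A.cx.shape i j h) x)

/-- The target degree of `d` is a free index and `d` is zero except in one target degree, so a
single vanishing covers all of them. -/
lemma d_eq_zero (A : DGA k) {i j : ℤ} (j' : ℤ) {x : A.cx.X i} (hj : j + 1 = i)
    (h : A.cx.d i j x = 0) : A.cx.d i j' x = 0 := by
  by_cases h' : j' + 1 = i
  · obtain rfl : j = j' := by omega
    exact h
  · exact A.d_of_ne h' x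

lemma map_d {A B : DGA k} (f : A ⟶ B) {i j : ℤ} (x : A.cx.X i) :
    f.φ.f j (A.cx.d i j x) = B.cx.d i j (f.φ.f i x) :=
  congr($((f.φ.comm i j).symm) x)

lemma hom_ext_apply {A B : DGA k} {f g : A ⟶ B} (h : ∀ i (x : A.cx.X i), f.φ.f i x = g.φ.f i x) :
    f = g := by
  apply hom_ext
  ext i x
  exact h i x

lemma map_mem_Z {A B : DGA k} (f : A ⟶ B) {i : ℤ} {x : A.cx.X i} (hx : x ∈ A.Z i) :
    f.φ.f i x ∈ B.Z i := by
  have hx' : A.cx.d i (i - 1) x = 0 := hx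
  change B.cx.d i (i - 1) _ = 0
  rw [← map_d, hx', map_zero]

lemma hmap_cls {A B : DGA k} (f : A ⟶ B) (i : ℤ) (x : A.Z i) :
    hmap f i (A.cls i x) = B.cls i ⟨f.φ.f i x, map_mem_Z f x.2⟩ := by
  simp only [hmap, cls, ModuleCat.hom_comp, LinearMap.comp_apply]
  have h1 := congr($(HomologicalComplex.homologyπ_naturality f.φ i)
    (A.cx.liftCycles (ModuleCat.ofHom (A.Z i).subtype) (i - 1) (by simp) (by ext x; exact x.2) x))
  refine h1.trans ?_
  change B.cx.homologyπ i _ = B.cx.homologyπ i _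
  congr 1
  apply (ModuleCat.mono_iff_injective (B.cx.iCycles i)).1 inferInstance
  have h2 := congr($(HomologicalComplex.cyclesMap_i f.φ i)
    (A.cx.liftCycles (ModuleCat.ofHom (A.Z i).subtype) (i - 1) (by simp) (by ext x; exact x.2) x))
  have h3 := congr($(A.cx.liftCycles_i (ModuleCat.ofHom (A.Z i).subtype) (i - 1) (by simp)
    (by ext x; exact x.2)) x)
  have h4 := congr($(B.cx.liftCycles_i (ModuleCat.ofHom (B.Z i).subtype) (i - 1) (by simp)
    (by ext x; exact x.2)) ⟨f.φ.f i x, map_mem_Z f x.2⟩)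
  refine h2.trans (Eq.trans ?_ h4.symm)
  exact congrArg (f.φ.f i) h3

lemma quasiIsoAt_iff_bijective {A B : DGA k} (f : A ⟶ B) (i : ℤ) :
    QuasiIsoAt f.φ i ↔ Function.Bijective (hmap f i) := by
  rw [quasiIsoAt_iff_isIso_homologyMap, ConcreteCategory.isIso_iff_bijective]
  rfl

lemma cls_eq_iff (A : DGA k) (i : ℤ) (x y : A.Z i) :
    A.cls i x = A.cls i y ↔ ∃ b : A.cx.X (i + 1), A.cx.d (i + 1) i b = (x : A.cx.X i) - y := by
  rw [← sub_eq_zero, ← map_sub, cls_eq_zero_iff]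
  rfl

/-- Injectivity and surjectivity on homology, unfolded to cycles and bounding chains. In this form
quasi-isomorphisms are checked below by exhibiting elements. -/
lemma quasiIsoAt_iff {A B : DGA k} (f : A ⟶ B) (i : ℤ) :
    QuasiIsoAt f.φ i ↔
      (∀ x : A.cx.X i, A.cx.d i (i - 1) x = 0 → ∀ b : B.cx.X (i + 1),
        B.cx.d (i + 1) i b = f.φ.f i x → ∃ c : A.cx.X (i + 1), A.cx.d (i + 1) i c = x) ∧
      (∀ y : B.cx.X i, B.cx.d i (i - 1) y = 0 → ∃ x : A.cx.X i, A.cx.d i (i - 1) x = 0 ∧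
        ∃ b : B.cx.X (i + 1), B.cx.d (i + 1) i b = f.φ.f i x - y) := by
  rw [quasiIsoAt_iff_bijective, Function.Bijective, injective_iff_map_eq_zero]
  refine and_congr ⟨fun h x hx b hb => ?_, fun h a ha => ?_⟩ ⟨fun h y hy => ?_, fun h a => ?_⟩
  · exact (A.cls_eq_zero_iff i ⟨x, hx⟩).1
      (h _ ((hmap_cls f i ⟨x, hx⟩).trans ((B.cls_eq_zero_iff i _).2 ⟨b, hb⟩)))
  · obtain ⟨x, rfl⟩ := A.cls_surjective i a
    rw [hmap_cls, cls_eq_zero_iff] at ha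
    obtain ⟨b, hb⟩ := ha
    exact (A.cls_eq_zero_iff i x).2 (h x x.2 b hb)
  · obtain ⟨a, ha⟩ := h (B.cls i ⟨y, hy⟩)
    obtain ⟨x, rfl⟩ := A.cls_surjective i a
    rw [hmap_cls, cls_eq_iff] at ha
    exact ⟨x, x.2, ha⟩
  · obtain ⟨y, rfl⟩ := B.cls_surjective i a
    obtain ⟨x, hx, b, hb⟩ := h y y.2
    exact ⟨A.cls i ⟨x, hx⟩, by rw [hmap_cls, cls_eq_iff]; exact ⟨b, hb⟩⟩

lemma quasiIso_iff {A B : DGA k} (f : A ⟶ B) : quasiIso k f ↔ ∀ i, QuasiIsoAt f.φ i :=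
  _root_.quasiIso_iff f.φ

lemma quasiIso_comp {A B D : DGA k} {f : A ⟶ B} {g : B ⟶ D} (hf : quasiIso k f)
    (hg : quasiIso k g) : quasiIso k (f ≫ g) := by
  have : QuasiIso f.φ := hf
  have : QuasiIso g.φ := hg
  exact inferInstanceAs (QuasiIso (f.φ ≫ g.φ))

lemma quasiIso_of_comp_right {A B D : DGA k} {f : A ⟶ B} {g : B ⟶ D} (hg : quasiIso k g)
    (h : quasiIso k (f ≫ g)) : quasiIso k f := by
  have : QuasiIso g.φ := hg
  have : QuasiIso (f.φ ≫ g.φ) := h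
  exact _root_.quasiIso_of_comp_right f.φ g.φ

lemma quasiIso_of_comp_left {A B D : DGA k} {f : A ⟶ B} {g : B ⟶ D} (hf : quasiIso k f)
    (h : quasiIso k (f ≫ g)) : quasiIso k g := by
  have : QuasiIso f.φ := hf
  have : QuasiIso (f.φ ≫ g.φ) := h
  exact _root_.quasiIso_of_comp_left f.φ g.φ

lemma quasiIso_id (A : DGA k) : quasiIso k (𝟙 A) := inferInstanceAs (QuasiIso (𝟙 A.cx))

lemma subsingleton_homology_iff (A : DGA k) (i : ℤ) :
    Subsingleton (A.cx.homology i) ↔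
      ∀ x : A.cx.X i, A.cx.d i (i - 1) x = 0 → ∃ b : A.cx.X (i + 1), A.cx.d (i + 1) i b = x := by
  refine ⟨fun h x hx => (A.cls_eq_zero_iff i ⟨x, hx⟩).1 (Subsingleton.elim _ _), fun h => ?_⟩
  refine subsingleton_of_forall_eq 0 fun a => ?_
  obtain ⟨x, rfl⟩ := A.cls_surjective i a
  exact (A.cls_eq_zero_iff i x).2 (h x x.2)

lemma subsingleton_homology_congr {A B : DGA k} {f : A ⟶ B} {i : ℤ} (h : QuasiIsoAt f.φ i) :
    Subsingleton (A.cx.homology i) ↔ Subsingleton (B.cx.homology i) :=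
  (Equiv.ofBijective _ ((quasiIsoAt_iff_bijective f i).1 h)).subsingleton_congr

/-- Vanishing of `H_i` passes along a zigzag of quasi-isomorphisms in either direction. This
converts `P_n C ≃ C` into a condition on homology alone. -/
lemma EqPostnikov.subsingleton {n : ℕ} {C : DGA k} (h : C.EqPostnikov n) {i : ℤ} (hi : (n : ℤ) < i) :
    Subsingleton (C.cx.homology i) := by
  obtain ⟨P, p, hp, hPC⟩ := h
  have key : ∀ A B : DGA k, QuasiIsomorphic A B →
      (Subsingleton (A.cx.homology i) ↔ Subsingleton (B.cx.homology i)) := by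
    intro A B hAB
    induction hAB with
    | rel A B h =>
      obtain ⟨f, hf⟩ := h
      exact subsingleton_homology_congr ((quasiIso_iff f).1 hf i)
    | refl A => rfl
    | symm A B _ ih => exact ih.symm
    | trans A B D _ _ ih ih' => exact ih.trans ih'
  exact (key P C hPC).1 (hp.subsingleton i hi)

/-- Such a dga is its own Postnikov section, by the identity. -/
lemma eqPostnikov_of_subsingleton {n : ℕ} {C : DGA k}
    (h : ∀ i : ℤ, (n : ℤ) < i → Subsingleton (C.cx.homology i)) : C.EqPostnikov n :=
  ⟨C, 𝟙 C, ⟨h, fun i _ => (quasiIso_iff _).1 (quasiIso_id C) i⟩, .refl _⟩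

/-! ### Trivial fibrations -/

/-- A trivial fibration of dgas: a surjection with acyclic kernel. -/
structure IsTrivFib {A B : DGA k} (p : A ⟶ B) : Prop where
  surj : ∀ i, Function.Surjective (p.φ.f i)
  exists_d : ∀ (i : ℤ) (x : A.cx.X i), p.φ.f i x = 0 → A.cx.d i (i - 1) x = 0 →
    ∃ b : A.cx.X (i + 1), p.φ.f (i + 1) b = 0 ∧ A.cx.d (i + 1) i b = x

lemma IsTrivFib.quasiIso {A B : DGA k} {p : A ⟶ B} (hp : IsTrivFib p) : quasiIso k p := by
  rw [quasiIso_iff]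
  intro i
  rw [quasiIsoAt_iff]
  refine ⟨fun x hx b hb => ?_, fun y hy => ?_⟩
  · obtain ⟨c, rfl⟩ := hp.surj _ b
    obtain ⟨e, -, he⟩ := hp.exists_d i (x - A.cx.d (i + 1) i c) (by rw [map_sub, map_d, hb, sub_self])
      (by rw [map_sub, hx, d_d, sub_zero])
    exact ⟨e + c, by rw [map_add, he]; abel⟩
  · obtain ⟨x, rfl⟩ := hp.surj _ y
    have hx : A.cx.d (i - 1) (i - 1 - 1) (A.cx.d i (i - 1) x) = 0 := A.d_d ..
    obtain ⟨e, he, he'⟩ := hp.exists_d (i - 1) (A.cx.d i (i - 1) x) (by rw [map_d, hy]) hx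
    -- The correction `e` lives in degree `i - 1 + 1`, which is only propositionally `i`.
    obtain ⟨e', he1, he2⟩ : ∃ e' : A.cx.X i, p.φ.f i e' = 0 ∧
        A.cx.d i (i - 1) e' = A.cx.d i (i - 1) x := by
      have hi : i - 1 + 1 = i := by omega
      generalize i - 1 + 1 = i' at *
      subst hi
      exact ⟨e, he, he'⟩
    exact ⟨x - e', by rw [map_sub, he2, sub_self], 0, by rw [map_zero, map_sub, he1]; simp⟩

/-- Let `x` be a cycle in the kernel and `x = d c`. Then `p c` is a cycle, hence `p c = p z - d (p
b)` for some cycle `z` of `A` and some `b`. The chain `c - z + d b` lies in the kernel and still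
bounds `x`. -/
lemma isTrivFib_of_quasiIso {A B : DGA k} {p : A ⟶ B} (hp : ∀ i, Function.Surjective (p.φ.f i))
    (h : DGA.quasiIso k p) : IsTrivFib p := by
  rw [quasiIso_iff] at h
  refine ⟨hp, fun i x hx hdx => ?_⟩
  obtain ⟨c, hc⟩ := ((quasiIsoAt_iff p i).1 (h i)).1 x hdx 0 (by rw [map_zero, hx])
  obtain ⟨z, hz, b, hb⟩ := ((quasiIsoAt_iff p (i + 1)).1 (h (i + 1))).2 (p.φ.f (i + 1) c)
    (by rw [← map_d, B.d_eq_zero _ (j := i) rfl (by rw [← map_d, hc, hx] : B.cx.d (i + 1) i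
      (p.φ.f (i + 1) c) = 0) |> (map_d p c).trans])
  obtain ⟨b, rfl⟩ := hp _ b
  refine ⟨c - z + A.cx.d (i + 1 + 1) (i + 1) b, ?_, ?_⟩
  · rw [map_add, map_sub, map_d, hb]
    abel
  · rw [map_add, map_sub, hc, d_d, A.d_eq_zero _ (by omega) hz]
    simp

/-! ### Constructors for dgas and their morphisms -/

/-- A construction of dgas from graded modules: the underlying data need not be bundled. -/
def mk' (X : ℤ → Type u) [∀ i, AddCommGroup (X i)] [∀ i, Module k (X i)]
    (d : ∀ i j, X i →ₗ[k] X j) (shape : ∀ i j, j + 1 ≠ i → ∀ x, d i j x = 0)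
    (d_d : ∀ i j l, j + 1 = i → l + 1 = j → ∀ x, d j l (d i j x) = 0)
    (one : X 0) (mul : ∀ {i j l : ℤ}, i + j = l → (X i →ₗ[k] X j →ₗ[k] X l))
    (one_mul : ∀ {i : ℤ} (x : X i), mul (zero_add i) one x = x)
    (mul_one : ∀ {i : ℤ} (x : X i), mul (add_zero i) x one = x)
    (mul_assoc : ∀ {i₁ i₂ i₃ i₁₂ i₂₃ i : ℤ} (h₁₂ : i₁ + i₂ = i₁₂) (h₂₃ : i₂ + i₃ = i₂₃)
      (h : i₁₂ + i₃ = i) (h' : i₁ + i₂₃ = i) (x : X i₁) (y : X i₂) (z : X i₃),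
      mul h (mul h₁₂ x y) z = mul h' x (mul h₂₃ y z))
    (d_one : d 0 (-1) one = 0)
    (leibniz : ∀ {i i' j j' l l' : ℤ} (_ : i' + 1 = i) (_ : j' + 1 = j)
      (h : i + j = l) (h₁ : i' + j = l') (h₂ : i + j' = l') (x : X i) (y : X j),
      d l l' (mul h x y) = mul h₁ (d i i' x) y + i.negOnePow • mul h₂ x (d j j' y)) : DGA k where
  cx :=
    { X i := ModuleCat.of k (X i)
      d i j := ModuleCat.ofHom (d i j)
      shape i j h := ModuleCat.hom_ext <| LinearMap.ext fun x => shape i j h x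
      d_comp_d' i j l hij hjl := ModuleCat.hom_ext <| LinearMap.ext fun x => d_d i j l hij hjl x }
  one := one
  mul := mul
  one_mul := one_mul
  mul_one := mul_one
  mul_assoc := mul_assoc
  d_one := d_one
  leibniz := leibniz

/-- A construction of morphisms of dgas from linear maps. -/
def homMk {A B : DGA k} (f : ∀ i, A.cx.X i →ₗ[k] B.cx.X i)
    (hd : ∀ i j (x : A.cx.X i), j + 1 = i → f j (A.cx.d i j x) = B.cx.d i j (f i x))
    (h1 : f 0 A.one = B.one)
    (hmul : ∀ {i j l : ℤ} (h : i + j = l) (x : A.cx.X i) (y : A.cx.X j),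
      f l (A.mul h x y) = B.mul h (f i x) (f j y)) : A ⟶ B where
  φ := { f := fun i => ModuleCat.ofHom (f i)
         comm' := fun i j h => ModuleCat.hom_ext <| LinearMap.ext fun x => (hd i j x h).symm }
  map_one := h1
  map_mul := hmul

/-! ### Products and sub-dgas -/

/-- The product of two dgas. -/
def prod (A B : DGA k) : DGA k :=
  mk' (fun i => A.cx.X i × B.cx.X i)
    (fun i j => LinearMap.prodMap (A.cx.d i j).hom (B.cx.d i j).hom)
    (fun i j h x => Prod.ext (A.d_of_ne h _) (B.d_of_ne h _))
    (fun i j l _ _ x => Prod.ext (A.d_d ..) (B.d_d ..))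
    (A.one, B.one)
    (fun h => LinearMap.mk₂ k (fun x y => (A.mul h x.1 y.1, B.mul h x.2 y.2))
      (fun _ _ _ => by simp) (fun _ _ _ => by simp) (fun _ _ _ => by simp) (fun _ _ _ => by simp))
    (fun x => Prod.ext (A.one_mul _) (B.one_mul _))
    (fun x => Prod.ext (A.mul_one _) (B.mul_one _))
    (fun h₁₂ h₂₃ h h' x y z => Prod.ext (A.mul_assoc h₁₂ h₂₃ h h' ..) (B.mul_assoc h₁₂ h₂₃ h h' ..))
    (Prod.ext A.d_one B.d_one)
    (fun hi hj h h₁ h₂ x y => Prod.ext (A.leibniz hi hj h h₁ h₂ ..) (B.leibniz hi hj h h₁ h₂ ..))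

/-- The first projection. -/
def prodFst (A B : DGA k) : prod A B ⟶ A :=
  homMk (fun _ => LinearMap.fst k _ _) (fun _ _ _ _ => rfl) rfl (fun _ _ _ => rfl)

/-- The second projection. -/
def prodSnd (A B : DGA k) : prod A B ⟶ B :=
  homMk (fun _ => LinearMap.snd k _ _) (fun _ _ _ _ => rfl) rfl (fun _ _ _ => rfl)

/-- The map to a product with given components. -/
def prodLift {A B D : DGA k} (f : D ⟶ A) (g : D ⟶ B) : D ⟶ prod A B :=
  homMk (fun i => LinearMap.prod (f.φ.f i).hom (g.φ.f i).hom)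
    (fun _ _ x _ => Prod.ext (map_d f x) (map_d g x)) (Prod.ext f.map_one g.map_one)
    (fun h x y => Prod.ext (f.map_mul h x y) (g.map_mul h x y))

variable (k) in
/-- A sub-dga. -/
structure Sub (A : DGA k) where
  carrier : ∀ i, Submodule k (A.cx.X i)
  one_mem : A.one ∈ carrier 0
  mul_mem : ∀ {i j l : ℤ} (h : i + j = l) {x : A.cx.X i} {y : A.cx.X j},
    x ∈ carrier i → y ∈ carrier j → A.mul h x y ∈ carrier l
  d_mem : ∀ {i j : ℤ} (_ : j + 1 = i) {x : A.cx.X i}, x ∈ carrier i → A.cx.d i j x ∈ carrier j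

namespace Sub

variable {A : DGA k} (S : Sub k A)

/-- A sub-dga, as a dga. -/
def toDGA : DGA k :=
  mk' (fun i => S.carrier i)
    (fun i j => LinearMap.restrict (A.cx.d i j).hom fun x hx => by
      by_cases h : j + 1 = i
      · exact S.d_mem h hx
      · have : A.cx.d i j x = 0 := A.d_of_ne h x
        change A.cx.d i j x ∈ _
        rw [this]
        exact zero_mem _)
    (fun i j h x => Subtype.ext (A.d_of_ne h _))
    (fun i j l _ _ x => Subtype.ext (A.d_d ..))
    ⟨A.one, S.one_mem⟩
    (fun h => LinearMap.mk₂ k (fun x y => ⟨A.mul h x y, S.mul_mem h x.2 y.2⟩)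
      (fun _ _ _ => Subtype.ext (by simp)) (fun _ _ _ => Subtype.ext (by simp))
      (fun _ _ _ => Subtype.ext (by simp)) (fun _ _ _ => Subtype.ext (by simp)))
    (fun x => Subtype.ext (A.one_mul _))
    (fun x => Subtype.ext (A.mul_one _))
    (fun h₁₂ h₂₃ h h' x y z => Subtype.ext (A.mul_assoc h₁₂ h₂₃ h h' ..))
    (Subtype.ext A.d_one)
    (fun {i i' j j' l l'} hi hj h h₁ h₂ x y => Subtype.ext (by
      refine (A.leibniz hi hj h h₁ h₂ (x : A.cx.X i) (y : A.cx.X j)).trans ?_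
      rw [Submodule.coe_add, Units.smul_def, Units.smul_def, Submodule.coe_smul_of_tower]
      rfl))

/-- The inclusion of a sub-dga. -/
def incl : S.toDGA ⟶ A :=
  homMk (fun i => (S.carrier i).subtype) (fun _ _ _ _ => rfl) rfl (fun _ _ _ => rfl)

/-- The restriction of the codomain of a morphism to a sub-dga. -/
def lift {B : DGA k} (f : B ⟶ A) (hf : ∀ i x, f.φ.f i x ∈ S.carrier i) : B ⟶ S.toDGA :=
  homMk (fun i => LinearMap.codRestrict (S.carrier i) (f.φ.f i).hom (hf i))
    (fun _ _ x _ => Subtype.ext (map_d f x)) (Subtype.ext f.map_one)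
    (fun h x y => Subtype.ext (f.map_mul h x y))

end Sub

/-- The sub-dga on which two morphisms agree. -/
def eqLocus {A B : DGA k} (f g : A ⟶ B) : Sub k A where
  carrier i := LinearMap.eqLocus (f.φ.f i).hom (g.φ.f i).hom
  one_mem := f.map_one.trans g.map_one.symm
  mul_mem {i j l} h x y hx hy := by
    have hx' : f.φ.f i x = g.φ.f i x := hx
    have hy' : f.φ.f j y = g.φ.f j y := hy
    change f.φ.f _ (A.mul h x y) = g.φ.f _ (A.mul h x y)
    rw [f.map_mul, g.map_mul, hx', hy']
  d_mem {i j} h x hx := by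
    have hx' : f.φ.f i x = g.φ.f i x := hx
    change f.φ.f _ (A.cx.d i j x) = g.φ.f _ (A.cx.d i j x)
    rw [map_d, map_d, hx']

/-! ### Pullbacks -/

section Pullback

variable {A B D : DGA k} (f : A ⟶ D) (g : B ⟶ D)

/-- The sub-dga `A ×_D B` of `A × B`. -/
def pbSub : Sub k (prod A B) := eqLocus (prodFst A B ≫ f) (prodSnd A B ≫ g)

/-- The pullback `A ×_D B`. -/
def pb : DGA k := (pbSub f g).toDGA

/-- The first projection of the pullback. -/
def pbFst : pb f g ⟶ A := (pbSub f g).incl ≫ prodFst A B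

/-- The second projection of the pullback. -/
def pbSnd : pb f g ⟶ B := (pbSub f g).incl ≫ prodSnd A B

lemma pb_condition : pbFst f g ≫ f = pbSnd f g ≫ g := hom_ext_apply fun _ x => x.2

variable {f g} in
/-- The map to the pullback with given components. -/
def pbLift {E : DGA k} (a : E ⟶ A) (b : E ⟶ B) (h : a ≫ f = b ≫ g) : E ⟶ pb f g :=
  (pbSub f g).lift (prodLift a b) fun i x => congr(($h).φ.f i x)

variable {f g} in
lemma pbLift_fst {E : DGA k} (a : E ⟶ A) (b : E ⟶ B) (h : a ≫ f = b ≫ g) :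
    pbLift a b h ≫ pbFst f g = a := rfl

variable {f g} in
lemma pbLift_snd {E : DGA k} (a : E ⟶ A) (b : E ⟶ B) (h : a ≫ f = b ≫ g) :
    pbLift a b h ≫ pbSnd f g = b := rfl

variable {g} in
-- Base change does not alter the kernel.
lemma IsTrivFib.pbFst (hg : IsTrivFib g) : IsTrivFib (pbFst f g) where
  surj i x := by
    obtain ⟨y, hy⟩ := hg.surj i (f.φ.f i x)
    exact ⟨⟨(x, y), hy.symm⟩, rfl⟩
  exists_d := by
    rintro i ⟨⟨x, y⟩, hxy⟩ hx hd
    obtain rfl : x = 0 := hx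
    have hy : g.φ.f i y = 0 := by
      have : f.φ.f i 0 = g.φ.f i y := hxy
      rw [← this, map_zero]
    obtain ⟨b, hb, hb'⟩ := hg.exists_d i y hy congr(($hd).1.2)
    exact ⟨⟨(0, b), (map_zero (f.φ.f (i + 1)).hom).trans hb.symm⟩, rfl,
      Subtype.ext (Prod.ext (map_zero (A.cx.d (i + 1) i).hom) hb')⟩

end Pullback

/-! ### Mapping path dgas and cones -/

/-- The identification of equal degrees, extended by zero. -/
def shift (A : DGA k) (i j : ℤ) : A.cx.X i →ₗ[k] A.cx.X j :=
  if h : i = j then (A.cx.XIsoOfEq h).hom.hom else 0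

@[simp]
lemma shift_self (A : DGA k) (i : ℤ) (x : A.cx.X i) : A.shift i i x = x := by
  rw [shift, dif_pos rfl]
  rfl

lemma shift_of_ne (A : DGA k) {i j : ℤ} (h : i ≠ j) (x : A.cx.X i) : A.shift i j x = 0 := by
  rw [shift, dif_neg h]
  rfl

lemma map_shift {A B : DGA k} (f : A ⟶ B) (i j : ℤ) (x : A.cx.X i) :
    f.φ.f j (A.shift i j x) = B.shift i j (f.φ.f i x) := by
  by_cases h : i = j
  · subst h
    simp
  · rw [shift_of_ne _ h, shift_of_ne _ h, map_zero]

/-- The product `(z, y, γ) (z', y', γ') = (z z', y y', γ y' + (-1)^i g(z) γ')` of the mapping path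
dga. -/
def pathMul {Z Y : DGA k} (g : Z ⟶ Y) {i j l : ℤ} (h : i + j = l) :
    (Z.cx.X i × Y.cx.X i × Y.cx.X (i + 1)) →ₗ[k] (Z.cx.X j × Y.cx.X j × Y.cx.X (j + 1)) →ₗ[k]
      (Z.cx.X l × Y.cx.X l × Y.cx.X (l + 1)) :=
  LinearMap.mk₂ k (fun u v => (Z.mul h u.1 v.1, Y.mul h u.2.1 v.2.1,
      Y.mul (show i + 1 + j = l + 1 by omega) u.2.2 v.2.1 +
        i.negOnePow • Y.mul (show i + (j + 1) = l + 1 by omega) (g.φ.f i u.1) v.2.2))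
    (fun u u' v => by
      refine Prod.ext (by simp) (Prod.ext (by simp) ?_)
      rcases Int.units_eq_one_or i.negOnePow with h | h <;> simp [h] <;> abel)
    (fun r u v => by
      refine Prod.ext (by simp) (Prod.ext (by simp) ?_)
      rcases Int.units_eq_one_or i.negOnePow with h | h <;> simp [h])
    (fun u v v' => by
      refine Prod.ext (by simp) (Prod.ext (by simp) ?_)
      rcases Int.units_eq_one_or i.negOnePow with h | h <;> simp [h] <;> abel)
    (fun r u v => by
      refine Prod.ext (by simp) (Prod.ext (by simp) ?_)
      rcases Int.units_eq_one_or i.negOnePow with h | h <;> simp [h])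

/-- The differential `d (z, y, γ) = (d z, d y, g z - y - d γ)` of the mapping path dga. -/
def pathD {Z Y : DGA k} (g : Z ⟶ Y) (i j : ℤ) :
    (Z.cx.X i × Y.cx.X i × Y.cx.X (i + 1)) →ₗ[k] (Z.cx.X j × Y.cx.X j × Y.cx.X (j + 1)) :=
  LinearMap.prod ((Z.cx.d i j).hom ∘ₗ LinearMap.fst k _ _)
    (LinearMap.prod ((Y.cx.d i j).hom ∘ₗ LinearMap.fst k _ _ ∘ₗ LinearMap.snd k _ _)
      (Y.shift i (j + 1) ∘ₗ ((g.φ.f i).hom ∘ₗ LinearMap.fst k _ _ -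
          LinearMap.fst k _ _ ∘ₗ LinearMap.snd k _ _) -
        (Y.cx.d (i + 1) (j + 1)).hom ∘ₗ LinearMap.snd k _ _ ∘ₗ LinearMap.snd k _ _))

lemma pathD_apply {Z Y : DGA k} (g : Z ⟶ Y) (i j : ℤ)
    (u : Z.cx.X i × Y.cx.X i × Y.cx.X (i + 1)) :
    pathD g i j u = (Z.cx.d i j u.1, Y.cx.d i j u.2.1,
      Y.shift i (j + 1) (g.φ.f i u.1 - u.2.1) - Y.cx.d (i + 1) (j + 1) u.2.2) := rfl

lemma pathMul_apply {Z Y : DGA k} (g : Z ⟶ Y) {i j l : ℤ} (h : i + j = l)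
    (u : Z.cx.X i × Y.cx.X i × Y.cx.X (i + 1)) (v : Z.cx.X j × Y.cx.X j × Y.cx.X (j + 1)) :
    pathMul g h u v = (Z.mul h u.1 v.1, Y.mul h u.2.1 v.2.1,
      Y.mul (show i + 1 + j = l + 1 by omega) u.2.2 v.2.1 +
        i.negOnePow • Y.mul (show i + (j + 1) = l + 1 by omega) (g.φ.f i u.1) v.2.2) := rfl

/-- The paths `γ` form a shifted bimodule, with left action through `g z` and right action through
`y`. The sign `(-1)^i` is the cost of moving the shift past an element of degree `i`; it is
multiplicative in the degrees. -/
lemma pathMul_assoc {Z Y : DGA k} (g : Z ⟶ Y) {i₁ i₂ i₃ i₁₂ i₂₃ i : ℤ} (h₁₂ : i₁ + i₂ = i₁₂)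
    (h₂₃ : i₂ + i₃ = i₂₃) (h : i₁₂ + i₃ = i) (h' : i₁ + i₂₃ = i)
    (x : Z.cx.X i₁ × Y.cx.X i₁ × Y.cx.X (i₁ + 1)) (y : Z.cx.X i₂ × Y.cx.X i₂ × Y.cx.X (i₂ + 1))
    (z : Z.cx.X i₃ × Y.cx.X i₃ × Y.cx.X (i₃ + 1)) :
    pathMul g h (pathMul g h₁₂ x y) z = pathMul g h' x (pathMul g h₂₃ y z) := by
  refine Prod.ext (Z.mul_assoc ..) (Prod.ext (Y.mul_assoc ..) ?_)
  simp only [pathMul_apply, map_add, LinearMap.add_apply, g.map_mul]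
  have e1 := Y.mul_assoc (show i₁ + 1 + i₂ = i₁₂ + 1 by omega) h₂₃
    (show i₁₂ + 1 + i₃ = i + 1 by omega) (by omega) x.2.2 y.2.1 z.2.1
  have e2 := Y.mul_assoc (show i₁ + (i₂ + 1) = i₁₂ + 1 by omega)
    (show i₂ + 1 + i₃ = i₂₃ + 1 by omega) (show i₁₂ + 1 + i₃ = i + 1 by omega)
    (by omega) (g.φ.f _ x.1) y.2.2 z.2.1
  have e3 := Y.mul_assoc h₁₂ (show i₂ + (i₃ + 1) = i₂₃ + 1 by omega)
    (show i₁₂ + (i₃ + 1) = i + 1 by omega) (by omega) (g.φ.f _ x.1) (g.φ.f _ y.1) z.2.2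
  have hs : i₁₂.negOnePow = i₁.negOnePow * i₂.negOnePow := by rw [← h₁₂, Int.negOnePow_add]
  rw [e1, e3, hs]
  rcases Int.units_eq_one_or i₁.negOnePow with h | h <;>
    rcases Int.units_eq_one_or i₂.negOnePow with h' | h' <;> simp [h, h', e2] <;> abel

/-- Apart from the Leibniz rules of `Z` and `Y`, the identity needed is the telescoping `(g z - y)
y' + g z (g z' - y') = g (z z') - y y'`. -/
lemma pathD_leibniz {Z Y : DGA k} (g : Z ⟶ Y) {i i' j j' l l' : ℤ} (hi : i' + 1 = i)
    (hj : j' + 1 = j) (h : i + j = l) (h₁ : i' + j = l') (h₂ : i + j' = l')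
    (x : Z.cx.X i × Y.cx.X i × Y.cx.X (i + 1)) (y : Z.cx.X j × Y.cx.X j × Y.cx.X (j + 1)) :
    pathD g l l' (pathMul g h x y) = pathMul g h₁ (pathD g i i' x) y +
      i.negOnePow • pathMul g h₂ x (pathD g j j' y) := by
  refine Prod.ext (Z.leibniz hi hj h h₁ h₂ ..) (Prod.ext (Y.leibniz hi hj h h₁ h₂ ..) ?_)
  subst hi hj
  obtain rfl : l = l' + 1 := by omega
  have e1 := Y.leibniz (show i' + 1 + 1 = _ from rfl) (show j' + 1 = _ from rfl)
    (show i' + 1 + 1 + (j' + 1) = l' + 1 + 1 by omega)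
    (show i' + 1 + (j' + 1) = l' + 1 by omega) (show i' + 1 + 1 + j' = l' + 1 by omega)
    x.2.2 y.2.1
  have e2 := Y.leibniz (show i' + 1 = _ from rfl) (show j' + 1 + 1 = _ from rfl)
    (show i' + 1 + (j' + 1 + 1) = l' + 1 + 1 by omega)
    (show i' + (j' + 1 + 1) = l' + 1 by omega) (show i' + 1 + (j' + 1) = l' + 1 by omega)
    (g.φ.f _ x.1) y.2.2
  simp only [pathMul_apply, pathD_apply, shift_self, map_add, map_sub, LinearMap.sub_apply,
    g.map_mul, map_d, Int.negOnePow_succ, Prod.snd_add, Prod.smul_snd, e1] at e1 e2 ⊢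
  rcases Int.units_eq_one_or i'.negOnePow with h | h <;> simp [h] at e2 ⊢ <;> rw [e2] <;> abel

/-- The mapping path dga of a morphism `g : Z ⟶ Y`. -/
def path {Z Y : DGA k} (g : Z ⟶ Y) : DGA k :=
  mk' (fun i => Z.cx.X i × Y.cx.X i × Y.cx.X (i + 1)) (pathD g)
    (fun i j h x => Prod.ext (Z.d_of_ne h _) (Prod.ext (Y.d_of_ne h _) (by
      rw [pathD_apply, Y.shift_of_ne (by omega), Y.d_of_ne (i := i + 1) (j := j + 1) (by omega)]
      simp)))
    (fun i j l hj hl x => Prod.ext (Z.d_d ..) (Prod.ext (Y.d_d ..) (by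
      subst hj hl
      simp [pathD_apply, d_d, map_d])))
    (Z.one, Y.one, 0)
    (pathMul g)
    (fun x => Prod.ext (Z.one_mul _) (Prod.ext (Y.one_mul _) (by
      change Y.mul (by omega) (0 : Y.cx.X (0 + 1)) x.2.1 +
        (0 : ℤ).negOnePow • Y.mul (by omega) (g.φ.f 0 Z.one) x.2.2 = x.2.2
      simp [g.map_one, Y.one_mul])))
    (fun x => Prod.ext (Z.mul_one _) (Prod.ext (Y.mul_one _) (by
      change Y.mul (by omega) x.2.2 Y.one + Int.negOnePow _ •
        Y.mul (by omega) (g.φ.f _ x.1) (0 : Y.cx.X (0 + 1)) = x.2.2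
      simp [Y.mul_one])))
    (pathMul_assoc g)
    (Prod.ext Z.d_one (Prod.ext Y.d_one (by
      change Y.shift 0 (-1 + 1) (g.φ.f 0 Z.one - Y.one) - Y.cx.d (0 + 1) (-1 + 1) 0 = 0
      simp [g.map_one])))
    (pathD_leibniz g)

/-- Evaluation at the start of a path. -/
def pathZero {Z Y : DGA k} (g : Z ⟶ Y) : path g ⟶ Z :=
  homMk (fun _ => LinearMap.fst k _ _) (fun _ _ _ _ => rfl) rfl (fun _ _ _ => rfl)

/-- Evaluation at the end of a path. -/
def pathOne {Z Y : DGA k} (g : Z ⟶ Y) : path g ⟶ Y :=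
  homMk (fun _ => LinearMap.fst k _ _ ∘ₗ LinearMap.snd k _ _) (fun _ _ _ _ => rfl) rfl
    (fun _ _ _ => rfl)

/-- The constant paths. -/
def pathConst {Z Y : DGA k} (g : Z ⟶ Y) : Z ⟶ path g :=
  homMk (fun i => LinearMap.prod LinearMap.id (LinearMap.prod (g.φ.f i).hom 0))
    (fun i j x h => Prod.ext rfl (Prod.ext (map_d g x) (by
      subst h
      change (0 : Y.cx.X (j + 1)) = Y.shift (j + 1) (j + 1) (g.φ.f _ x - g.φ.f _ x) -
        Y.cx.d _ _ 0
      simp)))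
    (Prod.ext rfl (Prod.ext g.map_one rfl))
    (fun {i j l} h x y => Prod.ext rfl (Prod.ext (g.map_mul h x y) (by
      change (0 : Y.cx.X (l + 1)) = Y.mul (show i + 1 + j = l + 1 by omega) 0 (g.φ.f j y) +
        i.negOnePow • Y.mul (show i + (j + 1) = l + 1 by omega) (g.φ.f i x) 0
      simp)))

/-- The functoriality of the mapping path dga. -/
def pathMap {Z Y Z' Y' : DGA k} {g : Z ⟶ Y} {g' : Z' ⟶ Y'} (a : Z ⟶ Z') (b : Y ⟶ Y')
    (h : a ≫ g' = g ≫ b) : path g ⟶ path g' :=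
  have h' (i : ℤ) (x : Z.cx.X i) : g'.φ.f i (a.φ.f i x) = b.φ.f i (g.φ.f i x) := congr(($h).φ.f i x)
  homMk (fun i => LinearMap.prodMap (a.φ.f i).hom
      (LinearMap.prodMap (b.φ.f i).hom (b.φ.f (i + 1)).hom))
    (fun i j x _ => Prod.ext (map_d a _) (Prod.ext (map_d b _) (by
      change b.φ.f (j + 1) (Y.shift i (j + 1) (g.φ.f i x.1 - x.2.1) -
          Y.cx.d (i + 1) (j + 1) x.2.2) =
        Y'.shift i (j + 1) (g'.φ.f i (a.φ.f i x.1) - b.φ.f i x.2.1) -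
          Y'.cx.d (i + 1) (j + 1) (b.φ.f (i + 1) x.2.2)
      rw [map_sub, map_shift, map_d, h', map_sub])))
    (Prod.ext a.map_one (Prod.ext b.map_one (map_zero (b.φ.f (0 + 1)).hom)))
    (fun {i j l} h x y => Prod.ext (a.map_mul h _ _) (Prod.ext (b.map_mul h _ _) (by
      change b.φ.f (l + 1) (Y.mul (show i + 1 + j = l + 1 by omega) x.2.2 y.2.1 +
          i.negOnePow • Y.mul (show i + (j + 1) = l + 1 by omega) (g.φ.f i x.1) y.2.2) =
        Y'.mul (show i + 1 + j = l + 1 by omega) (b.φ.f _ x.2.2) (b.φ.f _ y.2.1) +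
          i.negOnePow • Y'.mul (show i + (j + 1) = l + 1 by omega) (g'.φ.f i (a.φ.f i x.1))
            (b.φ.f _ y.2.2)
      rw [map_add, b.map_mul, h', Units.smul_def, map_zsmul, b.map_mul, Units.smul_def])))

/-- The kernel is a cone on `Y`: a cycle `(0, y, γ)` has `y = -d γ`, and it is the boundary of `(0,
-γ, 0)`. -/
lemma pathZero_isTrivFib {Z Y : DGA k} (g : Z ⟶ Y) : IsTrivFib (pathZero g) where
  surj i z := ⟨(z, 0, 0), rfl⟩
  exists_d := by
    rintro i ⟨z, y, γ⟩ hz hd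
    obtain rfl : z = 0 := hz
    have hd' := congr(($hd).2.2)
    change Y.shift i (i - 1 + 1) (g.φ.f i 0 - y) - Y.cx.d (i + 1) (i - 1 + 1) γ = 0 at hd'
    have e : i - 1 + 1 = i := by omega
    rw [e, shift_self] at hd'
    refine ⟨(0, -γ, 0), rfl, Prod.ext (map_zero (Z.cx.d _ _).hom) (Prod.ext ?_ ?_)⟩
    · change Y.cx.d (i + 1) i (-γ) = y
      rw [map_zero, zero_sub, sub_eq_zero] at hd'
      rw [map_neg, ← hd', neg_neg]
    · change Y.shift (i + 1) (i + 1) (g.φ.f _ 0 - -γ) - Y.cx.d (i + 1 + 1) (i + 1) 0 = γ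
      simp

lemma pathConst_quasiIso {Z Y : DGA k} (g : Z ⟶ Y) : quasiIso k (pathConst g) :=
  quasiIso_of_comp_right (pathZero_isTrivFib g).quasiIso (quasiIso_id Z)

/-! ### Spans and morphisms in the homotopy category -/

section Spans

variable {C : DGA k}

/-- A span `C ← C' → Z` of dgas over `C` whose left leg is a quasi-isomorphism. -/
structure Span (Z : Over C) where
  dom : DGA k
  q : dom ⟶ C
  hq : quasiIso k q
  a : dom ⟶ Z.left
  comm : a ≫ Z.hom = q

/-- The relation between spans given by the morphisms of spans. -/
def Span.Rel {Z : Over C} (s t : Span Z) : Prop := ∃ g : s.dom ⟶ t.dom, g ≫ t.a = s.a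

/-- The connected components of the category of spans. -/
def SpanClass (Z : Over C) : Type (u + 1) := Quot (Span.Rel (Z := Z))

/-- The class of a span. -/
def Span.mkClass {Z : Over C} (s : Span Z) : SpanClass Z := Quot.mk _ s

lemma Span.mkClass_eq {Z : Over C} {s t : Span Z} (g : s.dom ⟶ t.dom) (h : g ≫ t.a = s.a) :
    s.mkClass = t.mkClass := Quot.sound ⟨g, h⟩

/-- The composition of a span with a morphism. -/
def Span.map {Z Z' : Over C} (w : Z ⟶ Z') (s : Span Z) : Span Z' where
  dom := s.dom
  q := s.q
  hq := s.hq
  a := s.a ≫ w.left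
  comm := by rw [Category.assoc, Over.w, s.comm]

/-- The functoriality of `SpanClass`. -/
def SpanClass.map {Z Z' : Over C} (w : Z ⟶ Z') : SpanClass Z → SpanClass Z' :=
  Quot.map (Span.map w) fun s t ⟨g, h⟩ => ⟨g, by
    change g ≫ t.a ≫ w.left = s.a ≫ w.left
    rw [← Category.assoc, h]⟩

lemma SpanClass.map_id (Z : Over C) (x : SpanClass Z) : SpanClass.map (𝟙 Z) x = x := by
  obtain ⟨s, rfl⟩ := Quot.exists_rep x
  exact Span.mkClass_eq (𝟙 _) (by simp [Span.map])

lemma SpanClass.map_comp {Z Z' Z'' : Over C} (w : Z ⟶ Z') (w' : Z' ⟶ Z'') (x : SpanClass Z) :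
    SpanClass.map (w ≫ w') x = SpanClass.map w' (SpanClass.map w x) := by
  obtain ⟨s, rfl⟩ := Quot.exists_rep x
  exact Span.mkClass_eq (𝟙 _) (by simp [Span.map])

/-- The pullback of a span along a trivial fibration. -/
def Span.pull {Z Z' : Over C} (w : Z ⟶ Z') (hw : IsTrivFib w.left) (s : Span Z') : Span Z where
  dom := pb s.a w.left
  q := pbFst s.a w.left ≫ s.q
  hq := quasiIso_comp (hw.pbFst s.a).quasiIso s.hq
  a := pbSnd s.a w.left
  comm := by rw [← s.comm, ← Category.assoc, pb_condition, Category.assoc, Over.w]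

/-- The inverse pulls a span back along `w`. Its left leg stays a quasi-isomorphism because trivial
fibrations are stable under base change. The morphisms of spans relating the composites to the
identities are the graph of `s.a` and the projection of the pullback. -/
lemma SpanClass.map_bijective_of_isTrivFib {Z Z' : Over C} (w : Z ⟶ Z') (hw : IsTrivFib w.left) :
    Function.Bijective (SpanClass.map w) := by
  refine Function.bijective_iff_has_inverse.2
    ⟨Quot.map (Span.pull w hw) fun s t ⟨g, h⟩ =>
      ⟨pbLift (pbFst _ _ ≫ g) (pbSnd _ _) ?_, pbLift_snd _ _ _⟩, fun x => ?_, fun x => ?_⟩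
  · exact (Category.assoc _ _ _).trans ((congrArg _ h).trans (pb_condition s.a w.left))
  · obtain ⟨s, rfl⟩ := Quot.exists_rep x
    exact (Span.mkClass_eq (s := s) (t := (s.map w).pull w hw)
      (pbLift (𝟙 _) s.a (by simp [Span.map])) (pbLift_snd _ _ _)).symm
  · obtain ⟨s, rfl⟩ := Quot.exists_rep x
    exact Span.mkClass_eq (s := (s.pull w hw).map w) (t := s) (pbFst _ _) (pb_condition _ _)

/-! ### Path objects over `C` -/

/-- The sub-dga of the mapping path dga of a morphism over `C` that consists of the paths that are
constant over `C`. -/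
def overPathSub {Z Z' : Over C} (w : Z ⟶ Z') : Sub k (path w.left) :=
  eqLocus (pathMap (g' := 𝟙 C) Z.hom Z'.hom (by simp))
    (pathMap (g' := 𝟙 C) Z.hom Z'.hom (by simp) ≫ pathZero (𝟙 C) ≫ pathConst (𝟙 C))

lemma mem_overPathSub {Z Z' : Over C} (w : Z ⟶ Z') {i : ℤ} {z : Z.left.cx.X i}
    {y : Z'.left.cx.X i} {γ : Z'.left.cx.X (i + 1)} (h : Z'.hom.φ.f i y = Z.hom.φ.f i z)
    (h' : Z'.hom.φ.f (i + 1) γ = 0) : ((z, y, γ) : (path w.left).cx.X i) ∈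
      (overPathSub w).carrier i := Prod.ext rfl (Prod.ext h h')

/-- The mapping path object of a morphism over `C`. -/
def overPath {Z Z' : Over C} (w : Z ⟶ Z') : Over C :=
  Over.mk ((overPathSub w).incl ≫ pathOne w.left ≫ Z'.hom)

/-- Evaluation at the start of a path. -/
def overPathZero {Z Z' : Over C} (w : Z ⟶ Z') : overPath w ⟶ Z :=
  Over.homMk ((overPathSub w).incl ≫ pathZero w.left)
    (hom_ext_apply fun _ x => congr(($(x.2)).2.1).symm)

/-- Evaluation at the end of a path. -/
def overPathOne {Z Z' : Over C} (w : Z ⟶ Z') : overPath w ⟶ Z' :=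
  Over.homMk ((overPathSub w).incl ≫ pathOne w.left) rfl

/-- The constant paths. -/
def overPathConst {Z Z' : Over C} (w : Z ⟶ Z') : Z ⟶ overPath w :=
  Over.homMk ((overPathSub w).lift (pathConst w.left) fun i x =>
    mem_overPathSub w congr(($(Over.w w)).φ.f i x) (map_zero (Z'.hom.φ.f (i + 1)).hom)) (Over.w w)

/-- The contraction `(0, -γ, 0)` of the full path dga stays in this sub-dga, since `γ` maps to zero
in `C`. -/
lemma overPathZero_isTrivFib {Z Z' : Over C} (w : Z ⟶ Z') : IsTrivFib (overPathZero w).left where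
  surj i z := ⟨(overPathConst w).left.φ.f i z, rfl⟩
  exists_d := by
    rintro i ⟨⟨z, y, γ⟩, hu⟩ hz hd
    obtain rfl : z = 0 := hz
    have hd' := congr(($hd).1.2.2)
    change Z'.left.shift i (i - 1 + 1) (w.left.φ.f i 0 - y) -
      Z'.left.cx.d (i + 1) (i - 1 + 1) γ = 0 at hd'
    have e : i - 1 + 1 = i := by omega
    rw [e, shift_self] at hd'
    have hγ : Z'.hom.φ.f (i + 1) γ = 0 := congr(($hu).2.2)
    refine ⟨⟨(0, -γ, 0), mem_overPathSub w ?_ (map_zero (Z'.hom.φ.f (i + 1 + 1)).hom)⟩, rfl,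
      Subtype.ext (Prod.ext (map_zero (Z.left.cx.d _ _).hom) (Prod.ext ?_ ?_))⟩
    · rw [map_neg, hγ, map_zero, neg_zero]
    · change Z'.left.cx.d (i + 1) i (-γ) = y
      rw [map_zero, zero_sub, sub_eq_zero] at hd'
      rw [map_neg, ← hd', neg_neg]
    · change Z'.left.shift (i + 1) (i + 1) (w.left.φ.f _ 0 - -γ) -
        Z'.left.cx.d (i + 1 + 1) (i + 1) 0 = γ
      simp

/-- A path that is constant over `C` has both endpoints over the same element of `C`; surjectivity
of `Z ⟶ C` supplies a start point for each end point. Acyclicity follows by two-out-of-three, as the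
constant paths are a quasi-isomorphism. -/
lemma overPathOne_isTrivFib {Z Z' : Over C} (w : Z ⟶ Z')
    (hZ : ∀ i, Function.Surjective (Z.hom.φ.f i)) (hw : quasiIso k w.left) :
    IsTrivFib (overPathOne w).left := by
  refine isTrivFib_of_quasiIso (fun i y => ?_) ?_
  · obtain ⟨z, hz⟩ := hZ i (Z'.hom.φ.f i y)
    exact ⟨⟨(z, y, 0), mem_overPathSub w hz.symm (map_zero (Z'.hom.φ.f (i + 1)).hom)⟩, rfl⟩
  · refine quasiIso_of_comp_left (f := (overPathConst w).left) ?_ hw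
    exact quasiIso_of_comp_right (g := (overPathZero w).left)
      (overPathZero_isTrivFib w).quasiIso (quasiIso_id _)

/-- Ken Brown's factorization: `w` is the inclusion of constant paths followed by evaluation at the
end. The latter is a trivial fibration, and the former is a section of one, namely of evaluation at
the start. -/
lemma SpanClass.map_bijective {Z Z' : Over C} (w : Z ⟶ Z')
    (hZ : ∀ i, Function.Surjective (Z.hom.φ.f i)) (hw : quasiIso k w.left) :
    Function.Bijective (SpanClass.map w) := by
  have h₀ := SpanClass.map_bijective_of_isTrivFib _ (overPathZero_isTrivFib w)
  have h₁ := SpanClass.map_bijective_of_isTrivFib _ (overPathOne_isTrivFib w hZ hw)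
  have hc : Function.Bijective (SpanClass.map (overPathConst w)) := by
    refine (Function.Bijective.of_comp_iff' h₀ _).1 ?_
    have e : SpanClass.map (overPathZero w) ∘ SpanClass.map (overPathConst w) = id :=
      funext fun x => (SpanClass.map_comp ..).symm.trans (SpanClass.map_id Z x)
    rw [e]
    exact Function.bijective_id
  have e : SpanClass.map w = SpanClass.map (overPathOne w) ∘ SpanClass.map (overPathConst w) :=
    funext fun x => SpanClass.map_comp (overPathConst w) (overPathOne w) x
  rw [e]
  exact h₁.comp hc

/-! ### Replacement by dgas that map onto `C` -/

variable (C) in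
/-- The replacement of a dga over `C` by one that maps onto `C`. -/
def plus : Over C ⥤ Over C where
  obj Z := Over.mk (pathOne Z.hom)
  map w := Over.homMk (pathMap w.left (𝟙 C) (by simp)) rfl
  map_id _ := rfl
  map_comp _ _ := rfl

lemma plus_surjective (Z : Over C) (i : ℤ) :
    Function.Surjective (((plus C).obj Z).hom.φ.f i) := fun y => ⟨(0, y, 0), rfl⟩

/-- The map from a dga over `C` to its replacement. -/
def plusUnit (Z : Over C) : Z ⟶ (plus C).obj Z := Over.homMk (pathConst Z.hom) rfl

lemma plusUnit_naturality {Z Z' : Over C} (w : Z ⟶ Z') :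
    plusUnit Z ≫ (plus C).map w = w ≫ plusUnit Z' := by
  refine Over.OverMorphism.ext (hom_ext_apply fun i x => Prod.ext rfl (Prod.ext ?_ ?_))
  · exact congr(($(Over.w w)).φ.f i x).symm
  · exact map_zero ((𝟙 C : C ⟶ C).φ.f (i + 1)).hom

lemma plusUnit_quasiIso (Z : Over C) : overQuasiIso C (plusUnit Z) := pathConst_quasiIso Z.hom

lemma plus_map_quasiIso {Z Z' : Over C} (w : Z ⟶ Z') (hw : overQuasiIso C w) :
    overQuasiIso C ((plus C).map w) := by
  refine quasiIso_of_comp_left (f := (plusUnit Z).left) (plusUnit_quasiIso Z) ?_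
  have h : quasiIso k (w ≫ plusUnit Z').left := quasiIso_comp hw (plusUnit_quasiIso Z')
  rwa [← plusUnit_naturality] at h

variable (C) in
/-- The functor that sends a dga `Z` over `C` to the set of components of the category of spans
from `C` to the replacement of `Z`. -/
def spanFunctor : Over C ⥤ Type (u + 1) where
  obj Z := SpanClass ((plus C).obj Z)
  map w := ↾(SpanClass.map ((plus C).map w))
  map_id Z := by
    ext x
    exact SpanClass.map_id _ x
  map_comp w w' := by
    ext x
    exact SpanClass.map_comp ((plus C).map w) ((plus C).map w') x

variable (C) in
-- The replacement `plus` provides the surjectivity that `SpanClass.map_bijective` requires, so all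
-- quasi-isomorphisms are inverted.
lemma spanFunctor_inverts : (overQuasiIso C).IsInvertedBy (spanFunctor C) := by
  intro Z Z' w hw
  rw [isIso_iff_bijective]
  exact SpanClass.map_bijective _ (plus_surjective Z) (plus_map_quasiIso w hw)

/-! ### Morphisms of the homotopy category represented by spans -/

lemma Span.hq_over {Z : Over C} (s : Span Z) :
    overQuasiIso C (Over.homMk s.q : Over.mk s.q ⟶ overSelf C) := s.hq

/-- The morphism in the homotopy category represented by a span. -/
noncomputable def Span.toHo {Z : Over C} (s : Span Z) :
    (overQuasiIso C).Q.obj (overSelf C) ⟶ (overQuasiIso C).Q.obj Z :=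
  (Localization.isoOfHom (overQuasiIso C).Q (overQuasiIso C)
      (Over.homMk s.q : Over.mk s.q ⟶ overSelf C) s.hq_over).inv ≫
    (overQuasiIso C).Q.map (Over.homMk s.a s.comm : Over.mk s.q ⟶ Z)

lemma Span.toHo_eq_of_rel {Z : Over C} {s t : Span Z} (h : s.Rel t) : s.toHo = t.toHo := by
  obtain ⟨g, hg⟩ := h
  -- The left leg of a span is the right leg followed by `Z ⟶ C`, so a map compatible with the right
  -- legs is compatible with the left ones.
  have hq : g ≫ t.q = s.q := by rw [← t.comm, ← Category.assoc, hg, s.comm]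
  let g' : Over.mk s.q ⟶ Over.mk t.q := Over.homMk g hq
  have e₁ : (Over.homMk s.a s.comm : Over.mk s.q ⟶ Z) = g' ≫ Over.homMk t.a t.comm := by
    ext : 1
    exact hg.symm
  have e₂ : (Over.homMk s.q : Over.mk s.q ⟶ overSelf C) =
      g' ≫ (Over.homMk t.q : Over.mk t.q ⟶ overSelf C) := by
    ext : 1
    exact hq.symm
  rw [toHo, Iso.inv_comp_eq, Localization.isoOfHom_hom, e₁, e₂, Functor.map_comp, Functor.map_comp,
    Category.assoc, toHo, Localization.isoOfHom_hom_inv_id_assoc]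

/-- The morphism in the homotopy category represented by a class of spans. -/
noncomputable def SpanClass.toHo {Z : Over C} : SpanClass Z →
    ((overQuasiIso C).Q.obj (overSelf C) ⟶ (overQuasiIso C).Q.obj Z) :=
  Quot.lift Span.toHo fun _ _ => Span.toHo_eq_of_rel

lemma SpanClass.toHo_map {Z Z' : Over C} (w : Z ⟶ Z') (x : SpanClass Z) :
    (SpanClass.map w x).toHo = x.toHo ≫ (overQuasiIso C).Q.map w := by
  obtain ⟨s, rfl⟩ := Quot.exists_rep x
  change (s.map w).toHo = s.toHo ≫ _
  rw [Span.toHo, Span.toHo, Category.assoc, ← Functor.map_comp]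
  rfl

variable (C) in
/-- The identity span. -/
def Span.self : Span (overSelf C) := ⟨C, 𝟙 C, quasiIso_id C, 𝟙 C, Category.comp_id _⟩

lemma Span.toHo_self : (Span.self C).toHo = 𝟙 _ := by
  rw [toHo, Iso.inv_comp_eq]
  exact (Category.comp_id _).symm

/-- The morphism in the homotopy category represented by a class of spans to the replacement. -/
noncomputable def SpanClass.plusToHo {Z : Over C} (x : SpanClass ((plus C).obj Z)) :
    (overQuasiIso C).Q.obj (overSelf C) ⟶ (overQuasiIso C).Q.obj Z :=
  x.toHo ≫ (Localization.isoOfHom (overQuasiIso C).Q (overQuasiIso C) (plusUnit Z)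
    (plusUnit_quasiIso Z)).inv

lemma SpanClass.plusToHo_map {Z Z' : Over C} (w : Z ⟶ Z') (x : SpanClass ((plus C).obj Z)) :
    (SpanClass.map ((plus C).map w) x).plusToHo = x.plusToHo ≫ (overQuasiIso C).Q.map w := by
  rw [plusToHo, plusToHo, SpanClass.toHo_map, Category.assoc, Category.assoc]
  congr 1
  rw [Iso.comp_inv_eq, Category.assoc, Iso.eq_inv_comp, Localization.isoOfHom_hom,
    Localization.isoOfHom_hom, ← Functor.map_comp, ← Functor.map_comp, plusUnit_naturality]

lemma SpanClass.plusToHo_map_plusUnit {Z : Over C} (x : SpanClass Z) :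
    (SpanClass.map (plusUnit Z) x).plusToHo = x.toHo := by
  rw [plusToHo, SpanClass.toHo_map, Category.assoc, Localization.isoOfHom_hom_inv_id,
    Category.comp_id]

/-! ### Comparison of span classes with the morphisms out of `C` -/

variable (C) in
/-- The functor on the homotopy category that is induced by the span functor. -/
noncomputable def hoSpanFunctor : HoOver C ⥤ Type (u + 1) :=
  Localization.Construction.lift (spanFunctor C) (spanFunctor_inverts C)

/-- The action of the morphisms of the homotopy category on classes of spans. -/
noncomputable def hoAct {Z Z' : Over C} (t : (overQuasiIso C).Q.obj Z ⟶ (overQuasiIso C).Q.obj Z') :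
    SpanClass ((plus C).obj Z) → SpanClass ((plus C).obj Z') :=
  (hoSpanFunctor C).map t

lemma hoAct_comp {Z Z' Z'' : Over C}
    (t : (overQuasiIso C).Q.obj Z ⟶ (overQuasiIso C).Q.obj Z')
    (t' : (overQuasiIso C).Q.obj Z' ⟶ (overQuasiIso C).Q.obj Z'') (x) :
    hoAct (t ≫ t') x = hoAct t' (hoAct t x) :=
  congr($((hoSpanFunctor C).map_comp t t') x)

lemma hoAct_id {Z : Over C} (x) : hoAct (𝟙 ((overQuasiIso C).Q.obj Z)) x = x :=
  congr($((hoSpanFunctor C).map_id ((overQuasiIso C).Q.obj Z)) x)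

lemma hoAct_map {Z Z' : Over C} (w : Z ⟶ Z') (x : SpanClass ((plus C).obj Z)) :
    hoAct ((overQuasiIso C).Q.map w) x = SpanClass.map ((plus C).map w) x := by
  have h := Functor.congr_hom (Localization.Construction.fac (spanFunctor C)
    (spanFunctor_inverts C)) w
  exact congr($(h.trans ((Category.id_comp _).trans (Category.comp_id _))) x)

variable (C) in
/-- The natural transformation from the span functor to the morphisms in the homotopy category. -/
noncomputable def spanTrans : (overQuasiIso C).Q ⋙ hoSpanFunctor C ⟶
    (overQuasiIso C).Q ⋙ coyoneda.obj (Opposite.op ((overQuasiIso C).Q.obj (overSelf C))) where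
  app Z := ↾(SpanClass.plusToHo (Z := Z))
  naturality Z Z' w := by
    ext x
    exact (congrArg _ (hoAct_map w x)).trans (SpanClass.plusToHo_map w x)

variable (C) in
/-- The class of the identity span. -/
def selfClass : SpanClass ((plus C).obj (overSelf C)) :=
  SpanClass.map (plusUnit _) (Span.self C).mkClass

/-- Yoneda: `spanTrans` extends to a natural transformation on the whole localization. Its
naturality at `t`, evaluated on the identity span, says that the image of that span under `t`
represents `t`. -/
lemma SpanClass.exists_plusToHo {Z : Over C}
    (t : (overQuasiIso C).Q.obj (overSelf C) ⟶ (overQuasiIso C).Q.obj Z) :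
    ∃ x : SpanClass ((plus C).obj Z), x.plusToHo = t := by
  have h := (Localization.Construction.natTransExtension (spanTrans C)).naturality t
  rw [Localization.Construction.natTransExtension_app,
    Localization.Construction.natTransExtension_app,
    Localization.Construction.NatTransExtension.app_eq,
    Localization.Construction.NatTransExtension.app_eq] at h
  refine ⟨hoAct t (selfClass C), congr($h (selfClass C)).trans ?_⟩
  change (selfClass C).plusToHo ≫ t = t
  rw [selfClass, SpanClass.plusToHo_map_plusUnit]
  exact (congrArg (· ≫ t) Span.toHo_self).trans (Category.id_comp t)

/-- The span is recovered from the morphism it represents, by acting on the identity span. This is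
what makes `SpanClass.toHo` injective. -/
lemma hoAct_toHo {Z : Over C} (s : Span Z) :
    hoAct s.toHo (selfClass C) = SpanClass.map (plusUnit Z) s.mkClass := by
  let q' : Over.mk s.q ⟶ overSelf C := Over.homMk s.q
  -- The tautological span on the domain of `s`: pushed along `q` it becomes the identity span,
  -- pushed along `a` it becomes `s`.
  let s₀ : Span (Over.mk s.q) := ⟨s.dom, s.q, s.hq, 𝟙 _, Category.id_comp _⟩
  have e₁ : hoAct ((overQuasiIso C).Q.map q') (SpanClass.map (plusUnit _) s₀.mkClass) =
      selfClass C := by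
    rw [hoAct_map, ← SpanClass.map_comp, plusUnit_naturality, SpanClass.map_comp, selfClass]
    congr 1
    exact Span.mkClass_eq (s := s₀.map q') (t := Span.self C) s.q
      ((Category.comp_id _).trans (Category.id_comp _).symm)
  rw [Span.toHo, ← e₁, hoAct_comp, ← hoAct_comp ((overQuasiIso C).Q.map q'),
    Localization.isoOfHom_hom_inv_id, hoAct_id,
    hoAct_map, ← SpanClass.map_comp, plusUnit_naturality, SpanClass.map_comp]
  rfl

/-- If `Z ⟶ C` is surjective, the morphisms from `C` to `Z` in the homotopy category are the classes
of spans. -/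
theorem SpanClass.toHo_bijective {Z : Over C} (hZ : ∀ i, Function.Surjective (Z.hom.φ.f i)) :
    Function.Bijective (SpanClass.toHo (Z := Z)) := by
  have hb := SpanClass.map_bijective (plusUnit Z) hZ (plusUnit_quasiIso Z)
  refine ⟨fun x y h => ?_, fun t => ?_⟩
  · obtain ⟨s, rfl⟩ := Quot.exists_rep x
    obtain ⟨s', rfl⟩ := Quot.exists_rep y
    have h' : s.toHo = s'.toHo := h
    exact hb.1 ((hoAct_toHo s).symm.trans (h' ▸ hoAct_toHo s'))
  · obtain ⟨x, rfl⟩ := SpanClass.exists_plusToHo t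
    obtain ⟨y, rfl⟩ := hb.2 x
    exact ⟨y, (SpanClass.plusToHo_map_plusUnit y).symm⟩

end Spans

/-! ### Truncations and cones -/

/-- The part of degree `i` of the truncation of a dga at degree `m`: everything if `i > m`, the
cycles if `i = m`, and zero if `i < m`. -/
def tr (A : DGA k) (m i : ℤ) : Submodule k (A.cx.X i) where
  carrier := {x | (i < m → x = 0) ∧ (i = m → x ∈ A.Z i)}
  add_mem' hx hy := ⟨fun h => by rw [hx.1 h, hy.1 h, add_zero],
    fun h => add_mem (hx.2 h) (hy.2 h)⟩
  zero_mem' := ⟨fun _ => rfl, fun _ => zero_mem _⟩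
  smul_mem' r _ hx := ⟨fun h => by rw [hx.1 h, smul_zero], fun h => Submodule.smul_mem _ r (hx.2 h)⟩

lemma mem_tr_of_lt (A : DGA k) {m i : ℤ} (h : m < i) (x : A.cx.X i) : x ∈ A.tr m i :=
  ⟨fun _ => by omega, fun _ => by omega⟩

lemma mem_tr_of_mem_Z (A : DGA k) {m i : ℤ} (h : m ≤ i) {x : A.cx.X i} (hx : x ∈ A.Z i) :
    x ∈ A.tr m i := ⟨fun _ => by omega, fun _ => hx⟩

lemma NonNeg.mem_tr {C : DGA k} (hC : C.NonNeg) {i : ℤ} (x : C.cx.X i) : x ∈ C.tr 0 i :=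
  ⟨fun h => @Subsingleton.elim _ (hC i h) _ _,
    fun h => @Subsingleton.elim _ (hC (i - 1) (by omega)) _ _⟩

lemma map_mem_tr {A B : DGA k} (f : A ⟶ B) {m i : ℤ} {x : A.cx.X i} (hx : x ∈ A.tr m i) :
    f.φ.f i x ∈ B.tr m i :=
  ⟨fun h => by rw [hx.1 h, map_zero], fun h => map_mem_Z f (hx.2 h)⟩

lemma d_mem_tr (A : DGA k) {m i j : ℤ} (h : j + 1 = i) {x : A.cx.X i} (hx : x ∈ A.tr m i) :
    A.cx.d i j x ∈ A.tr m j := by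
  refine ⟨fun hj => ?_, fun _ => A.d_d ..⟩
  rcases (show i < m ∨ i = m by omega) with h' | h'
  · rw [hx.1 h', map_zero]
  · exact A.d_eq_zero j (by omega) (hx.2 h')

/-- Once factors below their truncation degrees are discarded, a product in the bottom degree `m''`
must have factors in degrees `m` and `m'`, hence is a product of cycles. -/
lemma mul_mem_tr (A : DGA k) {m m' m'' i j l : ℤ} (h : i + j = l) (hm : m + m' = m'')
    {x : A.cx.X i} {y : A.cx.X j} (hx : x ∈ A.tr m i) (hy : y ∈ A.tr m' j) :
    A.mul h x y ∈ A.tr m'' l := by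
  by_cases hi : i < m
  · rw [hx.1 hi, map_zero, LinearMap.zero_apply]
    exact zero_mem _
  by_cases hj : j < m'
  · rw [hy.1 hj, map_zero]
    exact zero_mem _
  exact ⟨fun _ => by omega, fun _ => A.mul_mem_Z h (hx.2 (by omega)) (hy.2 (by omega))⟩

lemma one_mem_tr (A : DGA k) : A.one ∈ A.tr 0 0 := A.mem_tr_of_mem_Z le_rfl A.d_one

lemma shift_shift (A : DGA k) {i j : ℤ} (h : i = j) (x : A.cx.X i) :
    A.shift j i (A.shift i j x) = x := by
  subst h
  simp

lemma d_shift (A : DGA k) {i j : ℤ} (h : i = j) (l : ℤ) (x : A.cx.X i) :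
    A.cx.d j l (A.shift i j x) = A.cx.d i l x := by
  subst h
  simp

lemma shift_mem_tr (A : DGA k) {m i j : ℤ} (h : i = j) {x : A.cx.X i} (hx : x ∈ A.tr m i) :
    A.shift i j x ∈ A.tr m j := by
  subst h
  rwa [shift_self]

/-- The connective cover of a dga, as a sub-dga. -/
def coverSub (A : DGA k) : Sub k A where
  carrier := A.tr 0
  one_mem := A.one_mem_tr
  mul_mem h _ _ hx hy := A.mul_mem_tr h (by simp) hx hy
  d_mem h _ hx := A.d_mem_tr h hx

/-- The connective cover of a dga. -/
def cover (A : DGA k) : DGA k := A.coverSub.toDGA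

/-- The map from the connective cover. -/
def coverIncl (A : DGA k) : A.cover ⟶ A := A.coverSub.incl

lemma coverIncl_quasiIso (A : DGA k) (hA : ∀ i : ℤ, i < 0 → Subsingleton (A.cx.homology i)) :
    quasiIso k A.coverIncl := by
  rw [quasiIso_iff]
  intro i
  rw [quasiIsoAt_iff]
  refine ⟨fun x hx b hb => ?_, fun y hy => ?_⟩
  · rcases lt_or_ge i 0 with hi | hi
    · exact ⟨0, (map_zero (A.cover.cx.d (i + 1) i).hom).trans (Subtype.ext (x.2.1 hi)).symm⟩
    · exact ⟨⟨b, A.mem_tr_of_lt (by omega) b⟩, Subtype.ext hb⟩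
  · rcases lt_or_ge i 0 with hi | hi
    · obtain ⟨b, hb⟩ := (A.subsingleton_homology_iff i).1 (hA i hi) y hy
      exact ⟨0, map_zero (A.cover.cx.d i (i - 1)).hom, -b, by rw [map_neg, hb, map_zero, zero_sub]⟩
    · exact ⟨⟨y, A.mem_tr_of_mem_Z hi hy⟩, Subtype.ext hy, 0,
        (map_zero (A.cx.d (i + 1) i).hom).trans (sub_self y).symm⟩

/-! ### The dga structure on the cone -/

/-- The product `(x, y) (x', y') = (x x', y x' + (-1)^i x y')` of the cone. -/
def coneMul (A : DGA k) {i j l : ℤ} (h : i + j = l) :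
    (A.cx.X i × A.cx.X (i - 1)) →ₗ[k] (A.cx.X j × A.cx.X (j - 1)) →ₗ[k]
      (A.cx.X l × A.cx.X (l - 1)) :=
  LinearMap.mk₂ k (fun u v => (A.mul h u.1 v.1,
      A.mul (show i - 1 + j = l - 1 by omega) u.2 v.1 +
        i.negOnePow • A.mul (show i + (j - 1) = l - 1 by omega) u.1 v.2))
    (fun u u' v => by
      refine Prod.ext (by simp) ?_
      rcases Int.units_eq_one_or i.negOnePow with h | h <;> simp [h] <;> abel)
    (fun r u v => by
      refine Prod.ext (by simp) ?_
      rcases Int.units_eq_one_or i.negOnePow with h | h <;> simp [h])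
    (fun u v v' => by
      refine Prod.ext (by simp) ?_
      rcases Int.units_eq_one_or i.negOnePow with h | h <;> simp [h] <;> abel)
    (fun r u v => by
      refine Prod.ext (by simp) ?_
      rcases Int.units_eq_one_or i.negOnePow with h | h <;> simp [h])

/-- The differential `d (x, y) = (d x + y, - d y)` of the cone. -/
def coneD (A : DGA k) (i j : ℤ) :
    (A.cx.X i × A.cx.X (i - 1)) →ₗ[k] (A.cx.X j × A.cx.X (j - 1)) :=
  LinearMap.prod ((A.cx.d i j).hom ∘ₗ LinearMap.fst k _ _ +
      A.shift (i - 1) j ∘ₗ LinearMap.snd k _ _)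
    (-((A.cx.d (i - 1) (j - 1)).hom ∘ₗ LinearMap.snd k _ _))

lemma coneD_apply (A : DGA k) (i j : ℤ) (u : A.cx.X i × A.cx.X (i - 1)) :
    A.coneD i j u = (A.cx.d i j u.1 + A.shift (i - 1) j u.2, -A.cx.d (i - 1) (j - 1) u.2) := rfl

lemma coneMul_apply (A : DGA k) {i j l : ℤ} (h : i + j = l) (u : A.cx.X i × A.cx.X (i - 1))
    (v : A.cx.X j × A.cx.X (j - 1)) :
    A.coneMul h u v = (A.mul h u.1 v.1,
      A.mul (show i - 1 + j = l - 1 by omega) u.2 v.1 +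
        i.negOnePow • A.mul (show i + (j - 1) = l - 1 by omega) u.1 v.2) := rfl

/-- The sign `(-1)^i` comes from moving `σ`, of degree `1`, past an element of degree `i`; terms
with two factors `σ` vanish. -/
lemma coneMul_assoc (A : DGA k) {i₁ i₂ i₃ i₁₂ i₂₃ i : ℤ} (h₁₂ : i₁ + i₂ = i₁₂)
    (h₂₃ : i₂ + i₃ = i₂₃) (h : i₁₂ + i₃ = i) (h' : i₁ + i₂₃ = i)
    (x : A.cx.X i₁ × A.cx.X (i₁ - 1)) (y : A.cx.X i₂ × A.cx.X (i₂ - 1))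
    (z : A.cx.X i₃ × A.cx.X (i₃ - 1)) :
    A.coneMul h (A.coneMul h₁₂ x y) z = A.coneMul h' x (A.coneMul h₂₃ y z) := by
  refine Prod.ext (A.mul_assoc ..) ?_
  simp only [coneMul_apply, map_add, LinearMap.add_apply]
  have e1 := A.mul_assoc (show i₁ - 1 + i₂ = i₁₂ - 1 by omega) h₂₃
    (show i₁₂ - 1 + i₃ = i - 1 by omega) (by omega) x.2 y.1 z.1
  have e2 := A.mul_assoc (show i₁ + (i₂ - 1) = i₁₂ - 1 by omega)
    (show i₂ - 1 + i₃ = i₂₃ - 1 by omega) (show i₁₂ - 1 + i₃ = i - 1 by omega)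
    (by omega) x.1 y.2 z.1
  have e3 := A.mul_assoc h₁₂ (show i₂ + (i₃ - 1) = i₂₃ - 1 by omega)
    (show i₁₂ + (i₃ - 1) = i - 1 by omega) (by omega) x.1 y.1 z.2
  have hs : i₁₂.negOnePow = i₁.negOnePow * i₂.negOnePow := by rw [← h₁₂, Int.negOnePow_add]
  rw [e1, e3, hs]
  rcases Int.units_eq_one_or i₁.negOnePow with h | h <;>
    rcases Int.units_eq_one_or i₂.negOnePow with h' | h' <;> simp [h, h', e2] <;> abel

/-- With `dσ = 1` the differential is `d (x + σ y) = d x + y - σ d y`. The rule reduces to those for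
`x x'`, `y x'` and `x y'`. -/
lemma coneD_leibniz (A : DGA k) {i i' j j' l l' : ℤ} (hi : i' + 1 = i)
    (hj : j' + 1 = j) (h : i + j = l) (h₁ : i' + j = l') (h₂ : i + j' = l')
    (x : A.cx.X i × A.cx.X (i - 1)) (y : A.cx.X j × A.cx.X (j - 1)) :
    A.coneD l l' (A.coneMul h x y) = A.coneMul h₁ (A.coneD i i' x) y +
      i.negOnePow • A.coneMul h₂ x (A.coneD j j' y) := by
  obtain rfl : i' = i - 1 := by omega
  obtain rfl : j' = j - 1 := by omega
  obtain rfl : l' = l - 1 := by omega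
  have e0 := A.leibniz (i' := i - 1) (j' := j - 1) (l' := l - 1) (by omega) (by omega) h
    (by omega) (by omega) x.1 y.1
  have e1 := A.leibniz (i := i - 1) (i' := i - 1 - 1) (j' := j - 1) (l' := l - 1 - 1)
    (by omega) (by omega) (show i - 1 + j = l - 1 by omega) (by omega) (by omega) x.2 y.1
  have e2 := A.leibniz (i' := i - 1) (j := j - 1) (j' := j - 1 - 1) (l' := l - 1 - 1)
    (by omega) (by omega) (show i + (j - 1) = l - 1 by omega) (by omega) (by omega) x.1 y.2
  have hs : (i - 1).negOnePow = -i.negOnePow := by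
    rw [Int.negOnePow_sub, Int.negOnePow_one, mul_neg, _root_.mul_one]
  rw [hs] at e1
  simp only [coneMul_apply, coneD_apply, shift_self, map_add, LinearMap.add_apply, hs]
  rcases Int.units_eq_one_or i.negOnePow with h | h <;> simp [h] at e0 e1 e2 ⊢ <;>
    rw [e0, e1, e2] <;> constructor <;> abel

/-- The cone of the identity of a dga `A`, as a dga: the elements are `x + σ y`, where `σ` is a
square-zero element of degree `1` with `d σ = 1` that commutes with the elements of `A`. -/
def cone (A : DGA k) : DGA k :=
  mk' (fun i => A.cx.X i × A.cx.X (i - 1)) A.coneD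
    (fun i j h x => by
      rw [coneD_apply, A.d_of_ne h, A.shift_of_ne (by omega),
        A.d_of_ne (i := i - 1) (j := j - 1) (by omega), add_zero, neg_zero]
      rfl)
    (fun i j l hj hl x => by
      obtain rfl : j = i - 1 := by omega
      obtain rfl : l = i - 1 - 1 := by omega
      simp [coneD_apply, d_d])
    (A.one, 0)
    A.coneMul
    (fun x => Prod.ext (A.one_mul _) (by
      change A.mul (by omega) (0 : A.cx.X (0 - 1)) x.1 +
        (0 : ℤ).negOnePow • A.mul (by omega) A.one x.2 = x.2
      simp [A.one_mul]))
    (fun x => Prod.ext (A.mul_one _) (by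
      change A.mul (by omega) x.2 A.one + Int.negOnePow _ •
        A.mul (by omega) x.1 (0 : A.cx.X (0 - 1)) = x.2
      simp [A.mul_one]))
    A.coneMul_assoc
    (Prod.ext (by
      change A.cx.d 0 (-1) A.one + A.shift (0 - 1) (-1) 0 = 0
      rw [A.d_one, map_zero, add_zero])
      (by
      change -A.cx.d (0 - 1) (-1 - 1) 0 = 0
      rw [map_zero, neg_zero]))
    A.coneD_leibniz

/-- The functoriality of the cone. -/
def coneMap {A B : DGA k} (f : A ⟶ B) : A.cone ⟶ B.cone :=
  homMk (fun i => LinearMap.prodMap (f.φ.f i).hom (f.φ.f (i - 1)).hom)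
    (fun i j x h => Prod.ext
      (by
        change f.φ.f j (A.cx.d i j x.1 + A.shift (i - 1) j x.2) =
          B.cx.d i j (f.φ.f i x.1) + B.shift (i - 1) j (f.φ.f (i - 1) x.2)
        rw [map_add, map_d, map_shift])
      (by
        change f.φ.f (j - 1) (-A.cx.d (i - 1) (j - 1) x.2) =
          -B.cx.d (i - 1) (j - 1) (f.φ.f (i - 1) x.2)
        rw [map_neg, map_d]))
    (Prod.ext f.map_one (map_zero (f.φ.f (0 - 1)).hom))
    (fun {i j l} h x y => Prod.ext (f.map_mul h _ _) (by
      change f.φ.f (l - 1) (A.mul (show i - 1 + j = l - 1 by omega) x.2 y.1 +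
          i.negOnePow • A.mul (show i + (j - 1) = l - 1 by omega) x.1 y.2) =
        B.mul (show i - 1 + j = l - 1 by omega) (f.φ.f _ x.2) (f.φ.f _ y.1) +
          i.negOnePow • B.mul (show i + (j - 1) = l - 1 by omega) (f.φ.f _ x.1) (f.φ.f _ y.2)
      rw [map_add, f.map_mul, Units.smul_def, map_zsmul, f.map_mul, Units.smul_def]))

/-! ### Killing the homology of an extension -/

section Kill

variable {C : DGA k}

/-- For `f : X ⟶ C`, the sub-dga of `X[σ] × C` of the elements `(x + σ y, c)` such that `x` is in
the connective cover of `X`, and `y` and `f x - c` are in the truncations of `X` and `C` at `n + 1`. -/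
def killSub (hC : C.NonNeg) (n : ℕ) {X : DGA k} (f : X ⟶ C) : Sub k (prod X.cone C) where
  carrier i :=
    { carrier := {u | u.1.1 ∈ X.tr 0 i ∧ u.1.2 ∈ X.tr (n + 1) (i - 1) ∧ f.φ.f i u.1.1 - u.2 ∈ C.tr (n + 1) i}
      add_mem' := fun {u v} hu hv => ⟨add_mem hu.1 hv.1, add_mem hu.2.1 hv.2.1, by
        have := add_mem hu.2.2 hv.2.2
        rwa [← add_sub_add_comm, ← map_add] at this⟩
      zero_mem' := ⟨zero_mem _, zero_mem _, by
        change f.φ.f i 0 - 0 ∈ _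
        rw [map_zero, sub_zero]
        exact zero_mem _⟩
      smul_mem' := fun r u hu => ⟨Submodule.smul_mem _ r hu.1, Submodule.smul_mem _ r hu.2.1, by
        have := Submodule.smul_mem _ r hu.2.2
        rwa [smul_sub, ← map_smul] at this⟩ }
  one_mem := ⟨X.one_mem_tr, zero_mem _, by
    change f.φ.f 0 X.one - C.one ∈ _
    rw [f.map_one, sub_self]
    exact zero_mem _⟩
  mul_mem {i j l} h u v hu hv := by
    refine ⟨X.mul_mem_tr h (by simp) hu.1 hv.1, ?_, ?_⟩
    · change X.mul (show i - 1 + j = l - 1 by omega) u.1.2 v.1.1 +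
        i.negOnePow • X.mul (show i + (j - 1) = l - 1 by omega) u.1.1 v.1.2 ∈ X.tr (n + 1) (l - 1)
      rw [Units.smul_def]
      exact add_mem (X.mul_mem_tr _ (by simp) hu.2.1 hv.1)
        (zsmul_mem (X.mul_mem_tr _ (by simp) hu.1 hv.2.1) _)
    · change f.φ.f l (X.mul h u.1.1 v.1.1) - C.mul h u.2 v.2 ∈ C.tr (n + 1) l
      -- As `C` is non-negative, its truncation at `n + 1` is an ideal. Each of the two summands has
      -- a factor in it.
      have e : f.φ.f l (X.mul h u.1.1 v.1.1) - C.mul h u.2 v.2 =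
          C.mul h (f.φ.f i u.1.1 - u.2) (f.φ.f j v.1.1) +
            C.mul h u.2 (f.φ.f j v.1.1 - v.2) := by
        rw [f.map_mul, map_sub, map_sub, LinearMap.sub_apply]
        abel
      rw [e]
      exact add_mem (C.mul_mem_tr h (by simp) hu.2.2 (hC.mem_tr _))
        (C.mul_mem_tr h (by simp) (hC.mem_tr _) hv.2.2)
  d_mem {i j} h u hu := by
    obtain rfl : j = i - 1 := by omega
    refine ⟨?_, ?_, ?_⟩
    · change X.cx.d i (i - 1) u.1.1 + X.shift (i - 1) (i - 1) u.1.2 ∈ X.tr 0 (i - 1)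
      rw [shift_self]
      -- Since `n + 1 ≥ 0`, the truncation at `n + 1` is contained in the connective cover, so `y`
      -- may be added to `d x`.
      refine add_mem (X.d_mem_tr h hu.1) ⟨fun h' => hu.2.1.1 (by omega), fun h' => ?_⟩
      by_cases h₀ : i - 1 < n + 1
      · rw [hu.2.1.1 h₀]
        exact zero_mem _
      · exact hu.2.1.2 (by omega)
    · exact neg_mem (X.d_mem_tr (by omega) hu.2.1)
    · change f.φ.f (i - 1) (X.cx.d i (i - 1) u.1.1 + X.shift (i - 1) (i - 1) u.1.2) -
        C.cx.d i (i - 1) u.2 ∈ C.tr (n + 1) (i - 1)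
      rw [shift_self, map_add, map_d, add_sub_right_comm, ← map_sub]
      exact add_mem (C.d_mem_tr h hu.2.2) (map_mem_tr f hu.2.1)

/-- The dga of the elements `(x + σ y, c)` as in `killSub`. -/
def kill (hC : C.NonNeg) (n : ℕ) {X : DGA k} (f : X ⟶ C) : DGA k := (killSub hC n f).toDGA

variable (hC : C.NonNeg) (n : ℕ) {X : DGA k} (f : X ⟶ C)

/-- The projection of `kill` to `C`. -/
def killProj : kill hC n f ⟶ C := (killSub hC n f).incl ≫ prodSnd _ _

/-- The inclusion of the connective cover into `kill`. -/
def killIncl : X.cover ⟶ kill hC n f :=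
  homMk (fun i => LinearMap.codRestrict ((killSub hC n f).carrier i)
      (LinearMap.prod (LinearMap.prod (X.tr 0 i).subtype 0) ((f.φ.f i).hom ∘ₗ (X.tr 0 i).subtype))
      fun x => ⟨x.2, zero_mem _, by
        change f.φ.f i x.1 - f.φ.f i x.1 ∈ _
        rw [sub_self]
        exact zero_mem _⟩)
    (fun i j x h => Subtype.ext (Prod.ext (Prod.ext
      (by
        change X.cx.d i j x.1 = X.cx.d i j x.1 + X.shift (i - 1) j 0
        rw [map_zero, add_zero])
      (by
        change 0 = -X.cx.d (i - 1) (j - 1) 0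
        rw [map_zero, neg_zero])) (map_d f x.1)))
    (Subtype.ext (Prod.ext rfl f.map_one))
    (fun {i j l} h x y => Subtype.ext (Prod.ext (Prod.ext rfl (by
      change 0 = X.mul (show i - 1 + j = l - 1 by omega) 0 y.1 +
        i.negOnePow • X.mul (show i + (j - 1) = l - 1 by omega) x.1 0
      simp)) (f.map_mul h x.1 y.1)))

lemma killIncl_proj : killIncl hC n f ≫ killProj hC n f = X.coverIncl ≫ f := rfl

variable {f} in
/-- The functoriality of `kill`. -/
def killMap {Y : DGA k} {f' : Y ⟶ C} (g : X ⟶ Y) (h : g ≫ f' = f) :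
    kill hC n f ⟶ kill hC n f' :=
  (killSub hC n f').lift ((killSub hC n f).incl ≫
      prodLift (prodFst _ _ ≫ coneMap g) (prodSnd _ _)) fun i x => by
    have e : f'.φ.f i (g.φ.f i x.1.1.1) = f.φ.f i x.1.1.1 := congr(($h).φ.f i x.1.1.1)
    refine ⟨map_mem_tr g x.2.1, map_mem_tr g x.2.2.1, ?_⟩
    change f'.φ.f i (g.φ.f i x.1.1.1) - x.1.2 ∈ _
    rw [e]
    exact x.2.2.2

variable {f} in
lemma killMap_proj {Y : DGA k} {f' : Y ⟶ C} (g : X ⟶ Y) (h : g ≫ f' = f) :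
    killMap hC n g h ≫ killProj hC n f' = killProj hC n f := rfl

/-- In degrees at most `n` the truncations force `y = 0` and `c = f x`, so the homology is that of
the connective cover of `X`, and `f` is an isomorphism there. In degrees above `n` both sides are
acyclic: `C` by hypothesis, and `kill` because `x` is the boundary of `σ x` up to a `σ`-term. -/
lemma killProj_quasiIso (hH : ∀ i : ℤ, (n : ℤ) < i → Subsingleton (C.cx.homology i))
    (hf : ∀ i : ℤ, i ≤ n → QuasiIsoAt f.φ i) : quasiIso k (killProj hC n f) := by
  rw [quasiIso_iff]
  intro i
  rw [quasiIsoAt_iff]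
  refine ⟨?_, fun c hc => ?_⟩
  · rintro ⟨⟨⟨x, y⟩, c⟩, hx, hy, hc⟩ hd b hb
    have hd₁ : X.cx.d i (i - 1) x + X.shift (i - 1) (i - 1) y = 0 := congr(($hd).1.1.1)
    rw [shift_self] at hd₁
    have hb' : C.cx.d (i + 1) i b = c := hb
    rcases lt_or_ge (n : ℤ) i with hi | hi
    · have hx' : x ∈ X.tr (n + 1) i := by
        rcases (show (n : ℤ) + 1 < i ∨ i = n + 1 by omega) with h | h
        · exact X.mem_tr_of_lt h x
        · refine X.mem_tr_of_mem_Z h.ge ?_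
          have hy' : y = 0 := hy.1 (by omega)
          rwa [hy', add_zero] at hd₁
      -- The bounding chain is `(σ x, b)`: its boundary is `(x - σ d x, d b)`, and `d x = -y`.
      refine ⟨⟨(((0, X.shift i (i + 1 - 1) x) : X.cx.X (i + 1) × X.cx.X (i + 1 - 1)), b),
        zero_mem _, X.shift_mem_tr (by omega) hx', C.mem_tr_of_lt (by omega) _⟩,
        Subtype.ext (Prod.ext (Prod.ext ?_ ?_) hb')⟩
      · change X.cx.d (i + 1) i 0 + X.shift (i + 1 - 1) i (X.shift i (i + 1 - 1) x) = x
        rw [map_zero, zero_add, X.shift_shift (by omega)]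
      · change -X.cx.d (i + 1 - 1) (i - 1) (X.shift i (i + 1 - 1) x) = y
        rw [X.d_shift (by omega), eq_neg_of_add_eq_zero_left hd₁, neg_neg]
    · obtain rfl : y = 0 := hy.1 (by omega)
      obtain rfl : f.φ.f i x = c := sub_eq_zero.1 (hc.1 (by omega))
      rw [add_zero] at hd₁
      rcases lt_or_ge i 0 with hi' | hi'
      · obtain rfl : x = 0 := hx.1 hi'
        exact ⟨0, (map_zero ((kill hC n f).cx.d (i + 1) i).hom).trans
          (Subtype.ext (Prod.ext rfl (map_zero (f.φ.f i).hom).symm))⟩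
      · obtain ⟨x', rfl⟩ := ((quasiIsoAt_iff f i).1 (hf i hi)).1 x hd₁ b hb
        exact ⟨(killIncl hC n f).φ.f (i + 1) ⟨x', X.mem_tr_of_lt (by omega) x'⟩,
          (map_d (killIncl hC n f) _).symm⟩
  · rcases lt_or_ge (n : ℤ) i with hi | hi
    · obtain ⟨b, hb⟩ := (C.subsingleton_homology_iff i).1 (hH i hi) c hc
      exact ⟨0, map_zero ((kill hC n f).cx.d i (i - 1)).hom, -b,
        by rw [map_neg, hb, map_zero, zero_sub]⟩
    · rcases lt_or_ge i 0 with hi' | hi'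
      · obtain rfl : c = 0 := @Subsingleton.elim _ (hC i hi') _ _
        exact ⟨0, map_zero ((kill hC n f).cx.d i (i - 1)).hom, 0, by simp⟩
      · obtain ⟨x, hx, b, hb⟩ := ((quasiIsoAt_iff f i).1 (hf i hi)).2 c hc
        let z : X.cover.cx.X i := ⟨x, X.mem_tr_of_mem_Z hi' hx⟩
        have hz : X.cover.cx.d i (i - 1) z = 0 := Subtype.ext hx
        exact ⟨(killIncl hC n f).φ.f i z, (map_d (killIncl hC n f) z).symm.trans
          ((congrArg _ hz).trans (map_zero ((killIncl hC n f).φ.f (i - 1)).hom)), b, hb⟩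

end Kill

/-! ### Derivations -/

section Derivations

variable {M : Type u} [AddCommGroup M] [Module k M] {C : DGA k} {hC : C.NonNeg} [Module C.H0 M]
  [Module C.H0ᵐᵒᵖ M] [SMulCommClass C.H0 C.H0ᵐᵒᵖ M] [IsScalarTower k C.H0 M]
  [IsScalarTower k C.H0ᵐᵒᵖ M] {p : ℤ} {Y : DGA k}

/-- The `M`-component of a map to `C ∨ Σ^p M`, in degree `i`. -/
noncomputable def compM (a : Y ⟶ sqZero M C hC p) (i : ℤ) : Y.cx.X i →ₗ[k] M :=
  (susp k M p i).subtype ∘ₗ LinearMap.snd k (C.cx.X i) (susp k M p i) ∘ₗ (a.φ.f i).hom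

lemma compM_of_ne (a : Y ⟶ sqZero M C hC p) {i : ℤ} (h : i ≠ p) (x : Y.cx.X i) :
    compM a i x = 0 :=
  (Prod.snd (α := C.cx.X i) (β := susp k M p i) (a.φ.f i x)).2 h

lemma compM_comp {Y' : DGA k} (g : Y' ⟶ Y) (a : Y ⟶ sqZero M C hC p) (i : ℤ) (x : Y'.cx.X i) :
    compM (g ≫ a) i x = compM a i (g.φ.f i x) := rfl

lemma compM_incl (f : Y ⟶ C) (i : ℤ) (x : Y.cx.X i) :
    compM (f ≫ sqZeroIncl M C hC p) i x = 0 := rfl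

lemma compM_d (a : Y ⟶ sqZero M C hC p) (i j : ℤ) (x : Y.cx.X i) :
    compM a j (Y.cx.d i j x) = 0 := by
  have h := congr((Prod.snd (α := C.cx.X j) (β := susp k M p j) $(map_d a x)).1)
  exact h

lemma compM_mul (a : Y ⟶ sqZero M C hC p) {i j l : ℤ} (h : i + j = l) (x : Y.cx.X i)
    (y : Y.cx.X j) : compM a l (Y.mul h x y) =
      C.toH0 hC i ((a ≫ sqZeroProj M C hC p).φ.f i x) • compM a j y +
        MulOpposite.op (C.toH0 hC j ((a ≫ sqZeroProj M C hC p).φ.f j y)) • compM a i x :=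
  congr((Prod.snd (α := C.cx.X l) (β := susp k M p l) $(a.map_mul h x y)).1)

lemma sqZero_hom_ext {a b : Y ⟶ sqZero M C hC p}
    (h : a ≫ sqZeroProj M C hC p = b ≫ sqZeroProj M C hC p)
    (h' : ∀ x : Y.cx.X p, compM a p x = compM b p x) : a = b := by
  refine hom_ext_apply fun i x => Prod.ext congr(($h).φ.f i x) (Subtype.ext ?_)
  change compM a i x = compM b i x
  by_cases hi : i = p
  · subst hi
    exact h' x
  · rw [compM_of_ne a hi, compM_of_ne b hi]

/-- The map to `C ∨ Σ^p M` over `r : Y ⟶ C` that is given by a derivation `Y ⟶ Σ^p M`. -/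
noncomputable def derHom (hp : p ≠ 0) (r : Y ⟶ C) (δ : Y.cx.X p →ₗ[k] M)
    (hd : ∀ i (x : Y.cx.X i), p + 1 = i → δ (Y.cx.d i p x) = 0)
    (hl : ∀ (x : Y.cx.X 0) (y : Y.cx.X p),
      δ (Y.mul (zero_add p) x y) = C.toH0 hC 0 (r.φ.f 0 x) • δ y)
    (hr : ∀ (x : Y.cx.X p) (y : Y.cx.X 0),
      δ (Y.mul (add_zero p) x y) = MulOpposite.op (C.toH0 hC 0 (r.φ.f 0 y)) • δ x)
    (hm : ∀ (i j : ℤ) (h : i + j = p) (x : Y.cx.X i) (y : Y.cx.X j), i ≠ 0 → j ≠ 0 →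
      δ (Y.mul h x y) = 0) : Y ⟶ sqZero M C hC p :=
  homMk (fun i => LinearMap.prod (r.φ.f i).hom (LinearMap.codRestrict (susp k M p i)
      (δ ∘ₗ Y.shift i p) fun x h => by
        change δ (Y.shift i p x) = 0
        rw [Y.shift_of_ne h, map_zero]))
    (fun i j x h => Prod.ext (map_d r x) (Subtype.ext (by
      change δ (Y.shift j p (Y.cx.d i j x)) = 0
      by_cases hj : j = p
      · subst hj
        rw [shift_self, hd i x h]
      · rw [Y.shift_of_ne hj, map_zero])))
    (Prod.ext r.map_one (Subtype.ext (by
      change δ (Y.shift 0 p Y.one) = 0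
      rw [Y.shift_of_ne hp.symm, map_zero])))
    (fun {i j l} h x y => Prod.ext (r.map_mul h x y) (Subtype.ext (by
      change δ (Y.shift l p (Y.mul h x y)) = C.toH0 hC i (r.φ.f i x) • δ (Y.shift j p y) +
        MulOpposite.op (C.toH0 hC j (r.φ.f j y)) • δ (Y.shift i p x)
      by_cases hi : i = 0
      · subst hi
        obtain rfl : j = l := by omega
        by_cases hj : j = p
        · subst hj
          rw [shift_self, shift_self, Y.shift_of_ne hp.symm, map_zero, smul_zero, add_zero]
          exact hl x y
        · rw [Y.shift_of_ne hj, Y.shift_of_ne hj, map_zero, smul_zero, zero_add,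
            Y.shift_of_ne hp.symm, map_zero, smul_zero]
      · rw [C.toH0_of_ne hC hi, zero_smul, zero_add]
        by_cases hj : j = 0
        · subst hj
          obtain rfl : i = l := by omega
          by_cases hi' : i = p
          · subst hi'
            rw [shift_self, shift_self]
            exact hr x y
          · rw [Y.shift_of_ne hi', Y.shift_of_ne hi', map_zero, smul_zero]
        · rw [C.toH0_of_ne hC hj, MulOpposite.op_zero, zero_smul]
          by_cases hl' : l = p
          · subst hl'
            rw [shift_self]
            exact hm i j h x y hi hj
          · rw [Y.shift_of_ne hl', map_zero])))

lemma derHom_proj (hp : p ≠ 0) (r : Y ⟶ C) (δ : Y.cx.X p →ₗ[k] M) (hd hl hr hm) :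
    derHom (hC := hC) hp r δ hd hl hr hm ≫ sqZeroProj M C hC p = r := rfl

lemma compM_derHom (hp : p ≠ 0) (r : Y ⟶ C) (δ : Y.cx.X p →ₗ[k] M) (hd hl hr hm)
    (x : Y.cx.X p) : compM (derHom (hC := hC) hp r δ hd hl hr hm) p x = δ x :=
  congrArg δ (Y.shift_self p x)

lemma compM_mul_left (hp : p ≠ 0) {a : Y ⟶ sqZero M C hC p} {r : Y ⟶ C}
    (h : a ≫ sqZeroProj M C hC p = r) {i : ℤ} (hi : 0 + i = p) (x : Y.cx.X 0) (y : Y.cx.X i) :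
    compM a p (Y.mul hi x y) = C.toH0 hC 0 (r.φ.f 0 x) • compM a i y := by
  rw [compM_mul, compM_of_ne a hp.symm, smul_zero, add_zero, h]

lemma compM_mul_right (hp : p ≠ 0) {a : Y ⟶ sqZero M C hC p} {r : Y ⟶ C}
    (h : a ≫ sqZeroProj M C hC p = r) {i : ℤ} (hi : i + 0 = p) (x : Y.cx.X i) (y : Y.cx.X 0) :
    compM a p (Y.mul hi x y) = MulOpposite.op (C.toH0 hC 0 (r.φ.f 0 y)) • compM a i x := by
  rw [compM_mul, compM_of_ne a hp.symm y, smul_zero, zero_add, h]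

lemma compM_mul_eq_zero (a : Y ⟶ sqZero M C hC p) {i j l : ℤ} (h : i + j = l) (x : Y.cx.X i)
    (y : Y.cx.X j) (hi : i ≠ 0) (hj : j ≠ 0) : compM a l (Y.mul h x y) = 0 := by
  rw [compM_mul, C.toH0_of_ne hC hi, C.toH0_of_ne hC hj, MulOpposite.op_zero, zero_smul, zero_smul,
    add_zero]

/-- The difference of two maps to `C ∨ Σ^p M` over `C`. -/
noncomputable def subHom (hp : p ≠ 0) (a b : Y ⟶ sqZero M C hC p)
    (h : a ≫ sqZeroProj M C hC p = b ≫ sqZeroProj M C hC p) : Y ⟶ sqZero M C hC p :=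
  derHom hp (a ≫ sqZeroProj M C hC p) (compM a p - compM b p)
    (fun i x _ => by
      rw [LinearMap.sub_apply, compM_d, compM_d, sub_zero])
    (fun x y => by
      rw [LinearMap.sub_apply, LinearMap.sub_apply, compM_mul_left hp rfl, compM_mul_left hp h.symm,
        smul_sub])
    (fun x y => by
      rw [LinearMap.sub_apply, LinearMap.sub_apply, compM_mul_right hp rfl,
        compM_mul_right hp h.symm, smul_sub])
    (fun i j h x y hi hj => by
      rw [LinearMap.sub_apply, compM_mul_eq_zero _ _ _ _ hi hj, compM_mul_eq_zero _ _ _ _ hi hj,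
        sub_zero])

/-! ### The connecting homomorphism -/

lemma exists_linearMap_of_ker_le {A B N : Type*} [AddCommGroup A] [AddCommGroup B]
    [AddCommGroup N] [Module k A] [Module k B] [Module k N] (g : A →ₗ[k] B)
    (hg : Function.Surjective g) (h : A →ₗ[k] N) (hgh : ∀ x, g x = 0 → h x = 0) :
    ∃ l : B →ₗ[k] N, ∀ x, l (g x) = h x := by
  refine ⟨(LinearMap.ker g).liftQ h (fun x hx => hgh x hx) ∘ₗ
    (g.quotKerEquivOfSurjective hg).symm.toLinearMap, fun x => ?_⟩
  have e : (g.quotKerEquivOfSurjective hg).symm (g x) = Submodule.Quotient.mk x :=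
    (LinearEquiv.symm_apply_eq _).2 rfl
  exact congrArg ((LinearMap.ker g).liftQ h fun x hx => hgh x hx) e

variable {n : ℕ}

lemma exists_d_of_subsingleton (h₁ : Subsingleton (Y.cx.homology (n + 1))) (z : Y.Z (n + 1)) :
    ∃ c : Y.cx.X (n + 2), Y.cx.d (n + 2) (n + 1) c = z := by
  obtain ⟨b, hb⟩ := (Y.subsingleton_homology_iff _).1 h₁ z z.2
  exact ⟨Y.shift (n + 1 + 1) (n + 2) b, (Y.d_shift (by omega) _ b).trans hb⟩

/-- The linear map `Z_{n+1}(Y) → M` that sends `d c` to the `M`-component of `a c`. -/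
lemma exists_connecting (a : Y ⟶ sqZero M C hC (n + 2))
    (h₁ : Subsingleton (Y.cx.homology (n + 1))) (h₂ : Subsingleton (Y.cx.homology (n + 2))) :
    ∃ α : Y.Z (n + 1) →ₗ[k] M, ∀ (z : Y.Z (n + 1)) (c : Y.cx.X (n + 2)),
      Y.cx.d (n + 2) (n + 1) c = z → α z = compM a (n + 2) c := by
  obtain ⟨α, hα⟩ := exists_linearMap_of_ker_le
    (LinearMap.codRestrict (Y.Z (n + 1)) (Y.cx.d (n + 2) (n + 1)).hom fun c => Y.d_d ..)
    (fun z => by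
      obtain ⟨c, hc⟩ := exists_d_of_subsingleton h₁ z
      exact ⟨c, Subtype.ext hc⟩)
    -- Two choices of `c` differ by a cycle, which is a boundary as `H_{n+2}(Y) = 0`, and the
    -- `M`-component vanishes on boundaries.
    (compM a (n + 2)) (fun c hc => by
      obtain ⟨b, rfl⟩ := (Y.subsingleton_homology_iff _).1 h₂ c
        (Y.d_eq_zero _ (by omega) congr(($hc).1))
      exact compM_d ..)
  exact ⟨α, fun z c h => (congrArg α (Subtype.ext h.symm)).trans (hα c)⟩

/-- The bilinearity of a linear map `Z_{n+1}(X) → M` over `Z_0(X)`. -/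
structure IsBilin {X : DGA k} (hC : C.NonNeg) (f : X ⟶ C) (β : X.Z (n + 1) →ₗ[k] M) : Prop where
  left : ∀ (x : X.Z 0) (z : X.Z (n + 1)),
    β (X.mulZ (zero_add _) x z) = C.toH0 hC 0 (f.φ.f 0 x) • β z
  right : ∀ (x : X.Z 0) (z : X.Z (n + 1)),
    β (X.mulZ (add_zero _) z x) = MulOpposite.op (C.toH0 hC 0 (f.φ.f 0 x)) • β z

/-- If `c` bounds `z` and `x` is a cycle of degree `0`, then `x c` bounds `x z` and `c x` bounds `z
x`. The `M`-component of `a` is a derivation, linear over degree `0` when the other factor has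
degree `n + 2`. -/
lemma isBilin_of_connecting {a : Y ⟶ sqZero M C hC (n + 2)} {r : Y ⟶ C}
    (hr : a ≫ sqZeroProj M C hC (n + 2) = r) (h₁ : Subsingleton (Y.cx.homology (n + 1)))
    {α : Y.Z (n + 1) →ₗ[k] M} (hα : ∀ (z : Y.Z (n + 1)) (c : Y.cx.X (n + 2)),
      Y.cx.d (n + 2) (n + 1) c = z → α z = compM a (n + 2) c) : IsBilin hC r α := by
  refine ⟨fun x z => ?_, fun x z => ?_⟩
  · obtain ⟨c, hc⟩ := exists_d_of_subsingleton h₁ z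
    have hx : Y.cx.d 0 (0 - 1) x = 0 := x.2
    rw [hα z c hc, hα _ (Y.mul (zero_add _) x c), compM_mul_left (by omega) hr]
    rw [Y.leibniz (i' := 0 - 1) (j' := n + 1) (by omega) (by omega) _ (by omega) (zero_add _), hx,
      hc]
    simp [mulZ]
  · obtain ⟨c, hc⟩ := exists_d_of_subsingleton h₁ z
    have hx : Y.cx.d 0 (0 - 1) x = 0 := x.2
    rw [hα z c hc, hα _ (Y.mul (add_zero _) c x), compM_mul_right (by omega) hr]
    rw [Y.leibniz (i' := n + 1) (j' := 0 - 1) (by omega) (by omega) _ (add_zero _) (by omega), hx,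
      hc]
    simp [mulZ]

/-! ### Maps from `kill` to the square-zero extension -/

variable {X : DGA k} {f : X ⟶ C}

lemma shift_d (A : DGA k) (i : ℤ) {j l : ℤ} (h : j = l) (x : A.cx.X i) :
    A.shift j l (A.cx.d i j x) = A.cx.d i l x := by
  subst h
  simp

lemma shift_mul_right (A : DGA k) {i j l j' l' : ℤ} (h : i + j = l) (h' : i + j' = l')
    (hj : j = j') (x : A.cx.X i) (y : A.cx.X j) :
    A.shift l l' (A.mul h x y) = A.mul h' x (A.shift j j' y) := by
  subst hj
  obtain rfl : l = l' := by omega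
  simp

lemma shift_mul_left (A : DGA k) {i j l i' l' : ℤ} (h : i + j = l) (h' : i' + j = l')
    (hi : i = i') (x : A.cx.X i) (y : A.cx.X j) :
    A.shift l l' (A.mul h x y) = A.mul h' (A.shift i i' x) y := by
  subst hi
  obtain rfl : l = l' := by omega
  simp

lemma kill_map_zero (u : (kill hC n f).cx.X 0) : f.φ.f 0 u.1.1.1 = (killProj hC n f).φ.f 0 u :=
  sub_eq_zero.1 (u.2.2.2.1 (by omega))

/-- The component `y` of an element `(x + σ y, c)` of degree `n + 2`, as a cycle. -/
def killZ (hC : C.NonNeg) (n : ℕ) (f : X ⟶ C) : (kill hC n f).cx.X (n + 2) →ₗ[k] X.Z (n + 1) :=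
  LinearMap.codRestrict (X.Z (n + 1))
    (X.shift (n + 2 - 1) (n + 1) ∘ₗ LinearMap.snd k (X.cx.X (n + 2)) (X.cx.X (n + 2 - 1)) ∘ₗ
      LinearMap.fst k _ (C.cx.X (n + 2)) ∘ₗ ((killSub hC n f).carrier (n + 2)).subtype)
    fun u => (X.shift_mem_tr (by omega) u.2.2.1).2 rfl

/-- The component `x` of an element `(x + σ y, c)`. -/
def killX (hC : C.NonNeg) (n : ℕ) (f : X ⟶ C) (i : ℤ) : (kill hC n f).cx.X i →ₗ[k] X.cx.X i :=
  LinearMap.fst k (X.cx.X i) (X.cx.X (i - 1)) ∘ₗ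
      LinearMap.fst k _ (C.cx.X i) ∘ₗ ((killSub hC n f).carrier i).subtype

/-- The map from `kill` to the square-zero extension that is given by a map on `X` and a
linear map on the cycles of `X`. -/
noncomputable def killHom (a : X ⟶ sqZero M C hC (n + 2))
    (ha : a ≫ sqZeroProj M C hC (n + 2) = f) (β : X.Z (n + 1) →ₗ[k] M) (hβ : IsBilin hC f β)
    (hd : ∀ (z : X.Z (n + 1)) (c : X.cx.X (n + 2)),
      X.cx.d (n + 2) (n + 1) c = z → β z = compM a (n + 2) c) :
    kill hC n f ⟶ sqZero M C hC (n + 2) :=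
  -- The derivation is `x + σ y ↦ a x + β y`. It kills the boundary `d x + y - σ d y` because `a`
  -- kills `d x` and `hd` gives `a y = β (d y)`.
  derHom (by omega) (killProj hC n f) (compM a (n + 2) ∘ₗ killX hC n f (n + 2) + β ∘ₗ killZ hC n f)
    (fun i u h => by
      subst h
      have e : killX hC n f _ ((kill hC n f).cx.d (n + 2 + 1) (n + 2) u) =
        X.cx.d (n + 2 + 1) (n + 2) u.1.1.1 + X.shift (n + 2 + 1 - 1) (n + 2) u.1.1.2 := rfl
      have e' : killZ hC n f ((kill hC n f).cx.d (n + 2 + 1) (n + 2) u) =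
        -⟨X.cx.d (n + 2) (n + 1) (X.shift (n + 2 + 1 - 1) (n + 2) u.1.1.2), X.d_d ..⟩ := by
        refine Subtype.ext ?_
        change X.shift (n + 2 - 1) (n + 1) (-X.cx.d (n + 2 + 1 - 1) (n + 2 - 1) u.1.1.2) =
          -X.cx.d (n + 2) (n + 1) (X.shift (n + 2 + 1 - 1) (n + 2) u.1.1.2)
        rw [map_neg, shift_d _ _ (by omega), d_shift _ (by omega)]
      rw [LinearMap.add_apply, LinearMap.comp_apply, LinearMap.comp_apply, e, e', map_add, compM_d,
        map_neg, hd _ _ rfl]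
      simp)
    (fun u v => by
      have e : killX hC n f _ ((kill hC n f).mul (zero_add _) u v) =
        X.mul (zero_add _) u.1.1.1 v.1.1.1 := rfl
      have e' : killZ hC n f ((kill hC n f).mul (zero_add _) u v) =
          X.mulZ (zero_add _) ⟨u.1.1.1, u.2.1.2 rfl⟩ (killZ hC n f v) := by
        refine Subtype.ext ?_
        change X.shift (n + 2 - 1) (n + 1) (X.mul (by omega) u.1.1.2 v.1.1.1 +
            (0 : ℤ).negOnePow • X.mul (show 0 + ((n : ℤ) + 2 - 1) = n + 2 - 1 by omega)
              u.1.1.1 v.1.1.2) =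
          X.mul (zero_add _) u.1.1.1 (X.shift (n + 2 - 1) (n + 1) v.1.1.2)
        -- An element of degree `0` has no `σ`-component, as that lies below the truncation degree
        -- `n + 1`.
        have hu : u.1.1.2 = 0 := u.2.2.1.1 (by omega)
        rw [hu, map_zero, LinearMap.zero_apply, zero_add, Int.negOnePow_zero, one_smul]
        exact X.shift_mul_right _ _ (by omega) _ _
      rw [LinearMap.add_apply, LinearMap.comp_apply, LinearMap.comp_apply, e, e',
        compM_mul_left (by omega) ha, hβ.left, ← smul_add, kill_map_zero]
      rfl)
    (fun u v => by
      have e : killX hC n f _ ((kill hC n f).mul (add_zero _) u v) =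
        X.mul (add_zero _) u.1.1.1 v.1.1.1 := rfl
      have e' : killZ hC n f ((kill hC n f).mul (add_zero _) u v) =
          X.mulZ (add_zero _) (killZ hC n f u) ⟨v.1.1.1, v.2.1.2 rfl⟩ := by
        refine Subtype.ext ?_
        change X.shift (n + 2 - 1) (n + 1) (X.mul (show (n : ℤ) + 2 - 1 + 0 = n + 2 - 1 by omega)
            u.1.1.2 v.1.1.1 + ((n : ℤ) + 2).negOnePow •
              X.mul (show (n : ℤ) + 2 + (0 - 1) = n + 2 - 1 by omega) u.1.1.1 v.1.1.2) =
          X.mul (add_zero _) (X.shift (n + 2 - 1) (n + 1) u.1.1.2) v.1.1.1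
        have hv : v.1.1.2 = 0 := v.2.2.1.1 (by omega)
        rw [hv, map_zero, smul_zero, add_zero]
        exact X.shift_mul_left _ _ (by omega) _ _
      rw [LinearMap.add_apply, LinearMap.comp_apply, LinearMap.comp_apply, e, e',
        compM_mul_right (by omega) ha, hβ.right, ← smul_add, kill_map_zero]
      rfl)
    (fun i j h u v hi hj => by
      have e : killX hC n f _ ((kill hC n f).mul h u v) = X.mul h u.1.1.1 v.1.1.1 := rfl
      have e' : killZ hC n f ((kill hC n f).mul h u v) = 0 := by
        refine Subtype.ext ?_
        change X.shift (n + 2 - 1) (n + 1)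
          (X.mul (show i - 1 + j = (n : ℤ) + 2 - 1 by omega) u.1.1.2 v.1.1.1 +
            i.negOnePow • X.mul (show i + (j - 1) = (n : ℤ) + 2 - 1 by omega) u.1.1.1 v.1.1.2) = 0
        -- If `j < 0` the connective cover makes the right factor zero; if `j > 0` then `i - 1 < n +
        -- 1` and the `σ`-component of `u` is truncated away.
        have h₁ : X.mul (show i - 1 + j = (n : ℤ) + 2 - 1 by omega) u.1.1.2 v.1.1.1 = 0 := by
          rcases lt_or_ge j 0 with hj' | hj'
          · have hv : v.1.1.1 = 0 := v.2.1.1 hj'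
            rw [hv, map_zero]
          · have hu : u.1.1.2 = 0 := u.2.2.1.1 (by omega)
            rw [hu, map_zero, LinearMap.zero_apply]
        have h₂ : X.mul (show i + (j - 1) = (n : ℤ) + 2 - 1 by omega) u.1.1.1 v.1.1.2 = 0 := by
          rcases lt_or_ge i 0 with hi' | hi'
          · have hu : u.1.1.1 = 0 := u.2.1.1 hi'
            rw [hu, map_zero, LinearMap.zero_apply]
          · have hv : v.1.1.2 = 0 := v.2.2.1.1 (by omega)
            rw [hv, map_zero]
        rw [h₁, h₂, smul_zero, add_zero, map_zero]
      rw [LinearMap.add_apply, LinearMap.comp_apply, LinearMap.comp_apply, e, e',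
        compM_mul_eq_zero _ _ _ _ hi hj, map_zero, add_zero])

variable {a : X ⟶ sqZero M C hC (n + 2)} {ha : a ≫ sqZeroProj M C hC (n + 2) = f}
  {β : X.Z (n + 1) →ₗ[k] M} {hβ : IsBilin hC f β} {hd : ∀ (z : X.Z (n + 1)) (c : X.cx.X (n + 2)),
    X.cx.d (n + 2) (n + 1) c = z → β z = compM a (n + 2) c}

lemma killHom_proj : killHom a ha β hβ hd ≫ sqZeroProj M C hC (n + 2) = killProj hC n f := rfl

lemma compM_killHom (u : (kill hC n f).cx.X (n + 2)) : compM (killHom a ha β hβ hd) (n + 2) u =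
    compM a (n + 2) (killX hC n f (n + 2) u) + β (killZ hC n f u) := compM_derHom ..

/-- Elements of the connective cover have no `σ`-component, so `β` does not contribute. -/
lemma killIncl_killHom : killIncl hC n f ≫ killHom a ha β hβ hd = X.coverIncl ≫ a := by
  refine sqZero_hom_ext ?_ fun x => ?_
  · rw [Category.assoc, killHom_proj, killIncl_proj, Category.assoc, ha]
  · rw [compM_comp, compM_killHom]
    have e : killZ hC n f ((killIncl hC n f).φ.f (n + 2) x) = 0 :=
      Subtype.ext (map_zero (X.shift (n + 2 - 1) (n + 1)))
    rw [e, map_zero, add_zero]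
    rfl

end Derivations

/-! ### The extension classified by a map to the square-zero extension -/

section Ext

variable {M : Type u} [AddCommGroup M] [Module k M] {C : DGA k} {hC : C.NonNeg} [Module C.H0 M]
  [Module C.H0ᵐᵒᵖ M] [SMulCommClass C.H0 C.H0ᵐᵒᵖ M] [IsScalarTower k C.H0 M]
  [IsScalarTower k C.H0ᵐᵒᵖ M] {n : ℕ} {Y : DGA k} (a : Y ⟶ sqZero M C hC (n + 2))

/-- The `Σ^{n+1} M`-component of the differential of the extension. -/
noncomputable def extD (i j : ℤ) : Y.cx.X i →ₗ[k] susp k M (n + 1) j :=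
  LinearMap.codRestrict _ (if j + 1 = i then -compM a i else 0) fun y h => by
    split_ifs with h'
    · rw [LinearMap.neg_apply, compM_of_ne a (by omega), neg_zero]
    · rfl

lemma extD_of_ne {i j : ℤ} (h : j + 1 ≠ i) (y : Y.cx.X i) : extD a i j y = 0 := by
  refine Subtype.ext ?_
  change (if j + 1 = i then -compM a i else 0) y = 0
  rw [if_neg h, LinearMap.zero_apply]

lemma coe_extD {i j : ℤ} (h : j + 1 = i) (y : Y.cx.X i) : (extD a i j y : M) = -compM a i y := by
  change (if j + 1 = i then -compM a i else 0) y = _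
  rw [if_pos h, LinearMap.neg_apply]

/-- The morphism to `C`, on elements of `Y ⊕ Σ^{n+1} M`. -/
noncomputable def extToSqZero (i : ℤ) :
    (Y.cx.X i × susp k M (n + 1) i) →ₗ[k] (C.cx.X i × susp k M (n + 1) i) :=
  LinearMap.prodMap ((a ≫ sqZeroProj M C hC (n + 2)).φ.f i).hom LinearMap.id

/-- The product of `Y ⊕ Σ^{n+1} M`. -/
noncomputable def extMul {i j l : ℤ} (h : i + j = l) :
    (Y.cx.X i × susp k M (n + 1) i) →ₗ[k] (Y.cx.X j × susp k M (n + 1) j) →ₗ[k]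
      (Y.cx.X l × susp k M (n + 1) l) :=
  LinearMap.mk₂ k (fun u v => (Y.mul h u.1 v.1,
      (sqZeroMul M C hC (n + 1) h (extToSqZero a i u) (extToSqZero a j v)).2))
    (fun _ _ _ => Prod.ext (by simp) (by rw [map_add, map_add]; rfl))
    (fun _ _ _ => Prod.ext (by simp) (by rw [map_smul, map_smul]; rfl))
    (fun _ _ _ => Prod.ext (by simp) (by rw [map_add, map_add]; rfl))
    (fun _ _ _ => Prod.ext (by simp) (by rw [map_smul, map_smul]; rfl))

lemma coe_extMul_snd {i j l : ℤ} (h : i + j = l) (u : Y.cx.X i × susp k M (n + 1) i)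
    (v : Y.cx.X j × susp k M (n + 1) j) : ((extMul a h u v).2 : M) =
      C.toH0 hC i ((a ≫ sqZeroProj M C hC (n + 2)).φ.f i u.1) • (v.2 : M) +
        MulOpposite.op (C.toH0 hC j ((a ≫ sqZeroProj M C hC (n + 2)).φ.f j v.1)) • (u.2 : M) := rfl

/-- The `M`-part of the product on the extension is pulled back from the square-zero extension by
`Σ^{n+1} M`; associativity is inherited from there. -/
lemma extToSqZero_mul {i j l : ℤ} (h : i + j = l) (u : Y.cx.X i × susp k M (n + 1) i)
    (v : Y.cx.X j × susp k M (n + 1) j) : extToSqZero a l (extMul a h u v) =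
      sqZeroMul M C hC (n + 1) h (extToSqZero a i u) (extToSqZero a j v) :=
  Prod.ext ((a ≫ sqZeroProj M C hC (n + 2)).map_mul h _ _) rfl

set_option linter.unusedSectionVars false in
-- Only degree `0` acts nontrivially on `M`, and there the sign is `1`.
lemma negOnePow_smul_toH0 (i : ℤ) (c : C.cx.X i) (m : M) :
    i.negOnePow • C.toH0 hC i c • m = C.toH0 hC i c • m := by
  by_cases hi : i = 0
  · subst hi
    rw [Int.negOnePow_zero, one_smul]
  · rw [C.toH0_of_ne hC hi, zero_smul, smul_zero]

/-- The dga `Y ⊕ Σ^{n+1} M` with the differential twisted by `a : Y ⟶ C ∨ Σ^{n+2} M`. -/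
noncomputable def ext : DGA k :=
  mk' (fun i => Y.cx.X i × susp k M (n + 1) i)
    (fun i j => LinearMap.prod (Y.cx.d i j).hom (extD a i j) ∘ₗ LinearMap.fst k _ _)
    (fun i j h u => Prod.ext (Y.d_of_ne h _) (extD_of_ne a h _))
    (fun i j l _ hl u => Prod.ext (Y.d_d ..) (Subtype.ext (by
      change (extD a j l (Y.cx.d i j u.1) : M) = 0
      rw [coe_extD a hl, compM_d, neg_zero])))
    (Y.one, 0)
    (extMul a)
    (fun {i} u => Prod.ext (Y.one_mul _) (by
      have e : extToSqZero a 0 (Y.one, 0) = (sqZero M C hC (n + 1)).one :=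
        Prod.ext (a ≫ sqZeroProj M C hC (n + 2)).map_one rfl
      have := congr(Prod.snd (α := C.cx.X i) (β := susp k M (n + 1) i)
        $((sqZero M C hC (n + 1)).one_mul (extToSqZero a i u)))
      rw [← e] at this
      exact this))
    (fun {i} u => Prod.ext (Y.mul_one _) (by
      have e : extToSqZero a 0 (Y.one, 0) = (sqZero M C hC (n + 1)).one :=
        Prod.ext (a ≫ sqZeroProj M C hC (n + 2)).map_one rfl
      have := congr(Prod.snd (α := C.cx.X i) (β := susp k M (n + 1) i)
        $((sqZero M C hC (n + 1)).mul_one (extToSqZero a i u)))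
      rw [← e] at this
      exact this))
    (fun {i₁ i₂ i₃ i₁₂ i₂₃ i} h₁₂ h₂₃ h h' x y z => Prod.ext (Y.mul_assoc ..) (by
      change (sqZeroMul M C hC (n + 1) h (extToSqZero a i₁₂ (extMul a h₁₂ x y))
        (extToSqZero a i₃ z)).2 = (sqZeroMul M C hC (n + 1) h' (extToSqZero a i₁ x)
        (extToSqZero a i₂₃ (extMul a h₂₃ y z))).2
      rw [extToSqZero_mul, extToSqZero_mul]
      exact congr(Prod.snd (α := C.cx.X i) (β := susp k M (n + 1) i)
        $((sqZero M C hC (n + 1)).mul_assoc h₁₂ h₂₃ h h' (extToSqZero a i₁ x) (extToSqZero a i₂ y)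
          (extToSqZero a i₃ z)))))
    (Prod.ext Y.d_one (Subtype.ext (by
      change (extD a 0 (-1) Y.one : M) = 0
      rw [coe_extD a (by omega), compM_of_ne a (by omega), neg_zero])))
    (fun {i i' j j' l l'} hi hj h h₁ h₂ u v => Prod.ext (Y.leibniz hi hj h h₁ h₂ ..) (Subtype.ext (by
      change (extD a l l' (Y.mul h u.1 v.1) : M) = ((extMul a h₁ (Y.cx.d i i' u.1, extD a i i' u.1)
        v).2 : M) + ((i.negOnePow • (extMul a h₂ u (Y.cx.d j j' v.1, extD a j j' v.1)).2 :
          susp k M (n + 1) l') : M)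
      -- Boundaries act as zero on `M`, so the terms in `u.2` and `v.2` drop out. What remains is
      -- the derivation property of the `M`-component of `a`, negated.
      rw [Units.smul_def, Submodule.coe_smul_of_tower, coe_extMul_snd, coe_extMul_snd, map_d, map_d,
        toH0_d, toH0_d, zero_smul, MulOpposite.op_zero, zero_smul, zero_add, add_zero,
        coe_extD a hi, coe_extD a hj, coe_extD a (by omega), ← Units.smul_def,
        negOnePow_smul_toH0, compM_mul, smul_neg, smul_neg, neg_add, add_comm])))

/-- The projection of the extension. -/
noncomputable def extProj : ext a ⟶ Y :=
  homMk (fun _ => LinearMap.fst k _ _) (fun _ _ _ _ => rfl) rfl (fun _ _ _ => rfl)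

/-- The lift to the extension of a morphism on which the derivation vanishes. -/
noncomputable def extLift {W : DGA k} (g : W ⟶ Y) (h : ∀ i x, compM (g ≫ a) i x = 0) :
    W ⟶ ext a :=
  homMk (fun i => LinearMap.prod (g.φ.f i).hom 0)
    (fun i j x hj => Prod.ext (map_d g x) (Subtype.ext (by
      change (0 : M) = extD a i j (g.φ.f i x)
      rw [coe_extD a hj, ← compM_comp, h, neg_zero])))
    (Prod.ext g.map_one rfl)
    (fun {i j l} hl x y => Prod.ext (g.map_mul hl x y) (Subtype.ext (by
      change (0 : M) = C.toH0 hC i _ • (0 : M) + MulOpposite.op (C.toH0 hC j _) • (0 : M)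
      rw [smul_zero, smul_zero, add_zero])))

variable {a} in
/-- The functoriality of the extension. -/
noncomputable def extMap {Y' : DGA k} {a' : Y' ⟶ sqZero M C hC (n + 2)} (g : Y ⟶ Y')
    (h : g ≫ a' = a) : ext a ⟶ ext a' :=
  homMk (fun i => LinearMap.prodMap (g.φ.f i).hom LinearMap.id)
    (fun i j u hj => Prod.ext (map_d g _) (Subtype.ext (by
      change (extD a i j u.1 : M) = extD a' i j (g.φ.f i u.1)
      rw [coe_extD a hj, coe_extD a' hj, ← h, compM_comp])))
    (Prod.ext g.map_one rfl)
    (fun {i j l} hl u v => Prod.ext (g.map_mul hl _ _) (by subst h; rfl))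

variable {a} in
lemma extMap_proj {Y' : DGA k} {a' : Y' ⟶ sqZero M C hC (n + 2)} (g : Y ⟶ Y')
    (h : g ≫ a' = a) : extMap g h ≫ extProj a' = extProj a ≫ g := rfl

/-- The summand `M` sits in degree `n + 1` and is hit only from degree `n + 2`, so it is invisible
to homology in degrees at most `n`. -/
lemma extProj_quasiIsoAt {i : ℤ} (hi : i ≤ n) : QuasiIsoAt (extProj a).φ i := by
  rw [quasiIsoAt_iff]
  refine ⟨?_, fun y hy => ?_⟩
  · rintro ⟨y, m⟩ - b hb
    refine ⟨((b, 0) : Y.cx.X (i + 1) × susp k M (n + 1) (i + 1)), Prod.ext hb (Subtype.ext ?_)⟩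
    change (extD a (i + 1) i b : M) = m
    rw [coe_extD a rfl, compM_of_ne a (by omega), m.2 (by omega), neg_zero]
  · refine ⟨((y, 0) : Y.cx.X i × susp k M (n + 1) i), Prod.ext hy (Subtype.ext ?_), 0, ?_⟩
    · change (extD a i (i - 1) y : M) = 0
      rw [coe_extD a (by omega), compM_of_ne a (by omega), neg_zero]
    · exact (map_zero (Y.cx.d (i + 1) i).hom).trans (sub_self y).symm

lemma ext_subsingleton {i : ℤ} (hi : (n : ℤ) + 1 < i) (h : Subsingleton (Y.cx.homology i)) :
    Subsingleton ((ext a).cx.homology i) := by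
  rw [subsingleton_homology_iff] at h ⊢
  rintro ⟨y, m⟩ hd
  obtain ⟨b, hb⟩ := h y congr(($hd).1)
  refine ⟨((b, 0) : Y.cx.X (i + 1) × susp k M (n + 1) (i + 1)), Prod.ext hb (Subtype.ext ?_)⟩
  change (extD a (i + 1) i b : M) = m
  rw [coe_extD a rfl, compM_of_ne a (by omega), m.2 (by omega), neg_zero]

/-- The universal extension `C ⊕ Σ^{n+2} M ⊕ Σ^{n+1} M` of `C ∨ Σ^{n+2} M` is equivalent to `C`. -/
lemma ext_id_isTrivFib : IsTrivFib (extProj (𝟙 (sqZero M C hC (n + 2))) ≫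
    sqZeroProj M C hC (n + 2)) where
  surj i c := ⟨(((c, 0) : C.cx.X i × susp k M (n + 2) i), 0), rfl⟩
  exists_d := by
    rintro i ⟨⟨c, m₂⟩, m₁⟩ hc hd
    obtain rfl : c = 0 := hc
    have hm : (m₂ : M) = 0 := by
      have : (extD (𝟙 (sqZero M C hC (n + 2))) i (i - 1)
        ((0, m₂) : C.cx.X i × susp k M (n + 2) i) : M) = 0 := congr((($hd).2 : M))
      exact neg_eq_zero.1 ((coe_extD (𝟙 (sqZero M C hC (n + 2))) (by omega) _).symm.trans this)
    -- The twisted differential maps `Σ^{n+2} M` onto `Σ^{n+1} M` by `-1`, so the kernel over `C` is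
    -- a cone and `-m₁`, one degree higher, bounds.
    refine ⟨(((0, ⟨-(m₁ : M), fun h => by rw [m₁.2 (by omega), neg_zero]⟩) :
        C.cx.X (i + 1) × susp k M (n + 2) (i + 1)), 0), rfl,
      Prod.ext (Prod.ext (map_zero (C.cx.d (i + 1) i).hom) (Subtype.ext hm.symm))
        (Subtype.ext ?_)⟩
    exact (coe_extD (𝟙 (sqZero M C hC (n + 2))) rfl _).trans (neg_neg _)

lemma exists_homologyEquiv (A : DGA k) (i : ℤ) (φ : A.Z i →ₗ[k] M) (hφ : Function.Surjective φ)
    (hk : ∀ z, φ z = 0 ↔ ∃ b : A.cx.X (i + 1), A.cx.d (i + 1) i b = z) :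
    ∃ θ : A.cx.homology i ≃ₗ[k] M, ∀ z, θ (A.cls i z) = φ z := by
  obtain ⟨l, hl⟩ := exists_linearMap_of_ker_le (A.cls i) (A.cls_surjective i) φ
    fun z hz => (hk z).2 ((A.cls_eq_zero_iff i z).1 hz)
  refine ⟨LinearEquiv.ofBijective l ⟨?_, ?_⟩, hl⟩
  · rw [injective_iff_map_eq_zero]
    intro y hy
    obtain ⟨z, rfl⟩ := A.cls_surjective i y
    rw [hl, hk] at hy
    exact (A.cls_eq_zero_iff i z).2 hy
  · intro m
    obtain ⟨z, rfl⟩ := hφ m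
    exact ⟨_, hl z⟩

lemma h0map_cls0 {X : DGA k} (hC : C.NonNeg) (f : X ⟶ C) (x : X.Z 0) :
    h0map f (X.cls0 x) = C.toH0 hC 0 (f.φ.f 0 x) := by
  rw [C.toH0_zero hC _ (C.mem_Z_zero hC _)]
  exact hmap_cls f 0 x

/-- The map `(y, m) ↦ α y + m` on cycles of degree `n + 1` of the extension. -/
noncomputable def extCycle (α : Y.Z (n + 1) →ₗ[k] M) : (ext a).Z (n + 1) →ₗ[k] M :=
  α ∘ₗ LinearMap.codRestrict (Y.Z (n + 1)) (((extProj a).φ.f (n + 1)).hom ∘ₗ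
      ((ext a).Z (n + 1)).subtype) (fun z => map_mem_Z (extProj a) z.2) +
    (susp k M (n + 1) (n + 1)).subtype ∘ₗ
      LinearMap.snd k (Y.cx.X (n + 1)) (susp k M (n + 1) (n + 1)) ∘ₗ ((ext a).Z (n + 1)).subtype

lemma ext_mem_Z {z : Y.cx.X (n + 1)} (hz : z ∈ Y.Z (n + 1)) (m : susp k M (n + 1) (n + 1)) :
    ((z, m) : Y.cx.X (n + 1) × susp k M (n + 1) (n + 1)) ∈ (ext a).Z (n + 1) :=
  Prod.ext hz (Subtype.ext (by
    change (extD a (n + 1) (n + 1 - 1) z : M) = 0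
    rw [coe_extD a (by omega), compM_of_ne a (by omega), neg_zero]))

lemma compM_shift {p : ℤ} (b : Y ⟶ sqZero M C hC p) {i j : ℤ} (h : i = j) (x : Y.cx.X i) :
    compM b j (Y.shift i j x) = compM b i x := by
  subst h
  rw [shift_self]

/-- The long exact sequence by hand: if `y = d b`, subtracting `d (b, 0) = (y, -a b)` from the cycle
`(y, m)` leaves `(0, a b + m)`, and `a b = α y`. -/
lemma exists_ext_equiv (h₁ : Subsingleton (Y.cx.homology (n + 1)))
    {α : Y.Z (n + 1) →ₗ[k] M} (hα : ∀ (z : Y.Z (n + 1)) (c : Y.cx.X (n + 2)),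
      Y.cx.d (n + 2) (n + 1) c = z → α z = compM a (n + 2) c) :
    ∃ θ : (ext a).cx.homology (n + 1) ≃ₗ[k] M, ∀ z, θ ((ext a).cls (n + 1) z) = extCycle a α z := by
  refine exists_homologyEquiv _ _ _ (fun m => ?_) fun z => ?_
  · refine ⟨⟨_, ext_mem_Z a (zero_mem _) ⟨m, fun h => absurd rfl h⟩⟩, ?_⟩
    change α 0 + m = m
    rw [map_zero, zero_add]
  · obtain ⟨⟨y, m⟩, hz⟩ := z
    have hy : y ∈ Y.Z (n + 1) := map_mem_Z (extProj a) hz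
    have key (b : Y.cx.X (n + 1 + 1)) (hb : Y.cx.d (n + 1 + 1) (n + 1) b = y) :
        α ⟨y, hy⟩ = compM a (n + 1 + 1) b := by
      rw [hα ⟨y, hy⟩ (Y.shift _ _ b) ((Y.d_shift (by omega) _ b).trans hb),
        compM_shift a (by omega)]
    change α ⟨y, hy⟩ + (m : M) = 0 ↔ _
    constructor
    · intro h
      obtain ⟨b, hb⟩ := (Y.subsingleton_homology_iff _).1 h₁ y hy
      refine ⟨((b, 0) : Y.cx.X (n + 1 + 1) × susp k M (n + 1) (n + 1 + 1)),
        Prod.ext hb (Subtype.ext ?_)⟩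
      change (extD a (n + 1 + 1) (n + 1) b : M) = m
      rw [coe_extD a rfl, ← key b hb, neg_eq_of_add_eq_zero_right h]
    · rintro ⟨⟨b, m'⟩, hb⟩
      have hb₁ : Y.cx.d (n + 1 + 1) (n + 1) b = y := congr(($hb).1)
      have hb₂ : (extD a (n + 1 + 1) (n + 1) b : M) = m := congr((($hb).2 : M))
      rw [key b hb₁, ← hb₂, coe_extD a rfl, add_neg_cancel]

lemma isBilin_extCycle {q : Y ⟶ C} (hq : a ≫ sqZeroProj M C hC (n + 2) = q)
    {α : Y.Z (n + 1) →ₗ[k] M} (hα : IsBilin hC q α) :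
    IsBilin hC (extProj a ≫ q) (extCycle a α) := by
  subst hq
  refine ⟨fun x z => ?_, fun x z => ?_⟩
  · have e := hα.left ⟨_, map_mem_Z (extProj a) x.2⟩ ⟨_, map_mem_Z (extProj a) z.2⟩
    refine (congrArg₂ (· + ·) e (coe_extMul_snd a (zero_add _) x.1 z.1)).trans ?_
    rw [C.toH0_of_ne hC (i := n + 1) (by omega), MulOpposite.op_zero, zero_smul, add_zero]
    exact (smul_add _ _ _).symm
  · have e := hα.right ⟨_, map_mem_Z (extProj a) x.2⟩ ⟨_, map_mem_Z (extProj a) z.2⟩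
    refine (congrArg₂ (· + ·) e (coe_extMul_snd a (add_zero _) z.1 x.1)).trans ?_
    rw [C.toH0_of_ne hC (i := n + 1) (by omega), zero_smul, zero_add]
    exact (smul_add _ _ _).symm

set_option linter.unusedSectionVars false in
-- Classes in `H_0(X)` and `H_{n+1}(X)` are represented by cycles, so bilinearity may be checked on
-- cycles.
lemma bimodIso_of_isBilin (E : PostnikovExt C n) (θ : E.X.cx.homology (n + 1) ≃ₗ[k] M)
    (φ : E.X.Z (n + 1) →ₗ[k] M) (hφ : IsBilin hC E.f φ) (h : ∀ z, θ (E.X.cls (n + 1) z) = φ z) :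
    ∃ iso : E.BimodIso M, ∀ z, iso.θ (E.X.cls (n + 1) z) = φ z := by
  refine ⟨⟨θ, fun x y => ?_, fun x y => ?_⟩, h⟩
  · obtain ⟨x, rfl⟩ := E.X.cls0_surjective x
    obtain ⟨z, rfl⟩ := E.X.cls_surjective _ y
    rw [h0map_cls0 hC, h, ← hφ.left, ← h]
    exact congrArg θ (E.X.hmul_cls _ x z)
  · obtain ⟨x, rfl⟩ := E.X.cls0_surjective x
    obtain ⟨z, rfl⟩ := E.X.cls_surjective _ y
    rw [h0map_cls0 hC, h, ← hφ.right, ← h]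
    exact congrArg θ (E.X.hmul_cls _ z x)

set_option linter.unusedSectionVars false in
lemma isBilin_of_bimodIso {E : PostnikovExt C n} (iso : E.BimodIso M) :
    IsBilin hC E.f (iso.θ.toLinearMap ∘ₗ E.X.cls (n + 1)) := by
  refine ⟨fun x z => ?_, fun x z => ?_⟩
  · rw [← h0map_cls0 hC]
    refine Eq.trans ?_ (iso.map_left (E.X.cls0 x) (E.X.cls (n + 1) z))
    exact congrArg iso.θ (E.X.hmul_cls _ x z).symm
  · rw [← h0map_cls0 hC]
    refine Eq.trans ?_ (iso.map_right (E.X.cls0 x) (E.X.cls (n + 1) z))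
    exact congrArg iso.θ (E.X.hmul_cls _ z x).symm

lemma subsingleton_homology_of_quasiIso
    (hH : ∀ i : ℤ, (n : ℤ) < i → Subsingleton (C.cx.homology i)) {q : Y ⟶ C} (hq : quasiIso k q)
    {i : ℤ} (hi : (n : ℤ) < i) : Subsingleton (Y.cx.homology i) :=
  (subsingleton_homology_congr ((quasiIso_iff q).1 hq i)).2 (hH i hi)

/-- The Postnikov extension classified by a span. -/
noncomputable def extPostnikov (hH : ∀ i : ℤ, (n : ℤ) < i → Subsingleton (C.cx.homology i))
    {q : Y ⟶ C} (hq : quasiIso k q) : PostnikovExt C n where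
  X := ext a
  f := extProj a ≫ q
  eqPostnikov := eqPostnikov_of_subsingleton fun i hi =>
    ext_subsingleton a (by simpa using hi)
      (subsingleton_homology_of_quasiIso hH hq (by push_cast at hi; omega))
  quasiIsoAt i hi := by
    have h₁ := extProj_quasiIsoAt a hi
    have h₂ := (quasiIso_iff q).1 hq i
    exact inferInstanceAs (QuasiIsoAt ((extProj a).φ ≫ q.φ) i)

lemma exists_extPostnikov_bimodIso
    (hH : ∀ i : ℤ, (n : ℤ) < i → Subsingleton (C.cx.homology i)) {q : Y ⟶ C} (hq : quasiIso k q)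
    (ha : a ≫ sqZeroProj M C hC (n + 2) = q) :
    ∃ iso : (extPostnikov a hH hq).BimodIso M, ∀ (z : (ext a).Z (n + 1)) (c : Y.cx.X (n + 2)),
      Y.cx.d (n + 2) (n + 1) c = (extProj a).φ.f (n + 1) z →
      iso.θ ((ext a).cls (n + 1) z) = compM a (n + 2) c +
        (Prod.snd (α := Y.cx.X (n + 1)) (β := susp k M (n + 1) (n + 1)) z.1 : M) := by
  have h₁ : Subsingleton (Y.cx.homology (n + 1)) :=
    subsingleton_homology_of_quasiIso hH hq (by omega)
  obtain ⟨α, hα⟩ := exists_connecting a h₁ (subsingleton_homology_of_quasiIso hH hq (by omega))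
  obtain ⟨θ, hθ⟩ := exists_ext_equiv a h₁ hα
  obtain ⟨iso, hiso⟩ := bimodIso_of_isBilin (extPostnikov a hH hq) θ _
    (isBilin_extCycle a ha (isBilin_of_connecting ha h₁ hα)) hθ
  refine ⟨iso, fun z c hc => (hiso z).trans ?_⟩
  rw [← hα ⟨_, map_mem_Z (extProj a) z.2⟩ c hc]
  rfl

end Ext

/-! ### Extensions and spans -/

section Classification

variable {M : Type u} [AddCommGroup M] [Module k M] {C : DGA k} {hC : C.NonNeg} [Module C.H0 M]
  [Module C.H0ᵐᵒᵖ M] [SMulCommClass C.H0 C.H0ᵐᵒᵖ M] [IsScalarTower k C.H0 M]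
  [IsScalarTower k C.H0ᵐᵒᵖ M] {n : ℕ}

set_option linter.unusedSectionVars false in
-- Degrees up to `n` are controlled by the maps to `C`, degree `n + 1` by the identifications with
-- `M`, and above that both homologies vanish.
lemma RigidExt.quasiIso_of_comm {E F : RigidExt M C n} (g : E.E.X ⟶ F.E.X)
    (hg : g ≫ F.E.f = E.E.f)
    (hθ : ∀ y, F.iso.θ (hmap g (n + 1) y) = E.iso.θ y) : quasiIso k g := by
  rw [quasiIso_iff]
  intro i
  rcases lt_trichotomy i (n + 1) with hi | rfl | hi
  · have h₁ := F.E.quasiIsoAt i (by omega)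
    have h₂ : QuasiIsoAt (g.φ ≫ F.E.f.φ) i := by
      rw [← comp_φ, hg]
      exact E.E.quasiIsoAt i (by omega)
    exact quasiIsoAt_of_comp_right g.φ F.E.f.φ i
  · rw [quasiIsoAt_iff_bijective]
    refine (Function.Bijective.of_comp_iff' F.iso.θ.bijective _).1 ?_
    have e : F.iso.θ ∘ hmap g (n + 1) = E.iso.θ := funext hθ
    rw [e]
    exact E.iso.θ.bijective
  · have h₁ := E.E.eqPostnikov.subsingleton (i := i) (by push_cast; omega)
    have h₂ := F.E.eqPostnikov.subsingleton (i := i) (by push_cast; omega)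
    rw [quasiIsoAt_iff_bijective]
    exact ⟨Function.injective_of_subsingleton _, fun y => ⟨0, Subsingleton.elim _ _⟩⟩

/-- A morphism of extensions, from a map of dgas. -/
def RigidExt.homMk {E F : RigidExt M C n} (g : E.E.X ⟶ F.E.X) (hg : g ≫ F.E.f = E.E.f)
    (hθ : ∀ z : E.E.X.Z (n + 1), F.iso.θ (F.E.X.cls (n + 1) ⟨g.φ.f (n + 1) z, map_mem_Z g z.2⟩) =
      E.iso.θ (E.E.X.cls (n + 1) z)) : E ⟶ F :=
  have hθ' : ∀ y, F.iso.θ (hmap g (n + 1) y) = E.iso.θ y := fun y => by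
    obtain ⟨z, rfl⟩ := E.E.X.cls_surjective _ y
    rw [hmap_cls, hθ]
  RigidExt.Hom.mk (PostnikovExt.Hom.mk g (RigidExt.quasiIso_of_comm g hg hθ') hg) hθ'

set_option linter.unusedSectionVars false in
lemma IsBilin.comp {X Y : DGA k} {f : X ⟶ C} {β : X.Z (n + 1) →ₗ[k] M} (hβ : IsBilin hC f β)
    (g : Y ⟶ X) {β' : Y.Z (n + 1) →ₗ[k] M}
    (h : ∀ z : Y.Z (n + 1), β' z = β ⟨g.φ.f (n + 1) z, map_mem_Z g z.2⟩) :
    IsBilin hC (g ≫ f) β' := by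
  refine ⟨fun x z => ?_, fun x z => ?_⟩
  · rw [h, h]
    refine Eq.trans (congrArg β (Subtype.ext ?_)) (hβ.left ⟨_, map_mem_Z g x.2⟩ _)
    exact g.map_mul (zero_add _) x.1 z.1
  · rw [h, h]
    refine Eq.trans (congrArg β (Subtype.ext ?_)) (hβ.right ⟨_, map_mem_Z g x.2⟩ _)
    exact g.map_mul (add_zero _) z.1 x.1

/-- The pullback of a Postnikov extension along a quasi-isomorphism. -/
def PostnikovExt.pull (E : PostnikovExt C n) {Y : DGA k} (g : Y ⟶ E.X) (hg : quasiIso k g) :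
    PostnikovExt C n where
  X := Y
  f := g ≫ E.f
  eqPostnikov := eqPostnikov_of_subsingleton fun i hi =>
    (subsingleton_homology_congr ((quasiIso_iff g).1 hg i)).2 (E.eqPostnikov.subsingleton hi)
  quasiIsoAt i hi := by
    have h₁ := (quasiIso_iff g).1 hg i
    have h₂ := E.quasiIsoAt i hi
    exact inferInstanceAs (QuasiIsoAt (g.φ ≫ E.f.φ) i)

/-- The map of Postnikov extensions from the pullback. -/
def PostnikovExt.pullHom (E : PostnikovExt C n) {Y : DGA k} (g : Y ⟶ E.X) (hg : quasiIso k g) :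
    E.pull g hg ⟶ E :=
  PostnikovExt.Hom.mk g hg rfl

set_option linter.unusedSectionVars false in
-- A map of extensions is an isomorphism on `H_{n+1}` over `H_0(C)`, so an identification with `M`
-- on its target transfers to its source.
lemma RigidExt.exists_pull (hC : C.NonNeg) (F : RigidExt M C n) {E : PostnikovExt C n}
    (g : E ⟶ F.E) : ∃ iso : E.BimodIso M, ∀ z : E.X.Z (n + 1), iso.θ (E.X.cls (n + 1) z) =
      F.iso.θ (F.E.X.cls (n + 1) ⟨g.g.φ.f (n + 1) z, map_mem_Z g.g z.2⟩) := by
  let θ : E.X.cx.homology (n + 1) ≃ₗ[k] M := (LinearEquiv.ofBijective (hmap g.g (n + 1))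
    ((quasiIsoAt_iff_bijective g.g _).1 ((quasiIso_iff g.g).1 g.quasiIso _))).trans F.iso.θ
  have hθ (z : E.X.Z (n + 1)) : θ (E.X.cls (n + 1) z) =
      F.iso.θ (F.E.X.cls (n + 1) ⟨g.g.φ.f (n + 1) z, map_mem_Z g.g z.2⟩) :=
    congrArg F.iso.θ (hmap_cls g.g _ z)
  have hb : IsBilin hC E.f (θ.toLinearMap ∘ₗ E.X.cls (n + 1)) := by
    rw [← g.comm]
    exact (isBilin_of_bimodIso (hC := hC) F.iso).comp g.g hθ
  obtain ⟨iso, h⟩ := bimodIso_of_isBilin E θ _ hb fun _ => rfl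
  exact ⟨iso, fun z => (h z).trans (hθ z)⟩

/-- The map from `kill` to the square-zero extension that is given by the identification of
`H_{n+1}(X)` with `M`. -/
noncomputable def RigidExt.killHom (hC : C.NonNeg) (E : RigidExt M C n) :
    kill hC n E.E.f ⟶ sqZero M C hC (n + 2) :=
  DGA.killHom (E.E.f ≫ sqZeroIncl M C hC (n + 2)) rfl (E.iso.θ.toLinearMap ∘ₗ E.E.X.cls (n + 1))
    (isBilin_of_bimodIso E.iso) fun z c h => by
      have e : E.E.X.cls (n + 1) z = 0 := (E.E.X.cls_eq_zero_iff _ z).2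
        ⟨E.E.X.shift (n + 2) (n + 1 + 1) c, (E.E.X.d_shift (by omega) _ c).trans h⟩
      rw [LinearMap.comp_apply, e, map_zero]
      rfl

lemma RigidExt.killHom_proj (E : RigidExt M C n) :
    E.killHom hC ≫ sqZeroProj M C hC (n + 2) = killProj hC n E.E.f := rfl

lemma RigidExt.compM_killHom (E : RigidExt M C n) (u : (kill hC n E.E.f).cx.X (n + 2)) :
    compM (E.killHom hC) (n + 2) u = E.iso.θ (E.E.X.cls (n + 1) (killZ hC n E.E.f u)) :=
  (DGA.compM_killHom u).trans (zero_add _)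

variable (hC) (hH : ∀ i : ℤ, (n : ℤ) < i → Subsingleton (C.cx.homology i))

/-- The span that classifies an extension. -/
noncomputable def RigidExt.span (E : RigidExt M C n) : Span (overSqZero M C hC (n + 2)) where
  dom := kill hC n E.E.f
  q := killProj hC n E.E.f
  hq := killProj_quasiIso hC n E.E.f hH E.E.quasiIsoAt
  a := E.killHom hC
  comm := rfl

variable {hC}

lemma killZ_killMap {X Y : DGA k} {f : X ⟶ C} {f' : Y ⟶ C} (g : X ⟶ Y) (h : g ≫ f' = f)
    (u : (kill hC n f).cx.X (n + 2)) : killZ hC n f' ((killMap hC n g h).φ.f (n + 2) u) =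
      ⟨g.φ.f (n + 1) (killZ hC n f u), map_mem_Z g (killZ hC n f u).2⟩ :=
  Subtype.ext (map_shift g _ _ _).symm

/-- `kill` is functorial over `C`, and its classifying derivation depends only on `θ[y]`, which maps
of rigid extensions preserve. -/
lemma RigidExt.span_mkClass_eq {E F : RigidExt M C n} (g : E ⟶ F) :
    (E.span hC hH).mkClass = (F.span hC hH).mkClass := by
  have hg : g.g.g ≫ F.E.f = E.E.f := g.g.comm
  refine Span.mkClass_eq (s := E.span hC hH) (t := F.span hC hH) (killMap hC n g.g.g hg) ?_
  refine sqZero_hom_ext (a := killMap hC n g.g.g hg ≫ F.killHom hC) (b := E.killHom hC) rfl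
    fun u => ?_
  rw [compM_comp, RigidExt.compM_killHom, RigidExt.compM_killHom, killZ_killMap, ← g.comm, hmap_cls]

lemma ConnectedComponents.eq_of_hom {J : Type*} [Category* J] {T : Type*} (F : J → T)
    (hF : ∀ {i j : J}, (i ⟶ j) → F i = F j) {i j : J} (h : Zigzag i j) : F i = F j := by
  induction h with
  | refl => rfl
  | tail _ h ih =>
    rcases h with ⟨⟨g⟩⟩ | ⟨⟨g⟩⟩
    · exact ih.trans (hF g)
    · exact ih.trans (hF g).symm

variable (hC) in
/-- The class of spans that classifies a component of the category of extensions. -/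
noncomputable def extToSpan : ConnectedComponents (RigidExt M C n) →
    SpanClass (overSqZero M C hC (n + 2)) :=
  Quotient.lift (fun E => (E.span hC hH).mkClass) fun _ _ h =>
    ConnectedComponents.eq_of_hom _ (RigidExt.span_mkClass_eq hH) h

/-- The map underlying a span, as a map to the square-zero extension. -/
abbrev Span.toSqZero (s : Span (overSqZero M C hC (n + 2))) : s.dom ⟶ sqZero M C hC (n + 2) := s.a

/-- The extension that is classified by a span. -/
noncomputable def Span.ext (s : Span (overSqZero M C hC (n + 2))) : RigidExt M C n :=
  ⟨extPostnikov s.toSqZero hH s.hq, (exists_extPostnikov_bimodIso s.toSqZero hH s.hq s.comm).choose⟩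

lemma Span.ext_θ (s : Span (overSqZero M C hC (n + 2))) (z : (DGA.ext s.toSqZero).Z (n + 1))
    (c : s.dom.cx.X (n + 2))
    (hc : s.dom.cx.d (n + 2) (n + 1) c = (extProj s.toSqZero).φ.f (n + 1) z) :
    (s.ext hH).iso.θ ((DGA.ext s.toSqZero).cls (n + 1) z) = compM s.toSqZero (n + 2) c +
        (Prod.snd (α := s.dom.cx.X (n + 1)) (β := susp k M (n + 1) (n + 1)) z.1 : M) :=
  (exists_extPostnikov_bimodIso s.toSqZero hH s.hq s.comm).choose_spec z c hc

lemma Span.exists_d (hH : ∀ i : ℤ, (n : ℤ) < i → Subsingleton (C.cx.homology i))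
    (s : Span (overSqZero M C hC (n + 2))) (z : (DGA.ext s.toSqZero).Z (n + 1)) :
    ∃ c, s.dom.cx.d (n + 2) (n + 1) c = (extProj s.toSqZero).φ.f (n + 1) z :=
  exists_d_of_subsingleton (subsingleton_homology_of_quasiIso hH s.hq (by omega))
    ⟨_, map_mem_Z (extProj s.toSqZero) z.2⟩

/-- The functoriality of the extension that is classified by a span. -/
noncomputable def Span.extHom {s t : Span (overSqZero M C hC (n + 2))} (g : s.dom ⟶ t.dom)
    (hg : g ≫ t.a = s.a) : s.ext hH ⟶ t.ext hH :=
  RigidExt.homMk (E := s.ext hH) (F := t.ext hH)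
    (extMap (a := s.toSqZero) (a' := t.toSqZero) g hg)
    (by
      have e : g ≫ t.q = s.q := by rw [← t.comm, ← s.comm, ← Category.assoc, hg]
      change extMap (a := s.toSqZero) (a' := t.toSqZero) g hg ≫ extProj t.toSqZero ≫ t.q =
        extProj s.toSqZero ≫ s.q
      rw [← Category.assoc, extMap_proj, Category.assoc, e])
    (fun z => by
      obtain ⟨c, hc⟩ := s.exists_d hH z
      refine (t.ext_θ hH _ (g.φ.f _ c) ?_).trans (Eq.trans ?_ (s.ext_θ hH z c hc).symm)
      · exact (map_d g c).symm.trans (congrArg (g.φ.f (n + 1)) hc)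
      · exact congrArg (· + _) congr(compM $hg (n + 2) c))

/-- The component of the category of extensions that is classified by a class of spans. -/
noncomputable def spanToExt :
    SpanClass (overSqZero M C hC (n + 2)) → ConnectedComponents (RigidExt M C n) :=
  Quot.lift (fun s => Quotient.mk _ (s.ext hH)) fun _ _ ⟨g, hg⟩ =>
    Quotient.sound (Zigzag.of_hom (Span.extHom hH g hg))

set_option linter.unusedSectionVars false in
lemma RigidExt.subsingleton_homology_neg {E : RigidExt M C n} (hC : C.NonNeg) (i : ℤ) (hi : i < 0) :
    Subsingleton (E.E.X.cx.homology i) := by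
  rw [subsingleton_homology_congr (E.E.quasiIsoAt i (by omega)), subsingleton_homology_iff]
  intro x _
  have := hC i hi
  exact ⟨0, Subsingleton.elim _ _⟩

end Classification

/-! ### The extension classified by the span of an extension -/

section Classification

variable {M : Type u} [AddCommGroup M] [Module k M] {C : DGA k} {hC : C.NonNeg} [Module C.H0 M]
  [Module C.H0ᵐᵒᵖ M] [SMulCommClass C.H0 C.H0ᵐᵒᵖ M] [IsScalarTower k C.H0 M]
  [IsScalarTower k C.H0ᵐᵒᵖ M] {n : ℕ}

/-- The cell `σ z`, paired with a chain `c` bounding `f z`, bounds `z` in `kill`. Its `σ`-component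
is `z`, so the connecting map for the classifying derivation returns `θ[z]`. -/
lemma exists_kill_d {X : DGA k} {f : X ⟶ C} (h : Subsingleton (C.cx.homology (n + 1)))
    (z : X.cover.Z (n + 1)) : ∃ u : (kill hC n f).cx.X (n + 2),
      (kill hC n f).cx.d (n + 2) (n + 1) u = (killIncl hC n f).φ.f (n + 1) z ∧
      killZ hC n f u = ⟨X.coverIncl.φ.f (n + 1) z, map_mem_Z X.coverIncl z.2⟩ := by
  have hz : X.coverIncl.φ.f (n + 1) z ∈ X.Z (n + 1) := map_mem_Z X.coverIncl z.2
  obtain ⟨c, hc⟩ := exists_d_of_subsingleton h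
    ⟨f.φ.f (n + 1) (X.coverIncl.φ.f (n + 1) z), map_mem_Z f hz⟩
  refine ⟨⟨((0, X.shift (n + 1) (n + 2 - 1) (X.coverIncl.φ.f (n + 1) z)), c), zero_mem _,
    X.shift_mem_tr (by omega) (X.mem_tr_of_mem_Z le_rfl hz), C.mem_tr_of_lt (by omega) _⟩, ?_, ?_⟩
  · refine Subtype.ext (Prod.ext (Prod.ext ?_ ?_) hc)
    · change X.cx.d (n + 2) (n + 1) 0 + X.shift (n + 2 - 1) (n + 1) (X.shift (n + 1) (n + 2 - 1)
        (X.coverIncl.φ.f (n + 1) z)) = X.coverIncl.φ.f (n + 1) z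
      rw [map_zero, zero_add, X.shift_shift (by omega)]
    · change -X.cx.d (n + 2 - 1) (n + 1 - 1) (X.shift (n + 1) (n + 2 - 1)
        (X.coverIncl.φ.f (n + 1) z)) = 0
      rw [X.d_shift (by omega), neg_eq_zero]
      exact hz
  · exact Subtype.ext (X.shift_shift (by omega) _)

lemma RigidExt.killIncl_killHom (E : RigidExt M C n) :
    killIncl hC n E.E.f ≫ E.killHom hC =
      E.E.X.coverIncl ≫ E.E.f ≫ sqZeroIncl M C hC (n + 2) :=
  DGA.killIncl_killHom (a := E.E.f ≫ sqZeroIncl M C hC (n + 2)) (ha := rfl)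

/-- The connective cover of `E` maps to `E` and also to the extension built from `kill`: the
classifying derivation vanishes on the cover, so the inclusion into `kill` lifts. `exists_kill_d`
shows that the lift respects the identifications with `M`. -/
lemma spanToExt_extToSpan (hH : ∀ i : ℤ, (n : ℤ) < i → Subsingleton (C.cx.homology i))
    (x : ConnectedComponents (RigidExt M C n)) :
    spanToExt hH (extToSpan hC hH x) = x := by
  obtain ⟨E, rfl⟩ := Quotient.exists_rep x
  have hg := E.E.X.coverIncl_quasiIso (RigidExt.subsingleton_homology_neg hC)
  obtain ⟨iso, hiso⟩ := E.exists_pull hC (E.E.pullHom E.E.X.coverIncl hg)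
  let F : RigidExt M C n := ⟨E.E.pull E.E.X.coverIncl hg, iso⟩
  let s := E.span hC hH
  have hs (i : ℤ) (x : E.E.X.cover.cx.X i) :
      compM (killIncl hC n E.E.f ≫ E.killHom hC) i x = 0 :=
    congr(compM $(E.killIncl_killHom (hC := hC)) i x)
  have g₁ : F ⟶ E := RigidExt.homMk (E := F) (F := E) E.E.X.coverIncl rfl fun z => (hiso z).symm
  have g₂ : F ⟶ s.ext hH := RigidExt.homMk (E := F) (F := s.ext hH)
    (extLift s.toSqZero (killIncl hC n E.E.f) hs) rfl fun z => by
      obtain ⟨u, hu, hu'⟩ := exists_kill_d (hC := hC) (f := E.E.f) (hH (n + 1) (by omega)) z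
      refine (s.ext_θ hH ⟨_, map_mem_Z (extLift s.toSqZero (killIncl hC n E.E.f) hs) z.2⟩ u
        hu).trans ((add_zero _).trans ((E.compM_killHom u).trans ?_))
      rw [hu']
      exact (hiso z).symm
  exact Quotient.sound ((Zigzag.of_inv g₂).trans (Zigzag.of_hom g₁))

/-- The map from `C` to `kill` for a dga that receives a section from `C`. -/
noncomputable def killSection {D : DGA k} (r : D ⟶ C) (j : C ⟶ D) : C ⟶ kill hC n r :=
  (D.coverSub.lift j fun _ x => map_mem_tr j (hC.mem_tr x) : C ⟶ D.cover) ≫ killIncl hC n r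

lemma killSection_proj {D : DGA k} {r : D ⟶ C} {j : C ⟶ D} (h : j ≫ r = 𝟙 C) :
    killSection (hC := hC) (n := n) r j ≫ killProj hC n r = 𝟙 C := h

lemma killSection_comp {D Z : DGA k} {r : D ⟶ C} (j : C ⟶ D) {B : kill hC n r ⟶ Z} {b : D ⟶ Z}
    (h : killIncl hC n r ≫ B = D.coverIncl ≫ b) : killSection r j ≫ B = j ≫ b :=
  congrArg ((D.coverSub.lift j fun _ x => map_mem_tr j (hC.mem_tr x) : C ⟶ D.cover) ≫ ·) h

end Classification

/-! ### Differences of maps in the homotopy category -/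

section Difference

lemma Span.toHo_map {C : DGA k} {Z Z' : Over C} (w : Z ⟶ Z') (s : Span Z) :
    (s.map w).toHo = s.toHo ≫ (overQuasiIso C).Q.map w :=
  SpanClass.toHo_map w s.mkClass

/-- Maps that agree after precomposition with a quasi-isomorphism become equal in the localization.
-/
lemma Span.toHo_map_eq {C : DGA k} {Y Z Z' : Over C} {w w' : Z ⟶ Z'} (σ : Y ⟶ Z)
    (hσ : overQuasiIso C σ) (h : σ ≫ w = σ ≫ w') (s : Span Z) :
    (s.map w).toHo = (s.map w').toHo := by
  have : IsIso ((overQuasiIso C).Q.map σ) := Localization.inverts _ (overQuasiIso C) σ hσ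
  rw [Span.toHo_map, Span.toHo_map]
  congr 1
  rw [← cancel_epi ((overQuasiIso C).Q.map σ), ← Functor.map_comp, ← Functor.map_comp, h]

variable {M : Type u} [AddCommGroup M] [Module k M] {C : DGA k} {hC : C.NonNeg} [Module C.H0 M]
  [Module C.H0ᵐᵒᵖ M] [SMulCommClass C.H0 C.H0ᵐᵒᵖ M] [IsScalarTower k C.H0 M]
  [IsScalarTower k C.H0ᵐᵒᵖ M] {p : ℤ}

lemma subHom_proj (hp : p ≠ 0) {Y : DGA k} (a b : Y ⟶ sqZero M C hC p)
    (h : a ≫ sqZeroProj M C hC p = b ≫ sqZeroProj M C hC p) :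
    subHom hp a b h ≫ sqZeroProj M C hC p = a ≫ sqZeroProj M C hC p := derHom_proj ..

lemma compM_subHom (hp : p ≠ 0) {Y : DGA k} (a b : Y ⟶ sqZero M C hC p)
    (h : a ≫ sqZeroProj M C hC p = b ≫ sqZeroProj M C hC p) (x : Y.cx.X p) :
    compM (subHom hp a b h) p x = compM a p x - compM b p x := compM_derHom ..

lemma comp_subHom (hp : p ≠ 0) {X Y : DGA k} (a b : Y ⟶ sqZero M C hC p)
    (h : a ≫ sqZeroProj M C hC p = b ≫ sqZeroProj M C hC p) (g : X ⟶ Y)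
    {a' b' : X ⟶ sqZero M C hC p} (ha : g ≫ a = a') (hb : g ≫ b = b')
    (h' : a' ≫ sqZeroProj M C hC p = b' ≫ sqZeroProj M C hC p) :
    g ≫ subHom hp a b h = subHom hp a' b' h' := by
  subst ha hb
  refine sqZero_hom_ext ?_ fun x => ?_
  · rw [Category.assoc, subHom_proj, subHom_proj, Category.assoc]
  · rw [compM_comp, compM_subHom, compM_subHom, compM_comp, compM_comp]

lemma subHom_incl (hp : p ≠ 0) {Y : DGA k} (a : Y ⟶ sqZero M C hC p) (f : Y ⟶ C)
    (h : a ≫ sqZeroProj M C hC p = (f ≫ sqZeroIncl M C hC p) ≫ sqZeroProj M C hC p) :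
    subHom hp a (f ≫ sqZeroIncl M C hC p) h = a := by
  refine sqZero_hom_ext (subHom_proj ..) fun x => ?_
  rw [compM_subHom, compM_incl, sub_zero]

/-- Subtracting a map that factors through a dga equivalent to `C`, on which it is the inclusion,
does not change the morphism in the homotopy category. -/
lemma toHo_subHom (hp : p ≠ 0) {W : DGA k} (b : W ⟶ sqZero M C hC p)
    (hW : IsTrivFib (b ≫ sqZeroProj M C hC p)) (κ : C ⟶ W) (hκ : κ ≫ b = sqZeroIncl M C hC p)
    (s : Span (overSqZero M C hC p)) (v : s.dom ⟶ W)
    (h : s.a ≫ sqZeroProj M C hC p = (v ≫ b) ≫ sqZeroProj M C hC p)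
    (t : Span (overSqZero M C hC p)) (g : t.dom ⟶ s.dom)
    (ht : g ≫ subHom hp s.a (v ≫ b) h = t.a) : t.toHo = s.toHo := by
  let pr := sqZeroProj M C hC p
  -- The universal case lives on the pullback of `C ∨ Σ^p M` and `W` over `C`, where both the map
  -- and the map to be subtracted are projections followed by fixed maps.
  let b₀ := pbFst pr (b ≫ pr)
  let b₁ := pbSnd pr (b ≫ pr)
  have hB : b₀ ≫ pr = (b₁ ≫ b) ≫ pr := (pb_condition pr (b ≫ pr)).trans (Category.assoc ..).symm
  let m₁ : Over.mk (b₀ ≫ pr) ⟶ overSqZero M C hC p := Over.homMk b₀ rfl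
  let m₂ : Over.mk (b₀ ≫ pr) ⟶ overSqZero M C hC p :=
    Over.homMk (subHom hp b₀ (b₁ ≫ b) hB) (subHom_proj ..)
  have hσ₀ : 𝟙 _ ≫ pr = (pr ≫ κ) ≫ b ≫ pr := by
    rw [Category.id_comp, Category.assoc, ← Category.assoc κ, hκ]
    exact (Category.comp_id _).symm
  -- A section of the trivial fibration `b₀`, hence a quasi-isomorphism. Along it the subtracted
  -- derivation is zero, so `m₁` and `m₂` agree there.
  let σ' := pbLift (𝟙 _) (pr ≫ κ) hσ₀
  have hσ₁ : σ' ≫ b₀ = 𝟙 _ := pbLift_fst _ _ _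
  have hσ₂ : σ' ≫ b₁ = pr ≫ κ := pbLift_snd _ _ _
  let σ : overSqZero M C hC p ⟶ Over.mk (b₀ ≫ pr) := Over.homMk σ' (by
    change σ' ≫ b₀ ≫ pr = pr
    rw [← Category.assoc, hσ₁, Category.id_comp])
  have hσ : overQuasiIso C σ := by
    refine quasiIso_of_comp_right (f := σ') (g := b₀) (hW.pbFst pr).quasiIso ?_
    rw [hσ₁]
    exact quasiIso_id _
  have hm : σ ≫ m₂ = σ ≫ m₁ := by
    refine Over.OverMorphism.ext ?_
    change σ' ≫ subHom hp b₀ (b₁ ≫ b) hB = σ' ≫ b₀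
    exact (comp_subHom hp b₀ (b₁ ≫ b) hB σ' hσ₁ (b' := pr ≫ sqZeroIncl M C hC p)
      (by rw [← Category.assoc, hσ₂, Category.assoc, hκ]) rfl).trans
        ((subHom_incl ..).trans hσ₁.symm)
  have hl := h.trans (Category.assoc ..)
  let s' : Span (Over.mk (b₀ ≫ pr)) := ⟨s.dom, s.q, s.hq, pbLift s.a v hl, by
    change pbLift s.a v hl ≫ b₀ ≫ pr = s.q
    rw [← Category.assoc, show pbLift s.a v hl ≫ b₀ = s.a from pbLift_fst _ _ _]
    exact s.comm⟩
  have h₁ : (s'.map m₁).Rel s := ⟨𝟙 _, (Category.id_comp _).trans (pbLift_fst s.a v hl).symm⟩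
  have h₂ : t.Rel (s'.map m₂) := ⟨g, by
    change g ≫ pbLift s.a v hl ≫ subHom hp b₀ (b₁ ≫ b) hB = t.a
    rw [comp_subHom hp b₀ (b₁ ≫ b) hB (pbLift s.a v hl) (pbLift_fst _ _ _)
      (b' := v ≫ b) (by rw [← Category.assoc, show pbLift s.a v hl ≫ b₁ = v from pbLift_snd _ _ _])
      h, ht]⟩
  exact (Span.toHo_eq_of_rel h₂).trans ((Span.toHo_map_eq σ hσ hm s').trans
    (Span.toHo_eq_of_rel h₁))

end Difference

/-! ### The class of a homotopy fiber -/

section Fiber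

variable {M : Type u} [AddCommGroup M] [Module k M] {C : DGA k} {hC : C.NonNeg} [Module C.H0 M]
  [Module C.H0ᵐᵒᵖ M] [SMulCommClass C.H0 C.H0ᵐᵒᵖ M] [IsScalarTower k C.H0 M]
  [IsScalarTower k C.H0ᵐᵒᵖ M] {n : ℕ}

lemma coverIncl_quasiIso_of_quasiIso (hC : C.NonNeg) {Y : DGA k} {q : Y ⟶ C} (hq : quasiIso k q) :
    quasiIso k Y.coverIncl :=
  Y.coverIncl_quasiIso fun i hi => by
    rw [subsingleton_homology_congr ((quasiIso_iff q).1 hq i), subsingleton_homology_iff]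
    intro x _
    have := hC i hi
    exact ⟨0, Subsingleton.elim _ _⟩

/-- The span given by a map from `kill` that extends a given span. -/
noncomputable def Span.kill (hH : ∀ i : ℤ, (n : ℤ) < i → Subsingleton (C.cx.homology i))
    (s : Span (overSqZero M C hC (n + 2)))
    (A : DGA.kill hC n s.q ⟶ sqZero M C hC (n + 2))
    (hA : A ≫ sqZeroProj M C hC (n + 2) = killProj hC n s.q) :
    Span (overSqZero M C hC (n + 2)) where
  dom := DGA.kill hC n s.q
  q := killProj hC n s.q
  hq := killProj_quasiIso hC n s.q hH fun i _ => (quasiIso_iff s.q).1 s.hq i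
  a := A
  comm := hA

/-- Both spans restrict to the same span on the connective cover. -/
lemma Span.kill_toHo (hH : ∀ i : ℤ, (n : ℤ) < i → Subsingleton (C.cx.homology i))
    (s : Span (overSqZero M C hC (n + 2)))
    (A : DGA.kill hC n s.q ⟶ sqZero M C hC (n + 2))
    (hA : A ≫ sqZeroProj M C hC (n + 2) = killProj hC n s.q)
    (h : killIncl hC n s.q ≫ A = s.dom.coverIncl ≫ s.a) :
    (s.kill hH A hA).toHo = s.toHo := by
  let t : Span (overSqZero M C hC (n + 2)) := ⟨s.dom.cover, s.dom.coverIncl ≫ s.q,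
    quasiIso_comp (coverIncl_quasiIso_of_quasiIso hC s.hq) s.hq, s.dom.coverIncl ≫ s.a,
    (Category.assoc ..).trans (congrArg _ s.comm)⟩
  have h₁ : t.Rel s := ⟨s.dom.coverIncl, rfl⟩
  have h₂ : t.Rel (s.kill hH A hA) := ⟨killIncl hC n s.q, h⟩
  exact (Span.toHo_eq_of_rel h₂).symm.trans (Span.toHo_eq_of_rel h₁)

/-- The map from `kill` given by a map on a dga with the homology of `C`. -/
lemma exists_killHom (hH : ∀ i : ℤ, (n : ℤ) < i → Subsingleton (C.cx.homology i)) {Y : DGA k}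
    {q : Y ⟶ C} (hq : quasiIso k q) (a : Y ⟶ sqZero M C hC (n + 2))
    (ha : a ≫ sqZeroProj M C hC (n + 2) = q) :
    ∃ A : kill hC n q ⟶ sqZero M C hC (n + 2),
      A ≫ sqZeroProj M C hC (n + 2) = killProj hC n q ∧
      killIncl hC n q ≫ A = Y.coverIncl ≫ a ∧
      ∀ (u : (kill hC n q).cx.X (n + 2)) (c : Y.cx.X (n + 2)),
        Y.cx.d (n + 2) (n + 1) c = killZ hC n q u →
        compM A (n + 2) u = compM a (n + 2) (killX hC n q (n + 2) u) + compM a (n + 2) c := by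
  have h₁ : Subsingleton (Y.cx.homology (n + 1)) :=
    subsingleton_homology_of_quasiIso hH hq (by omega)
  obtain ⟨α, hα⟩ := exists_connecting a h₁ (subsingleton_homology_of_quasiIso hH hq (by omega))
  exact ⟨killHom a ha α (isBilin_of_connecting ha h₁ hα) hα, killHom_proj, killIncl_killHom,
    fun u c hc => (compM_killHom u).trans (congrArg _ (hα _ c hc))⟩

/-- The core comparison. The maps `a` and `p` extend over `kill` to `A` and `B`, and the classifying
derivation of `E` is their difference: on `x` they cancel because the square commutes, and on `σ y`
the difference is `a c - p e = θ[y]`. Since `D` is equivalent to `C` and `p` restricts to the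
inclusion, `B` is homotopically trivial. A commuting square with the formula for `θ` suffices as
input, so the lemma applies directly both to homotopy pullbacks and to `Span.ext`. -/
lemma RigidExt.span_toHo (hH : ∀ i : ℤ, (n : ℤ) < i → Subsingleton (C.cx.homology i))
    (E : RigidExt M C n) (s : Span (overSqZero M C hC (n + 2))) {D : DGA k} {j : C ⟶ D}
    {p : D ⟶ sqZero M C hC (n + 2)} {u : E.E.X ⟶ s.dom} {v : E.E.X ⟶ D} (hj : quasiIso k j)
    (hjp : j ≫ p = sqZeroIncl M C hC (n + 2)) (huv : u ≫ s.a = v ≫ p) (huq : u ≫ s.q = E.E.f)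
    (hθ : ∀ (x : E.E.X.Z (n + 1)) (c : s.dom.cx.X (n + 2)) (e : D.cx.X (n + 2)),
      s.dom.cx.d (n + 2) (n + 1) c = u.φ.f (n + 1) x →
      D.cx.d (n + 2) (n + 1) e = v.φ.f (n + 1) x →
      E.iso.θ (E.E.X.cls (n + 1) x) =
        compM (Y := s.dom) s.a (n + 2) c - compM p (n + 2) e) :
    (E.span hC hH).toHo = s.toHo := by
  let pr := sqZeroProj M C hC (n + 2)
  have hsa : s.a ≫ pr = s.q := s.comm
  let r := p ≫ pr
  have hjr : j ≫ r = 𝟙 C := by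
    change j ≫ p ≫ pr = 𝟙 C
    rw [← Category.assoc, hjp]
    rfl
  have hr : quasiIso k r := quasiIso_of_comp_left (f := j) hj (by rw [hjr]; exact quasiIso_id C)
  have hvr : v ≫ r = E.E.f := by
    change v ≫ p ≫ pr = E.E.f
    rw [← Category.assoc, ← huv, Category.assoc, hsa, huq]
  obtain ⟨A, hA₁, hA₂, hA₃⟩ := exists_killHom hH s.hq (s.toSqZero) hsa
  obtain ⟨B, hB₁, hB₂, hB₃⟩ := exists_killHom hH hr p rfl
  -- Surjectivity comes from the section of `kill hC n r ⟶ C` induced by `j`.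
  have hW : IsTrivFib (B ≫ pr) := by
    rw [hB₁]
    exact isTrivFib_of_quasiIso (fun i c => ⟨(killSection r j).φ.f i c,
      congr(($(killSection_proj (hC := hC) (n := n) hjr)).φ.f i c)⟩)
      (killProj_quasiIso hC n r hH fun i _ => (quasiIso_iff r).1 hr i)
  have hκ : killSection r j ≫ B = sqZeroIncl M C hC (n + 2) :=
    (killSection_comp j hB₂).trans hjp
  let U := killMap hC n u huq
  let V := killMap hC n v hvr
  let t : Span (overSqZero M C hC (n + 2)) := ⟨kill hC n E.E.f, killProj hC n E.E.f,
    (E.span hC hH).hq, U ≫ A, by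
      change (U ≫ A) ≫ pr = _
      rw [Category.assoc, hA₁, killMap_proj]⟩
  have hUV : (U ≫ A) ≫ pr = (V ≫ B) ≫ pr := by
    rw [Category.assoc, Category.assoc, hA₁, hB₁, killMap_proj, killMap_proj]
  -- In degree `n + 2` the contributions of `x` are equal by `huv`; those of `y` give the formula
  -- for `θ`.
  have key : 𝟙 _ ≫ subHom (by omega) (U ≫ A) (V ≫ B) hUV = E.killHom hC := by
    rw [Category.id_comp]
    refine sqZero_hom_ext ?_ fun w => ?_
    · rw [subHom_proj, RigidExt.killHom_proj, Category.assoc, hA₁, killMap_proj]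
    · obtain ⟨c, hc⟩ := exists_d_of_subsingleton
        (subsingleton_homology_of_quasiIso hH s.hq (by omega))
        ⟨u.φ.f (n + 1) (killZ hC n E.E.f w), map_mem_Z u (killZ hC n E.E.f w).2⟩
      obtain ⟨e, he⟩ := exists_d_of_subsingleton
        (subsingleton_homology_of_quasiIso hH hr (by omega))
        ⟨v.φ.f (n + 1) (killZ hC n E.E.f w), map_mem_Z v (killZ hC n E.E.f w).2⟩
      have hx : compM s.toSqZero (n + 2) (killX hC n s.q (n + 2) (U.φ.f (n + 2) w)) =
          compM p (n + 2) (killX hC n r (n + 2) (V.φ.f (n + 2) w)) :=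
        congr(compM $huv (n + 2) (killX hC n E.E.f (n + 2) w))
      rw [compM_subHom, compM_comp, compM_comp, RigidExt.compM_killHom, hθ _ c e hc he,
        hA₃ (U.φ.f (n + 2) w) c (hc.trans congr(($(killZ_killMap u huq w)).1).symm),
        hB₃ (V.φ.f (n + 2) w) e (he.trans congr(($(killZ_killMap v hvr w)).1).symm), hx,
        add_sub_add_left_eq_sub]
  have h₁ := toHo_subHom (by omega) B hW (killSection r j) hκ t V hUV (E.span hC hH) (𝟙 _) key
  have h₂ : t.Rel (s.kill hH A hA₁) := ⟨U, rfl⟩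
  exact h₁.trans ((Span.toHo_eq_of_rel h₂).trans (s.kill_toHo hH A hA₁ hA₂))

end Fiber

/-! ### The classification of extensions -/

section Main

variable {M : Type u} [AddCommGroup M] [Module k M] {C : DGA k} {hC : C.NonNeg} [Module C.H0 M]
  [Module C.H0ᵐᵒᵖ M] [SMulCommClass C.H0 C.H0ᵐᵒᵖ M] [IsScalarTower k C.H0 M]
  [IsScalarTower k C.H0ᵐᵒᵖ M] {n : ℕ}

/-- The extension of `s` maps to the universal one, `ext (𝟙 _)`, which is equivalent to `C`. The
resulting square commutes by construction. -/
lemma Span.ext_span_toHo (hH : ∀ i : ℤ, (n : ℤ) < i → Subsingleton (C.cx.homology i))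
    (s : Span (overSqZero M C hC (n + 2))) : ((s.ext hH).span hC hH).toHo = s.toHo := by
  let j : C ⟶ DGA.ext (𝟙 (sqZero M C hC (n + 2))) :=
    extLift _ (sqZeroIncl M C hC (n + 2)) fun _ _ => rfl
  have hj : quasiIso k j :=
    quasiIso_of_comp_right (f := j) ext_id_isTrivFib.quasiIso (quasiIso_id C)
  refine (s.ext hH).span_toHo hH s (j := j) (p := extProj _) (u := extProj s.toSqZero)
    (v := extMap (a := s.toSqZero) s.toSqZero (Category.comp_id _)) hj rfl rfl rfl ?_
  intro x c e hc he
  refine (s.ext_θ hH x c hc).trans ?_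
  rw [sub_eq_add_neg]
  congr 1
  -- The differential of `ext (𝟙 _)` sends `e` to minus the `M`-component of `p e` in the summand
  -- `Σ^{n+1} M`; this turns the `+ m` of `Span.ext_θ` into the `- p e` required.
  exact congr((Prod.snd (α := (sqZero M C hC (n + 2)).cx.X (n + 1))
    (β := susp k M (n + 1) (n + 1)) $he : M)).symm.trans
      (coe_extD (𝟙 (sqZero M C hC (n + 2))) (by omega) _)

variable (hC) in
-- One composite is settled on components of extensions; the other is compared in the homotopy
-- category, where distinct classes of spans remain distinct.
lemma extToSpan_bijective (hH : ∀ i : ℤ, (n : ℤ) < i → Subsingleton (C.cx.homology i)) :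
    Function.Bijective (extToSpan (M := M) hC hH) := by
  refine Function.bijective_iff_has_inverse.2 ⟨spanToExt hH, spanToExt_extToSpan hH, fun x => ?_⟩
  obtain ⟨s, rfl⟩ := Quot.exists_rep x
  exact (SpanClass.toHo_bijective (Z := overSqZero M C hC (n + 2))
    fun i c => ⟨((c, 0) : C.cx.X i × susp k M (n + 2) i), rfl⟩).1 (s.ext_span_toHo hH)

variable (hC) in
/-- The bijection between the components of the category of extensions with an identification of
`H_{n+1}` and the homotopy classes of maps to the square-zero extension. -/
noncomputable def rigidEquiv (hH : ∀ i : ℤ, (n : ℤ) < i → Subsingleton (C.cx.homology i)) :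
    ConnectedComponents (RigidExt M C n) ≃ HoClasses M C hC (n + 2) :=
  Equiv.ofBijective (fun x => (extToSpan hC hH x).toHo)
    ((SpanClass.toHo_bijective (Z := overSqZero M C hC (n + 2))
      fun i c => ⟨((c, 0) : C.cx.X i × susp k M (n + 2) i), rfl⟩).comp
        (extToSpan_bijective hC hH))

lemma rigidEquiv_eq_of_hom (hH : ∀ i : ℤ, (n : ℤ) < i → Subsingleton (C.cx.homology i))
    {E F : RigidExt M C n} (g : E ⟶ F) :
    rigidEquiv hC hH (Quotient.mk _ E) = rigidEquiv hC hH (Quotient.mk _ F) :=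
  congrArg (rigidEquiv hC hH) (Quotient.sound (Zigzag.of_hom g))

lemma rigidEquiv_of_isHomotopyFiber
    (hH : ∀ i : ℤ, (n : ℤ) < i → Subsingleton (C.cx.homology i)) (E : RigidExt M C n)
    {C' : DGA k} (q : C' ⟶ C) (hq : quasiIso k q) (a : C' ⟶ sqZero M C hC (n + 2))
    (ha : a ≫ sqZeroProj M C hC (n + 2) = q) (h : IsHomotopyFiber hC E q a) :
    rigidEquiv hC hH (Quotient.mk _ E) = homotopyClass C hC q hq a ha := by
  obtain ⟨D, j, p, u, v, hj, hjp, -, hP, huq, hθ⟩ := h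
  exact E.span_toHo hH ⟨C', q, hq, a, ha⟩ hj hjp hP.w huq hθ

/-! ### The action of the automorphisms of `M` -/

/-- The change of the identification of `H_{n+1}` by an automorphism. -/
noncomputable def RigidExt.twist (E : RigidExt M C n) (e : bimodAut M C) : RigidExt M C n where
  E := E.E
  iso :=
    { θ := E.iso.θ.trans e.1
      map_left := fun a y => (congrArg e.1 (E.iso.map_left a y)).trans (e.2.1 _ _)
      map_right := fun a y => (congrArg e.1 (E.iso.map_right a y)).trans (e.2.2 _ _) }

lemma RigidExt.killHom_twist (E : RigidExt M C n) (e : bimodAut M C) :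
    (E.twist e).killHom hC = E.killHom hC ≫ sqZeroMap C hC (n + 2) e := by
  refine sqZero_hom_ext rfl fun x => ?_
  exact (RigidExt.compM_killHom (E.twist e) x).trans
    (congrArg e.1 (E.compM_killHom (hC := hC) x)).symm

/-- The twist leaves `kill` unchanged and composes its derivation with `e`. -/
lemma rigidEquiv_twist (hH : ∀ i : ℤ, (n : ℤ) < i → Subsingleton (C.cx.homology i))
    (E : RigidExt M C n) (e : bimodAut M C) :
    rigidEquiv hC hH (Quotient.mk _ (E.twist e)) = e • rigidEquiv hC hH (Quotient.mk _ E) := by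
  have h : ((E.twist e).span hC hH).Rel ((E.span hC hH).map (overSqZeroMap C hC (n + 2) e)) :=
    ⟨𝟙 _, (Category.id_comp _).trans (E.killHom_twist e).symm⟩
  exact (Span.toHo_eq_of_rel h).trans (Span.toHo_map _ _)

set_option linter.unusedSectionVars false in
-- The identifications are linear over `H_0(X)`; since `0 ≤ n`, the map `H_0(f)` is onto, so their
-- difference is linear over `H_0(C)`.
lemma PostnikovExt.BimodIso.exists_aut {E : PostnikovExt C n} (i i' : E.BimodIso M) :
    ∃ e : bimodAut M C, ∀ y, i'.θ y = e.1 (i.θ y) := by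
  have he (y) : (i.θ.symm.trans i'.θ) (i.θ y) = i'.θ y := congrArg i'.θ (i.θ.symm_apply_apply y)
  have hsurj : Function.Surjective (h0map E.f) :=
    ((quasiIsoAt_iff_bijective E.f 0).1 (E.quasiIsoAt 0 (by omega))).2
  refine ⟨⟨i.θ.symm.trans i'.θ, fun a m => ?_, fun a m => ?_⟩, fun y => (he y).symm⟩
  · obtain ⟨b, rfl⟩ := hsurj a
    obtain ⟨y, rfl⟩ := i.θ.surjective m
    rw [← i.map_left, he, he, i'.map_left]
  · obtain ⟨b, rfl⟩ := hsurj a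
    obtain ⟨y, rfl⟩ := i.θ.surjective m
    rw [← i.map_right, he, he, i'.map_right]

/-- The identification of `E` and the one pulled back from `F` along `g` differ by an automorphism.
-/
lemma RigidExt.exists_twist_hom (hC : C.NonNeg) {E F : RigidExt M C n} (g : E.E ⟶ F.E) :
    ∃ e : bimodAut M C, Nonempty (E.twist e ⟶ F) := by
  obtain ⟨iso, h⟩ := F.exists_pull hC g
  obtain ⟨e, he⟩ := E.iso.exists_aut iso
  exact ⟨e, ⟨RigidExt.homMk (E := E.twist e) g.g g.comm fun z => (h z).symm.trans (he _)⟩⟩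

lemma orbit_eq_of_hom (hH : ∀ i : ℤ, (n : ℤ) < i → Subsingleton (C.cx.homology i))
    {E F : RigidExt M C n} (g : E.E ⟶ F.E) :
    (Quotient.mk _ (rigidEquiv hC hH (Quotient.mk _ E)) :
        MulAction.orbitRel.Quotient (bimodAut M C) (HoClasses M C hC (n + 2))) =
      Quotient.mk _ (rigidEquiv hC hH (Quotient.mk _ F)) := by
  obtain ⟨e, ⟨g'⟩⟩ := RigidExt.exists_twist_hom hC g
  rw [← rigidEquiv_eq_of_hom hH g', rigidEquiv_twist]
  exact (Quotient.sound (s := MulAction.orbitRel _ _) (MulAction.orbitRel_apply.2 ⟨e, rfl⟩)).symm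

variable (hC) in
/-- The orbit of homotopy classes of maps that classifies an extension. -/
noncomputable def orbitClass (hH : ∀ i : ℤ, (n : ℤ) < i → Subsingleton (C.cx.homology i))
    (X : UnrigidExt M C n) :
    MulAction.orbitRel.Quotient (bimodAut M C) (HoClasses M C hC (n + 2)) :=
  Quotient.mk _ (rigidEquiv hC hH (Quotient.mk _ ⟨X.obj, X.property.some⟩))

lemma orbitClass_eq_of_hom (hH : ∀ i : ℤ, (n : ℤ) < i → Subsingleton (C.cx.homology i))
    {X Y : UnrigidExt M C n} (g : X ⟶ Y) : orbitClass hC hH X = orbitClass hC hH Y :=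
  orbit_eq_of_hom (E := ⟨X.obj, X.property.some⟩) (F := ⟨Y.obj, Y.property.some⟩) hH g.hom

variable (hC) in
/-- The orbit of homotopy classes of maps that classifies a component of the category of
extensions. -/
noncomputable def unrigidClass (hH : ∀ i : ℤ, (n : ℤ) < i → Subsingleton (C.cx.homology i)) :
    ConnectedComponents (UnrigidExt M C n) →
      MulAction.orbitRel.Quotient (bimodAut M C) (HoClasses M C hC (n + 2)) :=
  Quotient.lift (orbitClass hC hH) fun _ _ h =>
    ConnectedComponents.eq_of_hom _ (orbitClass_eq_of_hom hH) h

/-- The identification chosen in `orbitClass` is immaterial: the identity of `E.E` joins it to the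
given one. -/
lemma unrigidClass_forget (hH : ∀ i : ℤ, (n : ℤ) < i → Subsingleton (C.cx.homology i))
    (E : RigidExt M C n) : unrigidClass hC hH (Quotient.mk _ E.forget) =
      Quotient.mk _ (rigidEquiv hC hH (Quotient.mk _ E)) :=
  orbit_eq_of_hom (E := ⟨E.E, (E.forget).property.some⟩) (F := E) hH (𝟙 E.E)

/-- The functor that forgets the identification of `H_{n+1}`. -/
def forgetIso : RigidExt M C n ⥤ UnrigidExt M C n where
  obj := RigidExt.forget
  map g := ⟨g.g⟩

/-- If two extensions have classes in one orbit, a twist of one has the same class as the other. The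
first bijection then yields a zigzag of rigid extensions; forgetting the identifications removes the
twist. Surjectivity is inherited from `rigidEquiv`. -/
lemma unrigidClass_bijective (hH : ∀ i : ℤ, (n : ℤ) < i → Subsingleton (C.cx.homology i)) :
    Function.Bijective (unrigidClass (M := M) hC hH) := by
  refine ⟨fun x y h => ?_, fun t => ?_⟩
  · obtain ⟨X, rfl⟩ := Quotient.exists_rep x
    obtain ⟨Y, rfl⟩ := Quotient.exists_rep y
    let E : RigidExt M C n := ⟨X.obj, X.property.some⟩
    let F : RigidExt M C n := ⟨Y.obj, Y.property.some⟩
    obtain ⟨e, he⟩ := Quotient.exact h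
    have he' : rigidEquiv hC hH (Quotient.mk _ (F.twist e)) =
        rigidEquiv hC hH (Quotient.mk _ E) := (rigidEquiv_twist hH F e).trans he
    have hz : Zigzag (F.twist e) E := Quotient.exact ((rigidEquiv hC hH).injective he')
    exact (Quotient.sound (zigzag_obj_of_zigzag forgetIso hz)).symm
  · obtain ⟨t, rfl⟩ := Quotient.exists_rep t
    obtain ⟨x, rfl⟩ := (rigidEquiv hC hH).surjective t
    obtain ⟨E, rfl⟩ := Quotient.exists_rep x
    exact ⟨_, unrigidClass_forget hH E⟩

end Main

end DGA

theorem mainTheorem7 {k : Type u} [CommRing k] (C : DGA k) (hC : C.NonNeg) (n : ℕ)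
    (hn : C.EqPostnikov n)
    (M : Type u) [AddCommGroup M] [Module k M] [Module C.H0 M] [Module C.H0ᵐᵒᵖ M]
    [SMulCommClass C.H0 C.H0ᵐᵒᵖ M] [IsScalarTower k C.H0 M] [IsScalarTower k C.H0ᵐᵒᵖ M] :
    ∃ Φ : ConnectedComponents (DGA.RigidExt M C n) ≃ DGA.HoClasses M C hC (n + 2),
      (∀ (E : DGA.RigidExt M C n) {C' : DGA k} (q : C' ⟶ C) (hq : DGA.quasiIso k q)
        (a : C' ⟶ DGA.sqZero M C hC (n + 2)) (ha : a ≫ DGA.sqZeroProj M C hC (n + 2) = q),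
        DGA.IsHomotopyFiber hC E q a →
          Φ (Quotient.mk _ E) = DGA.homotopyClass C hC q hq a ha) ∧
      ∃ Ψ : ConnectedComponents (DGA.UnrigidExt M C n) ≃
          MulAction.orbitRel.Quotient (DGA.bimodAut M C) (DGA.HoClasses M C hC (n + 2)),
        ∀ E : DGA.RigidExt M C n,
          Ψ (Quotient.mk _ E.forget) = Quotient.mk _ (Φ (Quotient.mk _ E)) :=
  have hH (i : ℤ) (hi : (n : ℤ) < i) : Subsingleton (C.cx.homology i) := hn.subsingleton hi
  ⟨DGA.rigidEquiv hC hH, DGA.rigidEquiv_of_isHomotopyFiber hH,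
    Equiv.ofBijective _ (DGA.unrigidClass_bijective hH), DGA.unrigidClass_forget hH⟩
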